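/- Setting. Let $G$ be a compact, simply connected, semisimple Lie group (realized as a closed subgroup of some unitary group) with Lie algebra $LG$, let $T$ be a maximal torus, $R$ the real root system, defined by $[X,e_\alpha]=2\pi i\,\alpha(X)e_\alpha$ for $X\in LT$, let $S$ be a basis of $R$ with positive roots $R_+$ and open fundamental Weyl chamber $K(S)=\{H\in LT:\alpha(H)>0\ \forall\alpha\in S\}$. Fix a Chevalley–Weyl basis $\{h_{\alpha_j},e_\alpha:\alpha_j\in S,\ \alpha\in R\}$ of $LG_{\mathbb C}$ adapted to the compact form $LG$ (so $i h_{\alpha_j}\in LT$ and $e_\alpha+e_{-\alpha},\ i(e_\alpha-e_{-\alpha})\in LG$), and let $\mathcal C$ be the Chevalley automorphism $h_{\alpha_j}\mapsto-h_{\alpha_j}$, $e_\alpha\mapsto e_{-\alpha}$. Let $\tau_k=\sigma_k/(2i)$, where $\sigma_k$ are the Pauli matrices. A static, regular, spherically symmetric Einstein–Yang–Mills (EYM) configuration on $M=\mathbb R\times\mathbb R^3$ consists of a smooth metric $\alpha^2(dt^2-h)$, with $\alpha>0$ a function and $h$ a Riemannian metric on $\mathbb R^3$, both rotation invariant, and of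 an $SU(2)$-invariant connection, given in an adapted global gauge by a smooth, time-independent $LG$-valued one-form $A$ on $M$ with $$A_{(t,R_sx)}(c,R_sv)=\mathrm{Ad}(\Phi(s))\,A_{(t,x)}(c,v)\qquad(s\in SU(2))$$ for a continuous homomorphism $\Phi:SU(2)\to G$ (where $R_s$ is the rotation induced by $s$), without radial component, and with $A_{(t,0)}(\partial_t)=0$. Its electric part is $a(r)=A_{(0,re_3)}(\partial_t)$; its Wang map is $\Lambda_k(r)=L\Phi(\tau_k)+A_{(0,re_3)}(e_k\times re_3)$, so that $\Lambda_3=L\Phi(\tau_3)$. The configuration is generic if $\Lambda_3=-H_\lambda/(4\pi)$ with $H_\lambda\in K(S)$. Its magnetic amplitudes are the coefficients $w_\alpha(r)$ of $\Lambda_+=\Lambda_1+i\Lambda_2$ along $e_\alpha$, for $\alpha\in S(\lambda)=\{\alpha\in R_+:\alpha(H_\lambda)=2\}$; they are called real if, after a constant gauge transformation with some element of $T$ (which fixes their constant phases), $w_\alpha(r)\in\mathbb R$ for all $\alpha\in S(\lambda)$ and $r\ge0$. The field is purely magnetic if $a\equiv0$. The configuration is CP-symmetric if the metric is invariant under $\mathbf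 p:(t,x)\mapsto(t,-x)$ and $\mathcal C\circ\mathbf p^*A=\mathrm{Ad}(V^{-1})A+V^{-1}dV$ for some smooth $V:M\to G$. It is neutral if its magnetic charge vanishes, i.e. $r^2F_{(0,re_3)}(e_1,e_2)\to0$ as $r\to\infty$, where $F$ is the field strength of $A$. Proposition. (i) A static, regular, generic spherically symmetric EYM configuration is CP-symmetric if and only if the YM field is purely magnetic with real magnetic amplitudes. (ii) If such a configuration is purely magnetic with real magnetic amplitudes and neutral, then there is a global gauge, i.e. a smooth $V:M\to G$, such that $\mathrm{Ad}(V^{-1})A+V^{-1}dV$ is a time-independent spatial one-form $\mathcal A$ on $\mathbb R^3$ which vanishes at infinity; more precisely, $|x|\,|\mathcal A(x)|\to0$ as $|x|\to\infty$. -/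

import Mathlib

open scoped Matrix.Norms.L2Operator ContDiff Topology

attribute [local instance] LieRing.ofAssociativeRing LieAlgebra.ofAssociativeAlgebra

noncomputable section

namespace EYM

/-! ### Compact gauge groups, maximal tori, roots -/

/-- Complex `N × N` matrices. -/
abbrev Mat (N : ℕ) := Matrix (Fin N) (Fin N) ℂ

/-- The unitary group `U(N)`. A compact gauge group is a closed subgroup of some `U(N)`. -/
abbrev UGroup (N : ℕ) := Matrix.unitaryGroup (Fin N) ℂ

variable {N : ℕ}

/-- Velocities at the identity of curves in `G`. -/
def tangentSet (G : Subgroup (UGroup N)) : Set (Mat N) :=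
  {X | ∃ γ : ℝ → UGroup N, (∀ t, γ t ∈ G) ∧ γ 0 = 1 ∧
    HasDerivAt (fun t => (γ t : Mat N)) X 0}

/-- The tangent vectors at the identity form a real vector space. -/
def tangentSpaceOne (G : Subgroup (UGroup N)) : Submodule ℝ (Mat N) where
  carrier := tangentSet G
  zero_mem' := ⟨fun _ => 1, fun _ => G.one_mem, rfl, hasDerivAt_const _ _⟩
  add_mem' := by
    rintro X Y ⟨γ, hγ, hγ0, hX⟩ ⟨δ, hδ, hδ0, hY⟩
    refine ⟨fun t => γ t * δ t, fun t => G.mul_mem (hγ t) (hδ t), by simp [hγ0, hδ0], ?_⟩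
    have h := hX.mul hY
    simp only [hγ0, hδ0, OneMemClass.coe_one, mul_one, one_mul] at h
    exact h
  smul_mem' := by
    rintro c X ⟨γ, hγ, hγ0, hX⟩
    refine ⟨fun t => γ (c * t), fun t => hγ _, by simp [hγ0], ?_⟩
    have h1 : HasDerivAt (fun t : ℝ => c * t) c 0 := by
      simpa using (hasDerivAt_id (0 : ℝ)).const_mul c
    have h2 : HasDerivAt (fun t => (γ t : Mat N)) X (c * 0) := by simpa using hX
    exact h2.scomp (0 : ℝ) h1

theorem conj_mem_tangentSpaceOne {G : Subgroup (UGroup N)} {g : UGroup N} (hg : g ∈ G)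
    {Y : Mat N} (hY : Y ∈ tangentSpaceOne G) :
    (g : Mat N) * Y * star (g : Mat N) ∈ tangentSpaceOne G := by
  obtain ⟨δ, hδ, hδ0, hd⟩ := hY
  refine ⟨fun t => g * δ t * g⁻¹, fun t => G.mul_mem (G.mul_mem hg (hδ t)) (G.inv_mem hg),
    by simp [hδ0], ?_⟩
  exact (hd.const_mul (g : Mat N)).mul_const (star (g : Mat N))

theorem lie_mem_tangentSpaceOne {G : Subgroup (UGroup N)} {X Y : Mat N}
    (hX : X ∈ tangentSpaceOne G) (hY : Y ∈ tangentSpaceOne G) :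
    ⁅X, Y⁆ ∈ tangentSpaceOne G := by
  obtain ⟨γ, hγ, hγ0, hX⟩ := hX
  have hstar : HasDerivAt (fun t => star (γ t : Mat N)) (star X) 0 := hX.star
  have hskew : X + star X = 0 := by
    have h := hX.mul hstar
    have h' : HasDerivAt (fun _ : ℝ => (1 : Mat N)) (X + star X) 0 := by
      have e : (fun _ : ℝ => (1 : Mat N)) =
          (fun t => (γ t : Mat N)) * (fun t => star (γ t : Mat N)) := by
        funext t
        exact (Unitary.coe_mul_star_self (γ t)).symm
      rw [e]
      simpa [hγ0] using h
    exact h'.unique (hasDerivAt_const _ _)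
  have hstarX : star X = -X := by
    rw [eq_neg_iff_add_eq_zero, add_comm]; exact hskew
  have hZ : HasDerivAt (fun t => (γ t : Mat N) * Y * star (γ t : Mat N)) ⁅X, Y⁆ 0 := by
    have h := (hX.mul_const Y).mul hstar
    simp only [hγ0, hstarX, OneMemClass.coe_one, star_one, mul_one, one_mul, mul_neg,
      ← sub_eq_add_neg] at h
    exact h
  have hclosed : IsClosed (tangentSpaceOne G : Set (Mat N)) :=
    (tangentSpaceOne G).closed_of_finiteDimensional
  have hlim := hZ.tendsto_slope
  refine hclosed.mem_of_tendsto hlim (Filter.Eventually.of_forall fun t => ?_)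
  have hYm : Y ∈ tangentSpaceOne G := hY
  simp only [slope, vsub_eq_sub]
  exact (tangentSpaceOne G).smul_mem _ ((tangentSpaceOne G).sub_mem
    (conj_mem_tangentSpaceOne (hγ t) hYm) (conj_mem_tangentSpaceOne (hγ 0) hYm))

/-- The Lie algebra `LG` (tangent space at `1`, with the commutator). -/
def lieAlg (G : Subgroup (UGroup N)) : LieSubalgebra ℝ (Mat N) :=
  { tangentSpaceOne G with lie_mem' := fun hX hY => lie_mem_tangentSpaceOne hX hY }

/-- The complexification of `LG`, realised as `LG + i LG`
(a direct sum, because `LG` consists of anti-Hermitian matrices). -/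
def lieAlgC (G : Subgroup (UGroup N)) : Submodule ℂ (Mat N) :=
  Submodule.span ℂ (lieAlg G : Set (Mat N))

/-- `T` is a torus (closed, connected, abelian subgroup) in `G`. -/
structure IsTorusIn (T G : Subgroup (UGroup N)) : Prop where
  le : T ≤ G
  closed : IsClosed (T : Set (UGroup N))
  connected : IsConnected (T : Set (UGroup N))
  comm : ∀ x ∈ T, ∀ y ∈ T, x * y = y * x

/-- `T` is a maximal torus of `G`. -/
structure IsMaximalTorus (T G : Subgroup (UGroup N)) : Prop where
  torus : IsTorusIn T G
  maximal : ∀ T' : Subgroup (UGroup N), IsTorusIn T' G → T ≤ T' → T' = T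

/-- Real linear functionals on `LT`. -/
abbrev LTDual (T : Subgroup (UGroup N)) := Module.Dual ℝ (lieAlg T)

/-- `e` lies in the root space of the real functional `α`:
`[X, e] = 2πi α(X) e` for all `X ∈ LT`. -/
def InRootSpace (G T : Subgroup (UGroup N)) (α : LTDual T) (e : Mat N) : Prop :=
  e ∈ lieAlgC G ∧
    ∀ X : lieAlg T, ⁅(X : Mat N), e⁆ = (2 * (Real.pi : ℂ) * Complex.I * ((α X : ℝ) : ℂ)) • e

/-- The real root system `R` of `G` with respect to `T`. -/
def roots (G T : Subgroup (UGroup N)) : Set (LTDual T) :=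
  {α | α ≠ 0 ∧ ∃ e, e ≠ 0 ∧ InRootSpace G T α e}

/-- `S` is a basis of the root system `R`. -/
structure IsRootBase (G T : Subgroup (UGroup N)) (S : Set (LTDual T)) : Prop where
  subset : S ⊆ roots G T
  linearIndependent : LinearIndependent ℝ (fun α : S => (α : LTDual T))
  pos_or_neg : ∀ α ∈ roots G T, α ∈ AddSubmonoid.closure S ∨ -α ∈ AddSubmonoid.closure S

/-- The positive roots `R₊` determined by `S`. -/
def posRoots (G T : Subgroup (UGroup N)) (S : Set (LTDual T)) : Set (LTDual T) :=
  {α ∈ roots G T | α ∈ AddSubmonoid.closure S}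

/-- The open fundamental Weyl chamber `K(S)`. -/
def weylChamber {T : Subgroup (UGroup N)} (S : Set (LTDual T)) : Set (lieAlg T) :=
  {H | ∀ α ∈ S, 0 < α H}

/-- `S(λ)`: the positive roots with `α(H_λ) = 2`. -/
def levelTwoRoots (G T : Subgroup (UGroup N)) (S : Set (LTDual T)) (H : lieAlg T) :
    Set (LTDual T) :=
  {α ∈ posRoots G T S | α H = 2}

/-- A Chevalley-Weyl basis `{h_{α_j}, e_α | α_j ∈ S, α ∈ R}` of the complexified Lie algebra,
adapted to the compact real form `LG`: here `h_α = -[e_α, e_{-α}]` are the coroots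
(with `i h_α ∈ LT`), `e_α + e_{-α}` and `i (e_α - e_{-α})` lie in `LG`, and the structure constants
are real. The functional `α ↦ e α` is only relevant on the roots. -/
structure ChevalleyWeylBasis (G T : Subgroup (UGroup N)) (S : Set (LTDual T)) where
  /-- The root vectors `e_α`. -/
  e : LTDual T → Mat N
  /-- The vectors `h_α`. -/
  h : LTDual T → Mat N
  /-- The basis of the complexified Lie algebra. -/
  basis : Module.Basis (S ⊕ roots G T) ℂ (lieAlgC G)
  basis_inl : ∀ α : S, (basis (Sum.inl α) : Mat N) = h α
  basis_inr : ∀ α : roots G T, (basis (Sum.inr α) : Mat N) = e α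
  e_mem : ∀ α ∈ roots G T, InRootSpace G T α (e α)
  lie_e_neg : ∀ α ∈ roots G T, ⁅e α, e (-α)⁆ = -h α
  lie_h_e : ∀ α ∈ roots G T, ⁅h α, e α⁆ = (2 : ℂ) • e α
  I_smul_h_mem : ∀ α ∈ roots G T, Complex.I • h α ∈ lieAlg T
  add_mem : ∀ α ∈ roots G T, e α + e (-α) ∈ lieAlg G
  I_smul_sub_mem : ∀ α ∈ roots G T, Complex.I • (e α - e (-α)) ∈ lieAlg G
  lie_e_e : ∀ α ∈ roots G T, ∀ β ∈ roots G T, α + β ∈ roots G T →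
    ∃ c : ℝ, ⁅e α, e β⁆ = (c : ℂ) • e (α + β)

namespace ChevalleyWeylBasis

variable {G T : Subgroup (UGroup N)} {S : Set (LTDual T)}

/-- The Chevalley automorphism: the complex linear map with
`h_{α_j} ↦ -h_{α_j}`, `e_α ↦ e_{-α}`. -/
def chevalley (B : ChevalleyWeylBasis G T S) : lieAlgC G →ₗ[ℂ] Mat N :=
  B.basis.constr ℂ (Sum.elim (fun α : S => -B.h α) (fun α : roots G T => B.e (-(α : LTDual T))))

/-- The coefficient of `X` along `e_α`. -/
def coeff (B : ChevalleyWeylBasis G T S) (X : lieAlgC G) (α : roots G T) : ℂ :=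
  B.basis.repr X (Sum.inr α)

end ChevalleyWeylBasis

/-! ### `SU(2)` and rotations -/

/-- The group `SU(2)`. -/
abbrev SU2 := Matrix.specialUnitaryGroup (Fin 2) ℂ

/-- The generators `τ_k = σ_k / (2i)`, with `σ_k` the Pauli matrices
(indices `0, 1, 2` stand for `1, 2, 3`). -/
def tau : Fin 3 → Matrix (Fin 2) (Fin 2) ℂ :=
  ![(2 * Complex.I)⁻¹ • !![0, 1; 1, 0],
    (2 * Complex.I)⁻¹ • !![0, -Complex.I; Complex.I, 0],
    (2 * Complex.I)⁻¹ • !![1, 0; 0, -1]]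

/-- The matrix `exp (t τ_k) = cos (t/2) + 2 sin (t/2) τ_k` (note `(2 τ_k)² = -1`). -/
def expTauMat (k : Fin 3) (t : ℝ) : Matrix (Fin 2) (Fin 2) ℂ :=
  ((Real.cos (t / 2) : ℝ) : ℂ) • (1 : Matrix (Fin 2) (Fin 2) ℂ)
    + ((2 * Real.sin (t / 2) : ℝ) : ℂ) • tau k

theorem expTauMat_mem (k : Fin 3) (t : ℝ) :
    expTauMat k t ∈ Matrix.specialUnitaryGroup (Fin 2) ℂ := by
  have h1 : (Real.cos (t / 2) : ℂ) ^ 2 + (Real.sin (t / 2) : ℂ) ^ 2 = 1 := by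
    exact_mod_cast Real.cos_sq_add_sin_sq (t / 2)
  have hI : Complex.I ^ 2 = -1 := Complex.I_sq
  rw [Matrix.mem_specialUnitaryGroup_iff, Matrix.mem_unitaryGroup_iff]
  unfold expTauMat
  generalize Real.cos (t / 2) = c at *
  generalize Real.sin (t / 2) = u at *
  have h2 : (starRingEnd ℂ) 2 = 2 := Complex.conj_ofNat 2
  constructor
  · fin_cases k <;> ext i j <;> fin_cases i <;> fin_cases j <;>
      simp [tau, Matrix.mul_apply, Matrix.star_apply, h2] <;> ring_nf <;>
      simp [hI] <;> linear_combination h1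
  · fin_cases k <;> simp [tau, Matrix.det_fin_two] <;> ring_nf <;>
      simp [hI] <;> linear_combination h1

/-- The one-parameter subgroup `t ↦ exp (t τ_k)` of `SU(2)`. -/
def expTau (k : Fin 3) (t : ℝ) : SU2 := ⟨expTauMat k t, expTauMat_mem k t⟩

/-- Space `ℝ³`. -/
abbrev E3 := EuclideanSpace ℝ (Fin 3)

/-- Space-time `M = ℝ × ℝ³`, with points `(t, x)`. -/
abbrev M4 := ℝ × E3

/-- The rotation of `ℝ³` induced by `s ∈ SU(2)`: with `x · τ = ∑ x_k τ_k`, it is determined by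
`(rot s x) · τ = s (x · τ) s⁻¹`; the coordinates are read off with `tr (τ_j τ_k) = -δ_{jk}/2`. -/
def rot (s : SU2) (x : E3) : E3 :=
  WithLp.toLp 2 fun k => -2 * (Matrix.trace (tau k *
    ((s : Matrix (Fin 2) (Fin 2) ℂ) * (∑ j, ((x j : ℝ) : ℂ) • tau j)
      * star (s : Matrix (Fin 2) (Fin 2) ℂ)))).re

/-- The unit vector along the `k`-th axis of `ℝ³`. -/
def axis (k : Fin 3) : E3 := EuclideanSpace.single k 1

/-- The parity transformation `(t, x) ↦ (t, -x)`. -/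
def parity : M4 →L[ℝ] M4 :=
  (ContinuousLinearMap.fst ℝ ℝ E3).prod (-ContinuousLinearMap.snd ℝ ℝ E3)

/-! ### Gauge potentials -/

/-- Matrix-valued one-forms on space-time. -/
abbrev OneForm (N : ℕ) := M4 → M4 →L[ℝ] Mat N

/-- A global gauge transformation: a smooth map `M → G`. -/
structure IsGaugeTransformation (G : Subgroup (UGroup N)) (V : M4 → UGroup N) : Prop where
  mem : ∀ m, V m ∈ G
  smooth : ContDiff ℝ ∞ (fun m => (V m : Mat N))

/-- The gauge transformed potential `Ad(V⁻¹) A + V⁻¹ dV`, evaluated at the point `m` on the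
tangent vector `v`. -/
def gaugeTransform (A : OneForm N) (V : M4 → UGroup N) (m v : M4) : Mat N :=
  (((V m)⁻¹ : UGroup N) : Mat N) * A m v * (V m : Mat N)
    + (((V m)⁻¹ : UGroup N) : Mat N) * fderiv ℝ (fun m' => (V m' : Mat N)) m v

/-- The field strength `F = dA + A ∧ A`. -/
def curvature (A : OneForm N) (m u v : M4) : Mat N :=
  fderiv ℝ A m u v - fderiv ℝ A m v u + ⁅A m u, A m v⁆

/-! ### Static, regular, spherically symmetric EYM configurations -/

/-- A static, regular, spherically symmetric Einstein-Yang-Mills configuration on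
`M = ℝ × ℝ³` with gauge group `G`, in the adapted global gauge.
The metric is `α² (dt² - h)`. The Yang-Mills field is an `SU(2)`-invariant connection on a principal
bundle with `SU(2)`-action; over `M` this is the trivial bundle on which `s ∈ SU(2)` acts by
`(m, g) ↦ (s m, Φ(s) g)`, and the connection is given by a globally defined potential. -/
structure Configuration (G : Subgroup (UGroup N)) where
  /-- The conformal factor `α` of the static metric. -/
  lapse : E3 → ℝ
  /-- The Riemannian metric `h` on `ℝ³`. -/
  h : E3 → E3 →L[ℝ] E3 →L[ℝ] ℝ
  lapse_smooth : ContDiff ℝ ∞ lapse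
  lapse_pos : ∀ x, 0 < lapse x
  h_smooth : ContDiff ℝ ∞ h
  h_symm : ∀ x v w, h x v w = h x w v
  h_pos : ∀ x v, v ≠ 0 → 0 < h x v v
  lapse_rot : ∀ (s : SU2) (x : E3), lapse (rot s x) = lapse x
  h_rot : ∀ (s : SU2) (x v w : E3), h (rot s x) (rot s v) (rot s w) = h x v w
  /-- The homomorphism `Φ : SU(2) → G` which describes the `SU(2)`-action over the origin. -/
  Phi : SU2 →* UGroup N
  Phi_continuous : Continuous Phi
  Phi_mem : ∀ s, Phi s ∈ G
  /-- The gauge potential. -/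
  A : OneForm N
  A_mem : ∀ m v, A m v ∈ lieAlg G
  A_smooth : ContDiff ℝ ∞ A
  /-- The potential is time-independent. -/
  A_static : ∀ (t : ℝ) (x : E3), A (t, x) = A (0, x)
  /-- The potential is `SU(2)`-invariant. -/
  A_rot : ∀ (s : SU2) (t : ℝ) (x : E3) (c : ℝ) (v : E3),
    A (t, rot s x) (c, rot s v)
      = (Phi s : Mat N) * A (t, x) (c, v) * star (Phi s : Mat N)
  /-- The potential has no radial component. -/
  A_radial : ∀ (t : ℝ) (x : E3), A (t, x) (0, x) = 0
  /-- The electric part vanishes at the origin. -/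
  A_time_zero : ∀ t : ℝ, A (t, 0) (1, 0) = 0

namespace Configuration

variable {G T : Subgroup (UGroup N)} {S : Set (LTDual T)}

/-- The space-time metric `g = α² (dt² - h)`. -/
def metric (c : Configuration G) (m v w : M4) : ℝ :=
  c.lapse m.2 ^ 2 * (v.1 * w.1 - c.h m.2 v.2 w.2)

/-- `LΦ(τ_k)`: the infinitesimal homomorphism belonging to `Φ`. -/
def LPhi (c : Configuration G) (k : Fin 3) : Mat N :=
  deriv (fun t : ℝ => (c.Phi (expTau k t) : Mat N)) 0

/-- The vector at `x` of the rotation generated by `τ_k`, namely `e_k × x`. -/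
def rotField (k : Fin 3) (x : E3) : E3 :=
  WithLp.toLp 2 (crossProduct (WithLp.ofLp (axis k)) (WithLp.ofLp x))

/-- The Wang map: `Λ_k(r) = LΦ(τ_k) + A(X_k)` at the point `r e_3` of the third axis, where `X_k` is
the vector field of the rotation generated by `τ_k`. -/
def wang (c : Configuration G) (k : Fin 3) (r : ℝ) : Mat N :=
  c.LPhi k + c.A (0, r • axis 2) (0, rotField k (r • axis 2))

/-- The electric part `a(r)`: the `dt`-component of the potential on the third axis. -/
def electric (c : Configuration G) (r : ℝ) : Mat N :=
  c.A (0, r • axis 2) (1, 0)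

theorem LPhi_mem (c : Configuration G) (k : Fin 3) : c.LPhi k ∈ lieAlg G := by
  by_cases hd : DifferentiableAt ℝ (fun t : ℝ => (c.Phi (expTau k t) : Mat N)) 0
  · refine ⟨fun t => c.Phi (expTau k t), fun t => c.Phi_mem _, ?_, hd.hasDerivAt⟩
    have h : expTau k 0 = 1 := Subtype.ext (by simp [expTau, expTauMat])
    simp [h]
  · rw [LPhi, deriv_zero_of_not_differentiableAt hd]
    exact (lieAlg G).zero_mem

theorem wang_mem (c : Configuration G) (k : Fin 3) (r : ℝ) : c.wang k r ∈ lieAlg G :=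
  (lieAlg G).add_mem (c.LPhi_mem k) (c.A_mem _ _)

/-- `Ad(g⁻¹) Λ₊(r)`, where `Λ₊ = Λ_1 + i Λ_2`. -/
def wangPlusMat (c : Configuration G) (g : G) (r : ℝ) : Mat N :=
  star ((g : UGroup N) : Mat N) * (c.wang 0 r + Complex.I • c.wang 1 r) * ((g : UGroup N) : Mat N)

theorem wangPlusMat_mem (c : Configuration G) (g : G) (r : ℝ) :
    c.wangPlusMat g r ∈ lieAlgC G := by
  have key : ∀ k, star ((g : UGroup N) : Mat N) * c.wang k r * ((g : UGroup N) : Mat N)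
      ∈ lieAlgC G := fun k => by
    have h := conj_mem_tangentSpaceOne (G.inv_mem g.2) (c.wang_mem k r)
    have e : (((g : UGroup N)⁻¹ : UGroup N) : Mat N) = star ((g : UGroup N) : Mat N) := rfl
    rw [e, star_star] at h
    exact Submodule.subset_span h
  have e : c.wangPlusMat g r =
      star ((g : UGroup N) : Mat N) * c.wang 0 r * ((g : UGroup N) : Mat N) +
      Complex.I • (star ((g : UGroup N) : Mat N) * c.wang 1 r * ((g : UGroup N) : Mat N)) := by
    simp [wangPlusMat, mul_add, add_mul]
  rw [e]
  exact (lieAlgC G).add_mem (key 0) ((lieAlgC G).smul_mem _ (key 1))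

/-- The magnetic amplitudes `w_α(r)`: the coefficients of `Λ₊(r)` along the root vectors `e_α`,
after the constant gauge transformation with `g`. -/
def amplitude (c : Configuration G) (B : ChevalleyWeylBasis G T S) (g : G) (r : ℝ)
    (α : roots G T) : ℂ :=
  B.coeff ⟨c.wangPlusMat g r, c.wangPlusMat_mem g r⟩ α

/-- The configuration is purely magnetic: the electric part vanishes. -/
def IsPurelyMagnetic (c : Configuration G) : Prop :=
  ∀ r : ℝ, 0 ≤ r → c.electric r = 0

/-- The magnetic amplitudes `w_α`, `α ∈ S(λ)`, are real, the constant phases being fixed by a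
constant gauge transformation with an element `g` of the maximal torus. -/
def HasRealAmplitudes (c : Configuration G) (B : ChevalleyWeylBasis G T S) (Hl : lieAlg T) : Prop :=
  ∃ g : G, (g : UGroup N) ∈ T ∧
    ∀ α : roots G T, (α : LTDual T) ∈ levelTwoRoots G T S Hl →
      ∀ r : ℝ, 0 ≤ r → (c.amplitude B g r α).im = 0

/-- `H_λ ∈ LT` is the classifying element of the configuration (`Λ_3 = -H_λ / (4π)`), and it lies in
the open fundamental Weyl chamber. -/
def IsGeneric (c : Configuration G) (S : Set (LTDual T)) (Hl : lieAlg T) : Prop :=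
  c.LPhi 2 = -((4 * Real.pi)⁻¹ • (Hl : Mat N)) ∧ Hl ∈ weylChamber S

/-- The configuration is CP-symmetric: the metric is parity-invariant, and the potential
`𝒞 ∘ p^* A`, with `𝒞` the Chevalley automorphism, is equal to `A` up to a global gauge
transformation. -/
def IsCPSymmetric (c : Configuration G) (B : ChevalleyWeylBasis G T S) : Prop :=
  (∀ m v w : M4, c.metric (parity m) (parity v) (parity w) = c.metric m v w) ∧
  ∃ V : M4 → UGroup N, IsGaugeTransformation G V ∧ ∀ m v : M4,
    B.chevalley ⟨c.A (parity m) (parity v), Submodule.subset_span (c.A_mem _ _)⟩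
      = gaugeTransform c.A V m v

/-- The configuration is neutral: its magnetic charge vanishes, i.e. the flux density
`r² F(e_1, e_2)` of the field strength through the sphere of radius `r`, taken at `r e_3`,
tends to zero at infinity. -/
def IsNeutral (c : Configuration G) : Prop :=
  Filter.Tendsto
    (fun r : ℝ => r ^ 2 • curvature c.A (0, r • axis 2) (0, axis 0) (0, axis 1))
    Filter.atTop (𝓝 0)

/-- There is a global gauge in which the Yang-Mills field is described by a (smooth)
time-independent spatial one-form `a` on `ℝ³` which vanishes at infinity, in the sense that even
`|x| |a(x)|` tends to zero. -/
def HasVanishingSpatialGauge (c : Configuration G) : Prop :=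
  ∃ V : M4 → UGroup N, IsGaugeTransformation G V ∧
    ∃ a : E3 → E3 →L[ℝ] Mat N, ContDiff ℝ ∞ a ∧ (∀ x v, a x v ∈ lieAlg G) ∧
      (∀ (t : ℝ) (x : E3) (s : ℝ) (v : E3), gaugeTransform c.A V (t, x) (s, v) = a x v) ∧
      Filter.Tendsto (fun x : E3 => ‖x‖ * ‖a x‖) (Filter.cocompact E3) (𝓝 0)

end Configuration

end EYM
end

open EYM

/-!
The Chevalley automorphism is handled through its conjugates `Θ = Ad (g * g) ∘ 𝒞` by elements `g` of
the torus (`IsTwist`). With `Λ_k` the Wang map, the amplitudes are real after the gauge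
transformation `g` exactly when `Θ Λ_1 = Λ_1` and `Θ Λ_2 = -Λ_2`
(`Configuration.hasRealAmplitudes_iff`). If this holds at the origin, where `Λ_k = LΦ(τ_k)`, then
`Θ` followed by the adjoint action of the rotation by `π` about the first axis centralizes the image
of `SU(2)`, and the reflected potential at any point is expressed by `Θ` and by the potential on the
third axis (`Configuration.twist_A_neg`). Hence real amplitudes and the absence of an electric part
give a constant gauge transformation which implements CP.

Conversely, the potential has no radial component, so a gauge transformation `V` implementing CP is
constant. The phases at the origin can be fixed by the torus, because the roots of level two are
linearly independent (`ChevalleyWeylBasis.exists_root_values`). This yields an element `k` of `G`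
such that `Ad k ∘ Ad Φ(s)` maps `Θ A` to `Ad Φ(s) A` for all `s`, where `A` is the potential on the
third axis and the argument of `Θ A` is reflected along the first axis. Applied to the electric part
`a` and to `q = [LΦ(τ_1), Λ_1] + [LΦ(τ_2), Λ_2]`, both in the Lie algebra of the torus, this says
that `k` acts as `-1` on a subspace which contains them and is invariant under `SU(2)`.

The central fact is that such a subspace contains no nonzero anti-Hermitian vector `u` commuting
with `LΦ(τ_3)` (`eq_zero_of_Ad_eq_neg`). The triple `LΦ(τ_k)` is the sum of two commuting triples,
`P` inside the Lie algebra generated by the subspace and `M` centralizing it. Then `k` fixes `P_3`,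
and `u` commutes with `M` and with `P_3`. In the centralizer of `P_3` genericity excludes the weight
zero of `M` from the image of `ad u`, so only half-odd weights occur there, and those on the
brackets of two such vectors are integral. This allows `k` to be corrected to an element that still
reverses `u` and commutes with `P_3` and with the third element of the part of `M` spanned by these
brackets. As `G` is connected, the corrected element is the exponential of some `Z` commuting with
both; now `[u, Z]` has weight zero, hence vanishes, and `u` is both fixed and reversed.

So `a = 0` and `q = 0`; the latter makes `Λ_+ - Θ Λ_-` a lowest weight vector of positive weight, so
it vanishes (`Configuration.twist_eq_of_lie_add_eq_zero`), and the amplitudes are real.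

For a neutral field `[Λ_1, Λ_2]` tends to `LΦ(τ_3) = [LΦ(τ_1), LΦ(τ_2)]`. Pairing with the torus
shows that the squares of the real amplitudes tend to their nonzero values at the origin, so each
amplitude tends to its value at the origin up to a sign, and `Λ_k` tends to `Ad (exp X) LΦ(τ_k)` for
some `X` in the Lie algebra of the torus (`Configuration.exists_tendsto_wang`). The field on the
punctured space that is equivariant under `SU(2)` and equal to `X` on the third axis is smooth; cut
off near the origin and exponentiated, it is the required gauge transformation. On the
third axis the new potential along the rotation fields is `Ad (exp (-X)) Λ_k - LΦ(τ_k)`, which tends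
to zero.
-/

noncomputable section

namespace EYM

open NormedSpace Filter

variable {N : ℕ}

/-! ### The trace form on complex matrices -/

/-- The Hilbert-Schmidt inner product `tr (x* y)`. -/
def ip (x y : Mat N) : ℂ := (star x * y).trace

theorem ip_add_right (x y z : Mat N) : ip x (y + z) = ip x y + ip x z := by
  simp [ip, mul_add]

theorem ip_add_left (x y z : Mat N) : ip (x + y) z = ip x z + ip y z := by
  simp [ip, add_mul]

theorem ip_sub_right (x y z : Mat N) : ip x (y - z) = ip x y - ip x z := by
  simp [ip, mul_sub]

theorem ip_sub_left (x y z : Mat N) : ip (x - y) z = ip x z - ip y z := by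
  simp [ip, sub_mul]

theorem ip_smul_right (c : ℂ) (x y : Mat N) : ip x (c • y) = c * ip x y := by
  simp [ip]

theorem ip_smul_left (c : ℂ) (x y : Mat N) : ip (c • x) y = star c * ip x y := by
  simp [ip]

@[simp] theorem ip_zero_left (x : Mat N) : ip 0 x = 0 := by simp [ip]

@[simp] theorem ip_zero_right (x : Mat N) : ip x 0 = 0 := by simp [ip]

theorem ip_conj_symm (x y : Mat N) : star (ip x y) = ip y x := by
  simp only [ip, Matrix.star_eq_conjTranspose, ← Matrix.trace_conjTranspose,
    Matrix.conjTranspose_mul, Matrix.conjTranspose_conjTranspose]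

open scoped ComplexOrder in
theorem ip_self_eq_zero {x : Mat N} : ip x x = 0 ↔ x = 0 :=
  Matrix.trace_conjTranspose_mul_self_eq_zero_iff

theorem ip_self_eq_sum (x : Mat N) : ip x x = ((∑ i, ∑ j, ‖x j i‖ ^ 2 : ℝ) : ℂ) := by
  simp only [ip, Matrix.trace, Matrix.diag, Matrix.mul_apply, Matrix.star_apply]
  push_cast
  refine Finset.sum_congr rfl fun i _ => Finset.sum_congr rfl fun j _ => ?_
  rw [← Complex.conj_mul']; rfl

theorem ip_self_re_nonneg (x : Mat N) : 0 ≤ (ip x x).re := by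
  rw [ip_self_eq_sum, Complex.ofReal_re]; positivity

theorem ip_self_im (x : Mat N) : (ip x x).im = 0 := by
  rw [ip_self_eq_sum, Complex.ofReal_im]

theorem ip_self_re_eq_zero {x : Mat N} : (ip x x).re = 0 ↔ x = 0 := by
  rw [← ip_self_eq_zero]
  exact ⟨fun h => Complex.ext h (ip_self_im x), fun h => by rw [h]; rfl⟩

theorem ip_lie_left (a x y : Mat N) : ip ⁅a, x⁆ y = ip x ⁅star a, y⁆ := by
  simp only [ip, Ring.lie_def, star_sub, star_mul, sub_mul, mul_sub, Matrix.trace_sub,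
    Matrix.mul_assoc]
  rw [Matrix.trace_mul_comm (star a)]
  simp only [Matrix.mul_assoc]

theorem ip_lie_right (a x y : Mat N) : ip x ⁅a, y⁆ = ip ⁅star a, x⁆ y := by
  rw [ip_lie_left, star_star]

@[simp] theorem ip_neg_right (x y : Mat N) : ip x (-y) = -ip x y := by simp [ip]

@[simp] theorem ip_neg_left (x y : Mat N) : ip (-x) y = -ip x y := by simp [ip]

theorem ip_re_comm (x y : Mat N) : (ip x y).re = (ip y x).re := by
  rw [← ip_conj_symm y x]; rfl

theorem star_lie_mat (x y : Mat N) : star ⁅x, y⁆ = ⁅star y, star x⁆ := by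
  simp [Ring.lie_def]

/-- The operator norm is controlled by the Hilbert-Schmidt norm. -/
theorem exists_norm_sq_le_ip (N : ℕ) :
    ∃ C : ℝ, 0 < C ∧ ∀ x : Mat N, ‖x‖ ^ 2 ≤ C * (ip x x).re := by
  set D : ℝ := ∑ i : Fin N, ∑ j : Fin N, ‖(Matrix.single i j 1 : Mat N)‖ with hD
  have hD0 : 0 ≤ D := by positivity
  refine ⟨D ^ 2 + 1, by positivity, fun x => ?_⟩
  have hx : ∀ i j, ‖x i j‖ ≤ Real.sqrt (ip x x).re := fun i j => by
    apply Real.le_sqrt_of_sq_le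
    rw [ip_self_eq_sum, Complex.ofReal_re]
    calc ‖x i j‖ ^ 2 ≤ ∑ k, ‖x k j‖ ^ 2 :=
          Finset.single_le_sum (f := fun k => ‖x k j‖ ^ 2) (fun _ _ => by positivity)
            (Finset.mem_univ i)
      _ ≤ _ := Finset.single_le_sum (f := fun l => ∑ k, ‖x k l‖ ^ 2)
            (fun _ _ => by positivity) (Finset.mem_univ j)
  have h : ‖x‖ ≤ D * Real.sqrt (ip x x).re := by
    conv_lhs => rw [Matrix.matrix_eq_sum_single x]
    refine (norm_sum_le _ _).trans ?_
    rw [hD, Finset.sum_mul]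
    refine Finset.sum_le_sum fun i _ => (norm_sum_le _ _).trans ?_
    rw [Finset.sum_mul]
    refine Finset.sum_le_sum fun j _ => ?_
    have e : (Matrix.single i j (x i j) : Mat N) = x i j • Matrix.single i j 1 := by simp
    rw [e, norm_smul, mul_comm]
    exact mul_le_mul_of_nonneg_left (hx i j) (norm_nonneg _)
  calc ‖x‖ ^ 2 ≤ (D * Real.sqrt (ip x x).re) ^ 2 := by gcongr
    _ = D ^ 2 * (ip x x).re := by rw [mul_pow, Real.sq_sqrt (ip_self_re_nonneg x)]
    _ ≤ _ := by nlinarith [ip_self_re_nonneg x]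

theorem exists_trace_mul_le (N : ℕ) :
    ∃ C : ℝ, 0 < C ∧ ∀ x y : Mat N, |(x * y).trace.re| ≤ C * (‖x‖ * ‖y‖) := by
  let T : Mat N →L[ℝ] ℝ := LinearMap.toContinuousLinearMap
    (Complex.reLm.comp ((Matrix.traceLinearMap (Fin N) ℝ ℂ)))
  refine ⟨‖T‖ + 1, by positivity, fun x y => ?_⟩
  calc |(x * y).trace.re| = ‖T (x * y)‖ := rfl
    _ ≤ ‖T‖ * ‖x * y‖ := T.le_opNorm _
    _ ≤ ‖T‖ * (‖x‖ * ‖y‖) := by gcongr; exact norm_mul_le _ _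
    _ ≤ _ := by nlinarith [mul_nonneg (norm_nonneg x) (norm_nonneg y)]

/-! ### Matrix exponentials -/

theorem continuous_exp_mat : Continuous (exp : Mat N → Mat N) :=
  let := NormedAlgebra.restrictScalars ℚ ℝ (Mat N)
  exp_continuous

theorem hasDerivAt_exp_smul (X : Mat N) (t : ℝ) :
    HasDerivAt (fun s : ℝ => exp (s • X)) (exp (t • X) * X) t :=
  hasDerivAt_exp_smul_const X t

theorem hasDerivAt_exp_smul' (X : Mat N) (t : ℝ) :
    HasDerivAt (fun s : ℝ => exp (s • X)) (X * exp (t • X)) t :=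
  hasDerivAt_exp_smul_const' X t

theorem star_exp_skew {X : Mat N} (hX : star X = -X) : star (exp X) = exp (-X) := by
  rw [star_exp, hX]

theorem exp_mul_exp_neg (X : Mat N) : exp X * exp (-X) = 1 := by
  rw [← Matrix.exp_add_of_commute _ _ (Commute.neg_right (Commute.refl X))]; simp

theorem exp_neg_mul_exp (X : Mat N) : exp (-X) * exp X = 1 := by
  simpa using exp_mul_exp_neg (-X)

theorem exp_skew_mem {X : Mat N} (hX : star X = -X) : exp X ∈ Matrix.unitaryGroup (Fin N) ℂ := by
  rw [Matrix.mem_unitaryGroup_iff, star_exp_skew hX, exp_mul_exp_neg]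

/-- `exp X` as an element of the unitary group, for `X` anti-Hermitian. -/
def expU (X : Mat N) (hX : star X = -X) : UGroup N := ⟨exp X, exp_skew_mem hX⟩

@[simp] theorem coe_expU (X : Mat N) (hX : star X = -X) : (expU X hX : Mat N) = exp X := rfl

theorem star_smul_skew {X : Mat N} (hX : star X = -X) (t : ℝ) : star (t • X) = -(t • X) := by
  simp [hX]

theorem norm_coe_unitary_le (g : UGroup N) : ‖(g : Mat N)‖ ≤ 1 := by
  rcases subsingleton_or_nontrivial (Mat N) with h | h
  · rw [Subsingleton.elim (g : Mat N) 0]; simp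
  · exact (CStarRing.norm_of_mem_unitary g.2).le

theorem coe_mul_star (g : UGroup N) : (g : Mat N) * star (g : Mat N) = 1 :=
  Unitary.coe_mul_star_self g

theorem star_mul_coe (g : UGroup N) : star (g : Mat N) * (g : Mat N) = 1 :=
  Unitary.coe_star_mul_self g

end EYM
end

noncomputable section

namespace EYM

open NormedSpace Filter

variable {N : ℕ}

/-! ### Closed subgroups of the unitary group -/

theorem star_eq_neg_of_mem {K : Subgroup (UGroup N)} {X : Mat N} (hX : X ∈ lieAlg K) :
    star X = -X := by
  obtain ⟨γ, -, hγ0, hX⟩ := hX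
  have h := hX.mul hX.star
  have h' : HasDerivAt (fun _ : ℝ => (1 : Mat N)) (X + star X) 0 := by
    have e : (fun _ : ℝ => (1 : Mat N)) =
        (fun t => (γ t : Mat N)) * (fun t => star (γ t : Mat N)) := by
      funext t
      exact (coe_mul_star (γ t)).symm
    rw [e]
    simpa [hγ0] using h
  have := h'.unique (hasDerivAt_const _ _)
  rw [eq_neg_iff_add_eq_zero, add_comm]; exact this

/-- The elements of a subgroup of `U(N)`, as a set of matrices. -/
def matSet (K : Subgroup (UGroup N)) : Set (Mat N) := (fun g : UGroup N => (g : Mat N)) '' K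

theorem one_mem_matSet (K : Subgroup (UGroup N)) : (1 : Mat N) ∈ matSet K := ⟨1, K.one_mem, rfl⟩

theorem mul_mem_matSet {K : Subgroup (UGroup N)} {a b : Mat N} (ha : a ∈ matSet K)
    (hb : b ∈ matSet K) : a * b ∈ matSet K := by
  obtain ⟨a, ha, rfl⟩ := ha
  obtain ⟨b, hb, rfl⟩ := hb
  exact ⟨a * b, K.mul_mem ha hb, rfl⟩

theorem star_mem_matSet {K : Subgroup (UGroup N)} {a : Mat N} (ha : a ∈ matSet K) :
    star a ∈ matSet K := by
  obtain ⟨a, ha, rfl⟩ := ha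
  exact ⟨a⁻¹, K.inv_mem ha, rfl⟩

theorem pow_mem_matSet {K : Subgroup (UGroup N)} {a : Mat N} (ha : a ∈ matSet K) (n : ℕ) :
    a ^ n ∈ matSet K := by
  induction n with
  | zero => simpa using one_mem_matSet K
  | succ n ih => rw [pow_succ]; exact mul_mem_matSet ih ha

theorem isCompact_unitary (N : ℕ) : IsCompact (Matrix.unitaryGroup (Fin N) ℂ : Set (Mat N)) := by
  refine Metric.isCompact_of_isClosed_isBounded ?_ ?_
  · have : (Matrix.unitaryGroup (Fin N) ℂ : Set (Mat N)) = {x | x * star x = 1} := by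
      ext x; exact Matrix.mem_unitaryGroup_iff
    rw [this]
    exact isClosed_eq (by fun_prop) continuous_const
  · refine (Metric.isBounded_closedBall (x := (0 : Mat N)) (r := 1)).subset fun x hx => ?_
    rw [mem_closedBall_zero_iff]
    exact norm_coe_unitary_le ⟨x, hx⟩

theorem isCompact_matSet {K : Subgroup (UGroup N)} (hK : IsClosed (K : Set (UGroup N))) :
    IsCompact (matSet K) := by
  have : CompactSpace (UGroup N) := isCompact_iff_compactSpace.1 (isCompact_unitary N)
  exact hK.isCompact.image continuous_subtype_val

theorem mem_lieAlg_of_exp_mem {K : Subgroup (UGroup N)} {X : Mat N}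
    (h : ∀ t : ℝ, exp (t • X) ∈ matSet K) : X ∈ lieAlg K := by
  choose γ hγ hγe using h
  refine ⟨γ, hγ, Subtype.ext (by simp [hγe]), ?_⟩
  simp only [hγe]
  simpa using hasDerivAt_exp_smul X 0

theorem norm_pow_sub_pow_le {a b : Mat N} (hb : ‖b‖ ≤ 1)
    (ha' : ∀ n : ℕ, ‖a ^ n‖ ≤ 1) (n : ℕ) : ‖a ^ n - b ^ n‖ ≤ n * ‖a - b‖ := by
  induction n with
  | zero => simp
  | succ n ih =>
    have e : a ^ (n + 1) - b ^ (n + 1) = a ^ n * (a - b) + (a ^ n - b ^ n) * b := by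
      rw [pow_succ, pow_succ]; noncomm_ring
    rw [e]
    calc _ ≤ ‖a ^ n‖ * ‖a - b‖ + ‖a ^ n - b ^ n‖ * ‖b‖ :=
          (norm_add_le _ _).trans (add_le_add (norm_mul_le _ _) (norm_mul_le _ _))
      _ ≤ 1 * ‖a - b‖ + (n * ‖a - b‖) * 1 := by gcongr; exact ha' n
      _ = _ := by push_cast; ring

/-- The exponential of the velocity of a curve `γ` at `1` is the limit of `γ (1/n) ^ n`. -/
theorem tendsto_pow_exp {X : Mat N} (hskew : star X = -X) {γ : ℝ → UGroup N} (hγ0 : γ 0 = 1)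
    (hd : HasDerivAt (fun t => (γ t : Mat N)) X 0) :
    Tendsto (fun n : ℕ => ((γ ((n : ℝ) + 1)⁻¹ : UGroup N) : Mat N) ^ (n + 1)) atTop
      (𝓝 (exp X)) := by
  have hdiff : HasDerivAt (fun t : ℝ => (γ t : Mat N) - exp (t • X)) 0 0 := by
    have := hd.fun_sub (hasDerivAt_exp_smul X 0)
    rwa [zero_smul, exp_zero, one_mul, sub_self] at this
  rw [tendsto_iff_norm_sub_tendsto_zero]
  have h0 : Tendsto (fun n : ℕ => ((n : ℝ) + 1)⁻¹) atTop (𝓝[≠] 0) := by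
    refine tendsto_nhdsWithin_iff.2 ⟨?_, Eventually.of_forall fun n => ?_⟩
    · simpa using tendsto_one_div_add_atTop_nhds_zero_nat (𝕜 := ℝ)
    · have : (0 : ℝ) < ((n : ℝ) + 1)⁻¹ := by positivity
      exact this.ne'
  have h1 := (hasDerivAt_iff_tendsto_slope.1 hdiff).comp h0
  have h2 := h1.norm
  simp only [norm_zero] at h2
  refine squeeze_zero (fun _ => norm_nonneg _) (fun n => ?_) h2
  have hn : (0 : ℝ) < (n : ℝ) + 1 := by positivity
  have e1 : exp X = exp ((((n : ℝ) + 1)⁻¹) • X) ^ (n + 1) := by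
    rw [← Matrix.exp_nsmul, ← Nat.cast_smul_eq_nsmul ℝ, smul_smul]
    push_cast
    rw [mul_inv_cancel₀ hn.ne', one_smul]
  rw [e1]
  refine (norm_pow_sub_pow_le
    (norm_coe_unitary_le (expU _ (star_smul_skew hskew _)))
    (fun k => norm_coe_unitary_le (γ _ ^ k)) (n + 1)).trans (le_of_eq ?_)
  simp only [Function.comp, slope, vsub_eq_sub, hγ0, sub_zero, inv_inv, norm_smul, zero_smul,
    exp_zero, OneMemClass.coe_one, sub_self]
  rw [Real.norm_of_nonneg hn.le]
  push_cast; rfl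

theorem exp_mem_matSet {K : Subgroup (UGroup N)} (hK : IsClosed (K : Set (UGroup N))) {X : Mat N}
    (hX : X ∈ lieAlg K) : exp X ∈ matSet K := by
  have hskew := star_eq_neg_of_mem hX
  obtain ⟨γ, hγ, hγ0, hd⟩ := hX
  exact (isCompact_matSet hK).isClosed.mem_of_tendsto (tendsto_pow_exp hskew hγ0 hd)
    (Eventually.of_forall fun n => pow_mem_matSet ⟨_, hγ _, rfl⟩ _)

theorem exp_smul_mem_matSet {K : Subgroup (UGroup N)} (hK : IsClosed (K : Set (UGroup N)))
    {X : Mat N} (hX : X ∈ lieAlg K) (t : ℝ) : exp (t • X) ∈ matSet K :=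
  exp_mem_matSet hK ((lieAlg K).smul_mem t hX)

/-- Small exponentials in directions complementary to the Lie algebra leave the group. -/
theorem exists_exp_complement {K : Subgroup (UGroup N)} (hK : IsClosed (K : Set (UGroup N)))
    {W : Submodule ℝ (Mat N)} (hW : Disjoint (tangentSpaceOne K) W) :
    ∃ δ > 0, ∀ Y ∈ W, ‖Y‖ < δ → exp Y ∈ matSet K → Y = 0 := by
  by_contra hcon
  push Not at hcon
  have hc : ∀ n : ℕ, ∃ Y ∈ W, ‖Y‖ < ((n : ℝ) + 1)⁻¹ ∧ exp Y ∈ matSet K ∧ Y ≠ 0 :=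
    fun n => hcon _ (by positivity)
  choose Y hYW hYn hYe hY0 using hc
  have hYpos : ∀ n, 0 < ‖Y n‖ := fun n => norm_pos_iff.2 (hY0 n)
  have hYlim : Tendsto (fun n => ‖Y n‖) atTop (𝓝 0) :=
    squeeze_zero (fun _ => norm_nonneg _) (fun n => (hYn n).le)
      (by simpa using tendsto_one_div_add_atTop_nhds_zero_nat (𝕜 := ℝ))
  obtain ⟨Z, hZ, φ, hφ, hlim⟩ := (isCompact_sphere (0 : Mat N) 1).tendsto_subseq
    (x := fun n => ‖Y n‖⁻¹ • Y n) (fun n => by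
      rw [mem_sphere_zero_iff_norm, norm_smul, norm_inv, norm_norm,
        inv_mul_cancel₀ (hYpos n).ne'])
  have hZW : Z ∈ W := (W.closed_of_finiteDimensional).mem_of_tendsto hlim
    (Eventually.of_forall fun n => W.smul_mem _ (hYW _))
  have hZK : Z ∈ lieAlg K := by
    refine mem_lieAlg_of_exp_mem fun t => ?_
    -- multiples `m Y` with integers `m` close to `t / ‖Y‖` approximate `t Z`
    set m : ℕ → ℤ := fun n => ⌊t / ‖Y (φ n)‖⌋ with hm
    have hcoef : Tendsto (fun n => (m n : ℝ) * ‖Y (φ n)‖) atTop (𝓝 t) := by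
      rw [tendsto_iff_norm_sub_tendsto_zero]
      refine squeeze_zero (fun _ => norm_nonneg _) (fun n => ?_) (hYlim.comp hφ.tendsto_atTop)
      have hp := hYpos (φ n)
      have h1 : (m n : ℝ) ≤ t / ‖Y (φ n)‖ := Int.floor_le _
      have h2 : t / ‖Y (φ n)‖ < m n + 1 := Int.lt_floor_add_one _
      rw [le_div_iff₀ hp] at h1
      rw [div_lt_iff₀ hp] at h2
      rw [Real.norm_eq_abs, abs_le, Function.comp]
      constructor <;> nlinarith
    have hl : Tendsto (fun n => ((m n : ℝ) * ‖Y (φ n)‖) • (‖Y (φ n)‖⁻¹ • Y (φ n))) atTop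
        (𝓝 (t • Z)) := hcoef.smul hlim
    have hl2 := continuous_exp_mat.continuousAt.tendsto.comp hl
    refine (isCompact_matSet hK).isClosed.mem_of_tendsto hl2 (Eventually.of_forall fun n => ?_)
    have e : ((m n : ℝ) * ‖Y (φ n)‖) • (‖Y (φ n)‖⁻¹ • Y (φ n)) = (m n) • Y (φ n) := by
      rw [smul_smul, mul_assoc, mul_inv_cancel₀ (hYpos _).ne', mul_one, Int.cast_smul_eq_zsmul]
    simp only [Function.comp, e]
    obtain ⟨g, hg, hge⟩ := hYe (φ n)
    refine ⟨g ^ (m n), K.zpow_mem hg _, ?_⟩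
    have hun : (((g ^ (m n) : UGroup N) : Mat N)) = (g : Mat N) ^ (m n) := by
      rcases m n with k | k
      · simp
      · rw [zpow_negSucc, zpow_negSucc, ← Unitary.star_eq_inv, Unitary.coe_star]
        symm
        apply Matrix.inv_eq_left_inv
        rw [SubmonoidClass.coe_pow, ← SubmonoidClass.coe_pow]
        exact star_mul_coe _
    change ((g ^ (m n) : UGroup N) : Mat N) = _
    rw [hun, Matrix.exp_zsmul, ← hge]
  have : Z ∈ (tangentSpaceOne K) ⊓ W := ⟨hZK, hZW⟩
  rw [hW.eq_bot] at this
  rw [(Submodule.mem_bot ℝ).1 this] at hZ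
  simp at hZ

/-- Near `1` a closed subgroup is the image of a neighbourhood of `0` in its Lie algebra. -/
theorem eventually_exists_log {K : Subgroup (UGroup N)} (hK : IsClosed (K : Set (UGroup N)))
    {ε : ℝ} (hε : 0 < ε) :
    ∀ᶠ g in 𝓝 (1 : Mat N), g ∈ matSet K → ∃ X ∈ lieAlg K, ‖X‖ < ε ∧ exp X = g := by
  obtain ⟨W, hW⟩ := Submodule.exists_isCompl (tangentSpaceOne K)
  obtain ⟨δ, hδ, hδW⟩ := exists_exp_complement hK hW.disjoint
  let L := tangentSpaceOne K
  let F : L × W → Mat N := fun p => exp (p.1 : Mat N) * exp (p.2 : Mat N)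
  let D : (L × W) →L[ℝ] Mat N :=
    L.subtypeL.comp (ContinuousLinearMap.fst ℝ L W)
      + W.subtypeL.comp (ContinuousLinearMap.snd ℝ L W)
  have hF : HasStrictFDerivAt F D 0 := by
    have h0 : HasStrictFDerivAt (exp : Mat N → Mat N) (1 : Mat N →L[ℝ] Mat N) 0 :=
      hasStrictFDerivAt_exp_zero
    have h1 : HasStrictFDerivAt (fun p : L × W => exp (p.1 : Mat N))
        (L.subtypeL.comp (ContinuousLinearMap.fst ℝ L W)) 0 :=
      HasStrictFDerivAt.comp (𝕜 := ℝ) (f := fun p : L × W => (p.1 : Mat N)) (0 : L × W)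
        (by simpa using h0)
        (L.subtypeL.comp (ContinuousLinearMap.fst ℝ L W)).hasStrictFDerivAt
    have h2 : HasStrictFDerivAt (fun p : L × W => exp (p.2 : Mat N))
        (W.subtypeL.comp (ContinuousLinearMap.snd ℝ L W)) 0 :=
      HasStrictFDerivAt.comp (𝕜 := ℝ) (f := fun p : L × W => (p.2 : Mat N)) (0 : L × W)
        (by simpa using h0)
        (W.subtypeL.comp (ContinuousLinearMap.snd ℝ L W)).hasStrictFDerivAt
    have h3 := h1.mul' h2
    refine h3.congr_fderiv ?_
    ext p <;> simp [D]
  have hsurj : (D : (L × W) →L[ℝ] Mat N).range = ⊤ := by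
    rw [LinearMap.range_eq_top]
    intro x
    obtain ⟨a, b, rfl⟩ : ∃ a : L, ∃ b : W, (a : Mat N) + b = x := by
      have : x ∈ L ⊔ W := by rw [hW.sup_eq_top]; trivial
      obtain ⟨a, ha, b, hb, h⟩ := Submodule.mem_sup.1 this
      exact ⟨⟨a, ha⟩, ⟨b, hb⟩, h⟩
    exact ⟨(a, b), rfl⟩
  have hmap := hF.map_nhds_eq_of_surj hsurj
  have hF0 : F 0 = 1 := by simp [F]
  rw [hF0] at hmap
  have hnb : {p : L × W | ‖(p.1 : Mat N)‖ < ε ∧ ‖(p.2 : Mat N)‖ < δ} ∈ 𝓝 (0 : L × W) := by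
    refine IsOpen.mem_nhds ?_ (by simpa using ⟨hε, hδ⟩)
    exact (isOpen_lt (continuous_subtype_val.comp continuous_fst).norm continuous_const).inter
      (isOpen_lt (continuous_subtype_val.comp continuous_snd).norm continuous_const)
  have := Filter.image_mem_map (m := F) hnb
  rw [hmap] at this
  filter_upwards [this] with g hg hgK
  obtain ⟨p, ⟨hp1, hp2⟩, rfl⟩ := hg
  refine ⟨p.1, p.1.2, hp1, ?_⟩
  have hY : exp (p.2 : Mat N) ∈ matSet K := by
    have : exp (p.2 : Mat N) = exp (-(p.1 : Mat N)) * F p := by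
      simp only [F, ← mul_assoc, exp_neg_mul_exp, one_mul]
    rw [this]
    exact mul_mem_matSet (exp_mem_matSet hK ((lieAlg K).neg_mem p.1.2)) hgK
  have h0 := hδW _ p.2.2 hp2 hY
  simp [F, h0]

end EYM
end

noncomputable section

namespace EYM

open NormedSpace Filter

variable {N : ℕ}

/-! ### Surjectivity of the exponential map -/

theorem hasDerivAt_trace_re {f : ℝ → Mat N} {f' : Mat N} {t : ℝ} (h : HasDerivAt f f' t) :
    HasDerivAt (fun s => (f s).trace.re) f'.trace.re t := by
  let T : Mat N →L[ℝ] ℝ := LinearMap.toContinuousLinearMap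
    (Complex.reLm.comp ((Matrix.traceLinearMap (Fin N) ℝ ℂ)))
  exact T.hasFDerivAt.comp_hasDerivAt t h

theorem trace_re_eq_zero_of_skew {X : Mat N} (hX : star X = -X) : X.trace.re = 0 := by
  have h : star X.trace = -X.trace := by
    rw [← Matrix.trace_conjTranspose, ← Matrix.star_eq_conjTranspose, hX, Matrix.trace_neg]
  have := congrArg Complex.re h
  simp at this
  linarith

/-- A group element is a product of exponentials when the group is connected. -/
theorem exists_list_exp {K : Subgroup (UGroup N)} (hK : IsClosed (K : Set (UGroup N)))
    (hc : IsConnected (K : Set (UGroup N))) {g : UGroup N} (hg : g ∈ K) :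
    ∃ l : List (Mat N), (∀ X ∈ l, X ∈ lieAlg K) ∧ (l.map exp).prod = (g : Mat N) := by
  have hinv : ∀ l : List (Mat N), (∀ X ∈ l, X ∈ lieAlg K) →
      ∃ l' : List (Mat N), (∀ X ∈ l', X ∈ lieAlg K) ∧
        (l'.map exp).prod = star (l.map exp).prod := by
    intro l
    induction l with
    | nil => exact fun _ => ⟨[], by simp, by simp⟩
    | cons X t ih =>
      intro h
      obtain ⟨l', h1, h2⟩ := ih fun Y hY => h Y (List.mem_cons_of_mem _ hY)
      have hX := h X List.mem_cons_self
      refine ⟨l' ++ [-X], ?_, ?_⟩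
      · intro Y hY
        rcases List.mem_append.1 hY with hY | hY
        · exact h1 Y hY
        · rw [List.mem_singleton.1 hY]; exact (lieAlg K).neg_mem hX
      · simp [h2, star_exp_skew (star_eq_neg_of_mem hX)]
  let P : Subgroup K :=
    { carrier := {x | ∃ l : List (Mat N), (∀ X ∈ l, X ∈ lieAlg K) ∧
        (l.map exp).prod = ((x : UGroup N) : Mat N)}
      one_mem' := ⟨[], by simp, by simp⟩
      mul_mem' := by
        rintro x y ⟨l, h1, h2⟩ ⟨l', h1', h2'⟩
        refine ⟨l ++ l', fun Y hY => (List.mem_append.1 hY).elim (h1 Y) (h1' Y), ?_⟩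
        simp [h2, h2']
      inv_mem' := by
        rintro x ⟨l, h1, h2⟩
        obtain ⟨l', h1', h2'⟩ := hinv l h1
        exact ⟨l', h1', by rw [h2', h2]; rfl⟩ }
  have hP : (P : Set K) ∈ 𝓝 (1 : K) := by
    have hcont : ContinuousAt (fun x : K => ((x : UGroup N) : Mat N)) 1 :=
      (continuous_subtype_val.comp continuous_subtype_val).continuousAt
    have := hcont.eventually (eventually_exists_log hK one_pos)
    filter_upwards [this] with x hx
    obtain ⟨X, hX, -, hXe⟩ := hx ⟨x, x.2, rfl⟩
    exact ⟨[X], by simpa using hX, by simpa using hXe⟩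
  have hopen := P.isOpen_of_mem_nhds hP
  have : ConnectedSpace K := isConnected_iff_connectedSpace.1 hc
  have huniv : (P : Set K) = Set.univ :=
    IsClopen.eq_univ ⟨P.isClosed_of_isOpen hopen, hopen⟩ ⟨1, P.one_mem⟩
  have : (⟨g, hg⟩ : K) ∈ (P : Set K) := by rw [huniv]; trivial
  exact this

/-- Near `1`, the elements of the group are determined by the projections of their skew parts to
the Lie algebra. -/
theorem exists_local_injectivity {K : Subgroup (UGroup N)} (hK : IsClosed (K : Set (UGroup N))) :
    ∃ ε > 0, ∀ g ∈ matSet K, ∀ g' ∈ matSet K, ‖g - 1‖ < ε → ‖g' - 1‖ < ε →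
      (∀ W ∈ lieAlg K, ((g - g') * W).trace.re = 0) → g = g' := by
  obtain ⟨C₁, hC₁, h₁⟩ := exists_norm_sq_le_ip N
  obtain ⟨C₂, hC₂, h₂⟩ := exists_trace_mul_le N
  have hstrict : HasStrictFDerivAt (exp : Mat N → Mat N) (1 : Mat N →L[ℝ] Mat N) 0 :=
    hasStrictFDerivAt_exp_zero
  have hlittle := hstrict.isLittleO.def (c := (2 * C₁ * C₂)⁻¹) (by positivity)
  obtain ⟨δ, hδ, hball⟩ := Metric.eventually_nhds_iff_ball.1 hlittle
  obtain ⟨ε, hε, hlog⟩ := Metric.eventually_nhds_iff_ball.1 (eventually_exists_log hK hδ)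
  refine ⟨ε, hε, fun g hg g' hg' hgε hgε' hW => ?_⟩
  obtain ⟨X, hX, hXδ, rfl⟩ := hlog g (by rwa [mem_ball_iff_norm]) hg
  obtain ⟨X', hX', hXδ', rfl⟩ := hlog g' (by rwa [mem_ball_iff_norm]) hg'
  set W := X - X' with hWdef
  have hWm : W ∈ lieAlg K := (lieAlg K).sub_mem hX hX'
  have hWs := star_eq_neg_of_mem hWm
  have hest := hball (X, X') (by
    rw [mem_ball_iff_norm, ← Prod.zero_eq_mk, sub_zero, Prod.norm_def]
    exact max_lt hXδ hXδ')
  simp only [one_apply_eq_self] at hest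
  have h0 := hW W hWm
  set R := exp X - exp X' - (X - X') with hR
  have e : (exp X - exp X') = R + W := by rw [hR, hWdef]; abel
  rw [e, add_mul, Matrix.trace_add, Complex.add_re] at h0
  have e2 : (W * W).trace.re = -(ip W W).re := by
    rw [ip, hWs]; simp
  have h3 := (abs_le.1 (h₂ R W)).2
  have h4 := h₁ W
  have h5 : ‖R‖ * ‖W‖ ≤ (2 * C₁ * C₂)⁻¹ * ‖W‖ ^ 2 := by
    rw [sq, ← mul_assoc]; gcongr
  have h6 : C₁ * (C₂ * (‖R‖ * ‖W‖)) ≤ ‖W‖ ^ 2 / 2 := by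
    calc C₁ * (C₂ * (‖R‖ * ‖W‖)) ≤ C₁ * (C₂ * ((2 * C₁ * C₂)⁻¹ * ‖W‖ ^ 2)) := by gcongr
      _ = _ := by field_simp
  have h7 : ‖W‖ ^ 2 ≤ 0 := by
    have : C₁ * (ip W W).re ≤ C₁ * (C₂ * (‖R‖ * ‖W‖)) := by
      apply mul_le_mul_of_nonneg_left _ hC₁.le
      linarith
    linarith
  have h8 : W = 0 := by
    rw [← norm_eq_zero]; exact pow_eq_zero_iff (two_ne_zero) |>.1 (le_antisymm h7 (sq_nonneg _))
  rw [sub_eq_zero.1 (hWdef.symm.trans h8)]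

theorem star_mul_self_of_mem_matSet {K : Subgroup (UGroup N)} {g : Mat N} (hg : g ∈ matSet K) :
    star g * g = 1 := by
  obtain ⟨g, -, rfl⟩ := hg
  exact star_mul_coe g

theorem mul_star_self_of_mem_matSet {K : Subgroup (UGroup N)} {g : Mat N} (hg : g ∈ matSet K) :
    g * star g = 1 := by
  obtain ⟨g, -, rfl⟩ := hg
  exact coe_mul_star g

/-- The partial products of a list of group elements. -/
theorem exists_partial_products {K : Subgroup (UGroup N)} (φ : Mat N → ℝ) (l : List (Mat N)) :
    (∀ h ∈ l, h ∈ matSet K) → ∀ a ∈ matSet K, ∃ p : ℕ → Mat N, (∀ i, p i ∈ matSet K) ∧ p 0 = a ∧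
      p l.length = a * l.prod ∧
      ∑ i ∈ Finset.range l.length, φ (star (p i) * p (i + 1)) = (l.map φ).sum := by
  induction l with
  | nil => exact fun _ a ha => ⟨fun _ => a, fun _ => ha, rfl, by simp, by simp⟩
  | cons x t ih =>
    intro hl a ha
    have hx := hl x List.mem_cons_self
    obtain ⟨p, h1, h2, h3, h4⟩ := ih (fun h hh => hl h (List.mem_cons_of_mem _ hh)) (a * x)
      (mul_mem_matSet ha hx)
    refine ⟨fun i => Nat.casesOn i a p, fun i => ?_, rfl, ?_, ?_⟩
    · cases i with
      | zero => exact ha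
      | succ i => exact h1 i
    · simp [h3, mul_assoc]
    · rw [List.length_cons, Finset.sum_range_succ']
      simp only [List.map_cons, List.sum_cons, h2]
      rw [h4, add_comm]
      congr 2
      change star a * (a * x) = x
      rw [← mul_assoc, star_mul_self_of_mem_matSet ha, one_mul]

theorem ip_one_sub_self {g : Mat N} (hg : star g * g = 1) :
    (ip (1 - g) (1 - g)).re = 2 * (N - g.trace.re) := by
  have h : star g.trace = (star g).trace := by
    rw [← Matrix.trace_conjTranspose, ← Matrix.star_eq_conjTranspose]
  have h' : (star g).trace.re = g.trace.re := by rw [← h]; rfl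
  simp only [ip, star_sub, star_one, sub_mul, mul_sub, one_mul, mul_one, hg, Matrix.trace_sub,
    Matrix.trace_one, Fintype.card_fin, Complex.sub_re, Complex.natCast_re, h']
  ring

/-- A group element is a product of elements close to `1` whose total energy
`∑ (N - Re tr h)` is small: replace `exp X` by `m` factors `exp (X / m)`. -/
theorem exists_small_energy {K : Subgroup (UGroup N)} (hK : IsClosed (K : Set (UGroup N)))
    {l : List (Mat N)} (hl : ∀ X ∈ l, X ∈ lieAlg K) {η : ℝ} (hη : 0 < η) :
    ∃ l' : List (Mat N), (∀ h ∈ l', h ∈ matSet K) ∧ l'.prod = (l.map exp).prod ∧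
      (l'.map fun h => (N : ℝ) - h.trace.re).sum < η := by
  have key : Tendsto (fun m : ℕ => (l.map fun X => ((m : ℝ) + 1) *
      ((N : ℝ) - (exp (((m : ℝ) + 1)⁻¹ • X)).trace.re)).sum) atTop (𝓝 0) := by
    have : (0 : ℝ) = (l.map fun _ => (0 : ℝ)).sum := by simp
    rw [this]
    refine tendsto_list_sum l fun X hX => ?_
    have hd : HasDerivAt (fun s : ℝ => (N : ℝ) - (exp (s • X)).trace.re) 0 0 := by
      have := (hasDerivAt_trace_re (hasDerivAt_exp_smul X 0)).const_sub (N : ℝ)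
      rwa [zero_smul, exp_zero, one_mul, trace_re_eq_zero_of_skew
        (star_eq_neg_of_mem (hl X hX)), neg_zero] at this
    have h0 : Tendsto (fun n : ℕ => ((n : ℝ) + 1)⁻¹) atTop (𝓝[≠] 0) := by
      refine tendsto_nhdsWithin_iff.2 ⟨?_, Eventually.of_forall fun n => ?_⟩
      · simpa using tendsto_one_div_add_atTop_nhds_zero_nat (𝕜 := ℝ)
      · have : (0 : ℝ) < ((n : ℝ) + 1)⁻¹ := by positivity
        exact this.ne'
    refine ((hasDerivAt_iff_tendsto_slope.1 hd).comp h0).congr fun n => ?_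
    simp [slope]
  obtain ⟨m, hm⟩ := (key.eventually (gt_mem_nhds hη)).exists
  refine ⟨(l.map fun X => List.replicate (m + 1) (exp (((m : ℝ) + 1)⁻¹ • X))).flatten,
    ?_, ?_, ?_⟩
  · intro h hh
    obtain ⟨L, hL, hh⟩ := List.mem_flatten.1 hh
    obtain ⟨X, hX, rfl⟩ := List.mem_map.1 hL
    rw [List.eq_of_mem_replicate hh]
    exact exp_smul_mem_matSet hK (hl X hX) _
  · rw [List.prod_flatten, List.map_map]
    congr 1
    refine List.map_congr_left fun X _ => ?_
    simp only [Function.comp, List.prod_replicate]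
    rw [← Matrix.exp_nsmul, ← Nat.cast_smul_eq_nsmul ℝ, smul_smul]
    push_cast
    rw [mul_inv_cancel₀ (by positivity), one_smul]
  · rw [List.map_flatten, List.sum_flatten, List.map_map, List.map_map]
    refine lt_of_eq_of_lt (congrArg List.sum ?_) hm
    refine List.map_congr_left fun X _ => ?_
    simp

/-- The exponential map of a connected compact group is surjective. Among the decompositions of `g`
into `n` factors, one of minimal energy has equal factors, by the first variation. -/
theorem exists_exp_eq {K : Subgroup (UGroup N)} (hK : IsClosed (K : Set (UGroup N)))
    (hc : IsConnected (K : Set (UGroup N))) {g : UGroup N} (hg : g ∈ K) :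
    ∃ X ∈ lieAlg K, exp X = (g : Mat N) := by
  obtain ⟨ε, hε, hinj⟩ := exists_local_injectivity hK
  obtain ⟨ε', hε', hlog⟩ := Metric.eventually_nhds_iff_ball.1 (eventually_exists_log hK one_pos)
  obtain ⟨C, hC, hnorm⟩ := exists_norm_sq_le_ip N
  obtain ⟨l, hl, hlg⟩ := exists_list_exp hK hc hg
  obtain ⟨l', hl', hlg', hsum⟩ := exists_small_energy hK hl
    (η := (min ε ε') ^ 2 / (2 * C)) (by positivity)
  obtain ⟨p₀, hp₀, hp₀0, hp₀n, hp₀s⟩ := exists_partial_products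
    (fun h : Mat N => (N : ℝ) - h.trace.re) l' hl' 1 (one_mem_matSet K)
  set n := l'.length
  rw [one_mul, hlg', hlg] at hp₀n
  let F : (ℕ → Mat N) → ℝ := fun p =>
    ∑ i ∈ Finset.range n, ((N : ℝ) - (star (p i) * p (i + 1)).trace.re)
  let P : Set (ℕ → Mat N) := {p | (∀ i, p i ∈ matSet K) ∧ p 0 = 1 ∧ p n = g}
  have hPc : IsCompact P := by
    have h1 : IsCompact (Set.univ.pi fun _ : ℕ => matSet K) :=
      isCompact_univ_pi fun _ => isCompact_matSet hK
    have h2 : IsClosed {p : ℕ → Mat N | p 0 = 1 ∧ p n = g} :=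
      (isClosed_eq (continuous_apply 0) continuous_const).inter
        (isClosed_eq (continuous_apply n) continuous_const)
    convert h1.inter_right h2 using 1
    ext p; simp [P]
  have hFc : Continuous F := by
    refine continuous_finsetSum _ fun i _ => continuous_const.sub ?_
    refine Complex.continuous_re.comp (Continuous.matrix_trace ?_)
    exact (continuous_star.comp (continuous_apply i)).mul (continuous_apply (i + 1))
  obtain ⟨p, ⟨hpK, hp0, hpn⟩, hmin⟩ := hPc.exists_isMinOn ⟨p₀, hp₀, hp₀0, hp₀n⟩ hFc.continuousOn
  set h : ℕ → Mat N := fun i => star (p i) * p (i + 1) with hh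
  have hhK : ∀ i, h i ∈ matSet K := fun i => mul_mem_matSet (star_mem_matSet (hpK i)) (hpK _)
  have hterm : ∀ i, 0 ≤ (N : ℝ) - (h i).trace.re := fun i => by
    have := ip_one_sub_self (star_mul_self_of_mem_matSet (hhK i))
    have := ip_self_re_nonneg (1 - h i)
    linarith
  have hclose : ∀ i < n, ‖h i - 1‖ < min ε ε' := fun i hi => by
    have h1 : (N : ℝ) - (h i).trace.re ≤ F p :=
      Finset.single_le_sum (f := fun i => (N : ℝ) - (h i).trace.re) (fun i _ => hterm i)
        (Finset.mem_range.2 hi)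
    have h2 : F p ≤ F p₀ := hmin ⟨hp₀, hp₀0, hp₀n⟩
    have h3 : F p₀ < (min ε ε') ^ 2 / (2 * C) := by rw [← hp₀s] at hsum; exact hsum
    have h4 := hnorm (1 - h i)
    rw [ip_one_sub_self (star_mul_self_of_mem_matSet (hhK i)), norm_sub_rev] at h4
    have h5 : ‖h i - 1‖ ^ 2 < (min ε ε') ^ 2 := by
      calc _ ≤ _ := h4
        _ < C * (2 * ((min ε ε') ^ 2 / (2 * C))) := by gcongr; linarith
        _ = _ := by field_simp
    exact lt_of_pow_lt_pow_left₀ 2 (by positivity) h5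
  have hstep : ∀ i, i + 1 < n → h i = h (i + 1) := fun i hi => by
    refine hinj _ (hhK i) _ (hhK _) ((hclose i (by omega)).trans_le (min_le_left _ _))
      ((hclose (i + 1) hi).trans_le (min_le_left _ _)) fun W hW => ?_
    have hWs := star_eq_neg_of_mem hW
    let q : ℝ → ℕ → Mat N := fun s => Function.update p (i + 1) (p (i + 1) * exp (s • W))
    have hq : ∀ s, q s ∈ P := fun s => by
      refine ⟨fun j => ?_, ?_, ?_⟩
      · by_cases hj : j = i + 1
        · subst hj
          simpa [q] using mul_mem_matSet (hpK (i + 1)) (exp_smul_mem_matSet hK hW s)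
        · simpa [q, hj] using hpK j
      · simpa [q] using hp0
      · simpa [q, show n ≠ i + 1 by omega] using hpn
    have hq0 : q 0 = p := by simp [q]
    let d : ℕ → ℝ := fun k => if k = i then -(h i * W).trace.re else
      if k = i + 1 then (h (i + 1) * W).trace.re else 0
    have hd : HasDerivAt (fun s => F (q s)) (∑ k ∈ Finset.range n, d k) 0 := by
      refine HasDerivAt.fun_sum fun k _ => ?_
      by_cases hk : k = i
      · subst hk
        have e : ∀ s, (N : ℝ) - (star (q s k) * q s (k + 1)).trace.re
            = N - (h k * exp (s • W)).trace.re := fun s => by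
          simp [q, hh, mul_assoc]
        simp only [e, d, if_true]
        have := hasDerivAt_trace_re ((hasDerivAt_exp_smul W 0).const_mul (h k))
        simp only [zero_smul, exp_zero, one_mul] at this
        exact this.const_sub _
      · by_cases hk' : k = i + 1
        · subst hk'
          have e : ∀ s, (N : ℝ) - (star (q s (i + 1)) * q s (i + 1 + 1)).trace.re
              = N - (exp (s • (-W)) * h (i + 1)).trace.re := fun s => by
            simp [q, hh, mul_assoc, star_exp_skew (star_smul_skew hWs s)]
          simp only [e, d, if_neg hk, if_true]
          have := hasDerivAt_trace_re ((hasDerivAt_exp_smul (-W) 0).mul_const (h (i + 1)))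
          simp only [zero_smul, exp_zero, one_mul] at this
          have := this.const_sub (N : ℝ)
          rwa [neg_mul, Matrix.trace_neg, Complex.neg_re, neg_neg,
            Matrix.trace_mul_comm] at this
        · have e : ∀ s, (N : ℝ) - (star (q s k) * q s (k + 1)).trace.re
              = N - (h k).trace.re := fun s => by
            simp [q, hh, hk, hk']
          simp only [e, d, if_neg hk, if_neg hk']
          exact hasDerivAt_const _ _
    have hmin' : IsLocalMin (fun s => F (q s)) 0 :=
      Eventually.of_forall fun s => by
        change F (q 0) ≤ F (q s)
        rw [hq0]; exact hmin (hq s)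
    have hzero := hmin'.hasDerivAt_eq_zero hd
    have hsub : ∑ k ∈ Finset.range n, d k = ∑ k ∈ ({i, i + 1} : Finset ℕ), d k := by
      symm
      refine Finset.sum_subset (fun k hk => ?_) fun k _ hk => ?_
      · rw [Finset.mem_range]
        rcases Finset.mem_insert.1 hk with rfl | hk
        · omega
        · rw [Finset.mem_singleton.1 hk]; exact hi
      · simp only [Finset.mem_insert, Finset.mem_singleton, not_or] at hk
        simp [d, hk.1, hk.2]
    rw [hsub, Finset.sum_pair (by omega)] at hzero
    simp only [d, if_true, if_neg (show i + 1 ≠ i by omega)] at hzero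
    rw [sub_mul, Matrix.trace_sub, Complex.sub_re]
    linarith
  have hall : ∀ i < n, h i = h 0 := fun i => by
    induction i with
    | zero => exact fun _ => rfl
    | succ i ih => exact fun hi => (hstep i hi).symm.trans (ih (by omega))
  have hpow : ∀ i ≤ n, p i = h 0 ^ i := fun i => by
    induction i with
    | zero => exact fun _ => by simp [hp0]
    | succ i ih =>
      intro hi
      rw [pow_succ, ← ih (by omega), ← hall i (by omega), hh]
      simp only
      rw [← mul_assoc, mul_star_self_of_mem_matSet (hpK i), one_mul]
  rcases Nat.eq_zero_or_pos n with h0 | h0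
  · refine ⟨0, (lieAlg K).zero_mem, ?_⟩
    rw [← hpn, h0, hp0, exp_zero]
  · obtain ⟨X, hX, -, hXe⟩ := hlog (h 0) (by
      rw [mem_ball_iff_norm]; exact (hclose 0 h0).trans_le (min_le_right _ _)) (hhK 0)
    refine ⟨n • X, (lieAlg K).nsmul_mem hX n, ?_⟩
    rw [Matrix.exp_nsmul, hXe, ← hpow n le_rfl, hpn]

end EYM
end

noncomputable section

namespace EYM

open NormedSpace Filter

variable {N : ℕ}

/-! ### The complexified Lie algebra and centralizers -/

theorem lieAlg_le_lieAlgC {G : Subgroup (UGroup N)} {X : Mat N} (hX : X ∈ lieAlg G) :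
    X ∈ lieAlgC G := Submodule.subset_span hX

theorem mem_lieAlgC_iff {G : Subgroup (UGroup N)} {x : Mat N} :
    x ∈ lieAlgC G ↔ ∃ a ∈ lieAlg G, ∃ b ∈ lieAlg G, x = a + Complex.I • b := by
  constructor
  · intro hx
    induction hx using Submodule.span_induction with
    | mem x hx => exact ⟨x, hx, 0, (lieAlg G).zero_mem, by simp⟩
    | zero => exact ⟨0, (lieAlg G).zero_mem, 0, (lieAlg G).zero_mem, by simp⟩
    | add x y _ _ hx hy =>
      obtain ⟨a, ha, b, hb, rfl⟩ := hx
      obtain ⟨a', ha', b', hb', rfl⟩ := hy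
      exact ⟨a + a', (lieAlg G).add_mem ha ha', b + b', (lieAlg G).add_mem hb hb', by
        rw [smul_add]; abel⟩
    | smul c x _ hx =>
      obtain ⟨a, ha, b, hb, rfl⟩ := hx
      refine ⟨c.re • a - c.im • b, (lieAlg G).sub_mem ((lieAlg G).smul_mem _ ha)
        ((lieAlg G).smul_mem _ hb), c.im • a + c.re • b, (lieAlg G).add_mem
        ((lieAlg G).smul_mem _ ha) ((lieAlg G).smul_mem _ hb), ?_⟩
      ext i j
      simp only [Matrix.smul_apply, Matrix.add_apply, Matrix.sub_apply, smul_eq_mul,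
        Complex.real_smul]
      nth_rewrite 1 [← Complex.re_add_im c]
      linear_combination (c.im * b i j) * Complex.I_mul_I
  · rintro ⟨a, ha, b, hb, rfl⟩
    exact (lieAlgC G).add_mem (lieAlg_le_lieAlgC ha)
      ((lieAlgC G).smul_mem _ (lieAlg_le_lieAlgC hb))

theorem star_mem_lieAlgC {G : Subgroup (UGroup N)} {x : Mat N} (hx : x ∈ lieAlgC G) :
    star x ∈ lieAlgC G := by
  obtain ⟨a, ha, b, hb, rfl⟩ := mem_lieAlgC_iff.1 hx
  rw [star_add, star_smul, star_eq_neg_of_mem ha, star_eq_neg_of_mem hb]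
  exact (lieAlgC G).add_mem ((lieAlgC G).neg_mem (lieAlg_le_lieAlgC ha))
    ((lieAlgC G).smul_mem _ ((lieAlgC G).neg_mem (lieAlg_le_lieAlgC hb)))

theorem mem_lieAlg_of_skew {G : Subgroup (UGroup N)} {x : Mat N} (hx : x ∈ lieAlgC G)
    (hs : star x = -x) : x ∈ lieAlg G := by
  obtain ⟨a, ha, b, hb, rfl⟩ := mem_lieAlgC_iff.1 hx
  rw [star_add, star_smul, star_eq_neg_of_mem ha, star_eq_neg_of_mem hb, Complex.star_def,
    Complex.conj_I, neg_smul, smul_neg, neg_neg, neg_add, add_right_inj,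
    eq_neg_iff_add_eq_zero, ← two_smul ℂ] at hs
  rw [(smul_eq_zero_iff_right two_ne_zero).1 hs, add_zero]
  exact ha

theorem lie_mem_lieAlgC {G : Subgroup (UGroup N)} {x y : Mat N} (hx : x ∈ lieAlgC G)
    (hy : y ∈ lieAlgC G) : ⁅x, y⁆ ∈ lieAlgC G := by
  obtain ⟨a, ha, b, hb, rfl⟩ := mem_lieAlgC_iff.1 hx
  obtain ⟨a', ha', b', hb', rfl⟩ := mem_lieAlgC_iff.1 hy
  have h : ∀ {p q}, p ∈ lieAlg G → q ∈ lieAlg G → ⁅p, q⁆ ∈ lieAlgC G := fun hp hq =>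
    lieAlg_le_lieAlgC ((lieAlg G).lie_mem hp hq)
  simp only [add_lie, lie_add, smul_lie, lie_smul]
  exact (lieAlgC G).add_mem ((lieAlgC G).add_mem (h ha ha') ((lieAlgC G).smul_mem _ (h hb ha')))
    ((lieAlgC G).smul_mem _ ((lieAlgC G).add_mem (h ha hb')
      ((lieAlgC G).smul_mem _ (h hb hb'))))

theorem conj_mem_lieAlg {G : Subgroup (UGroup N)} {g : UGroup N} (hg : g ∈ G) {x : Mat N}
    (hx : x ∈ lieAlg G) : (g : Mat N) * x * star (g : Mat N) ∈ lieAlg G :=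
  conj_mem_tangentSpaceOne hg hx

theorem conj_mem_lieAlgC {G : Subgroup (UGroup N)} {g : UGroup N} (hg : g ∈ G) {x : Mat N}
    (hx : x ∈ lieAlgC G) : (g : Mat N) * x * star (g : Mat N) ∈ lieAlgC G := by
  obtain ⟨a, ha, b, hb, rfl⟩ := mem_lieAlgC_iff.1 hx
  rw [mem_lieAlgC_iff]
  exact ⟨_, conj_mem_lieAlg hg ha, _, conj_mem_lieAlg hg hb, by simp [mul_add, add_mul]⟩

theorem conj_lie (g : UGroup N) (x y : Mat N) :
    (g : Mat N) * ⁅x, y⁆ * star (g : Mat N)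
      = ⁅(g : Mat N) * x * star (g : Mat N), (g : Mat N) * y * star (g : Mat N)⁆ := by
  have h := star_mul_coe g
  have e : ∀ a b : Mat N, (g : Mat N) * a * star (g : Mat N) * ((g : Mat N) * b * star (g : Mat N))
      = (g : Mat N) * (a * b) * star (g : Mat N) := fun a b => by
    calc _ = (g : Mat N) * a * (star (g : Mat N) * (g : Mat N)) * b * star (g : Mat N) := by
          noncomm_ring
      _ = _ := by rw [h]; noncomm_ring
  simp only [Ring.lie_def, mul_sub, sub_mul, e]

theorem conj_eq_self_iff {g : UGroup N} {x : Mat N} :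
    (g : Mat N) * x * star (g : Mat N) = x ↔ (g : Mat N) * x = x * (g : Mat N) := by
  constructor
  · intro h
    nth_rewrite 2 [← h]
    rw [mul_assoc _ (star _), star_mul_coe, mul_one]
  · intro h
    rw [h, mul_assoc, coe_mul_star, mul_one]

theorem lie_eq_zero_iff {x y : Mat N} : ⁅x, y⁆ = 0 ↔ x * y = y * x := by
  rw [Ring.lie_def, sub_eq_zero]

theorem exp_comm_of_lie_eq_zero {x y : Mat N} (h : ⁅x, y⁆ = 0) : exp x * y = y * exp x :=
  let := NormedAlgebra.restrictScalars ℚ ℝ (Mat N)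
  (Commute.exp_left (𝔸 := Mat N) (lie_eq_zero_iff.1 h : Commute x y))

/-- The centralizer in `K` of a set of matrices. -/
def centralizerIn (K : Subgroup (UGroup N)) (A : Set (Mat N)) : Subgroup (UGroup N) where
  carrier := {g | g ∈ K ∧ ∀ x ∈ A, (g : Mat N) * x = x * (g : Mat N)}
  one_mem' := ⟨K.one_mem, by simp⟩
  mul_mem' := by
    rintro g h ⟨hg, hg'⟩ ⟨hh, hh'⟩
    refine ⟨K.mul_mem hg hh, fun x hx => ?_⟩
    simp only [Submonoid.coe_mul]
    rw [mul_assoc, hh' x hx, ← mul_assoc, hg' x hx, mul_assoc]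
  inv_mem' := by
    rintro g ⟨hg, hg'⟩
    refine ⟨K.inv_mem hg, fun x hx => ?_⟩
    change star (g : Mat N) * x = x * star (g : Mat N)
    calc star (g : Mat N) * x = star (g : Mat N) * (x * (g : Mat N)) * star (g : Mat N) := by
          rw [mul_assoc, mul_assoc, coe_mul_star, mul_one]
      _ = _ := by rw [← hg' x hx, ← mul_assoc, star_mul_coe, one_mul]

theorem isClosed_centralizerIn {K : Subgroup (UGroup N)} (hK : IsClosed (K : Set (UGroup N)))
    (A : Set (Mat N)) : IsClosed (centralizerIn K A : Set (UGroup N)) := by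
  have : (centralizerIn K A : Set (UGroup N)) =
      (K : Set (UGroup N)) ∩ ⋂ x ∈ A, {g : UGroup N | (g : Mat N) * x = x * (g : Mat N)} := by
    ext g; simp [centralizerIn]
  rw [this]
  exact hK.inter (isClosed_biInter fun x _ => isClosed_eq
    (continuous_subtype_val.mul continuous_const) (continuous_const.mul continuous_subtype_val))

theorem mem_lieAlg_centralizerIn {K : Subgroup (UGroup N)} (hK : IsClosed (K : Set (UGroup N)))
    {A : Set (Mat N)} {X : Mat N} :
    X ∈ lieAlg (centralizerIn K A) ↔ X ∈ lieAlg K ∧ ∀ x ∈ A, ⁅X, x⁆ = 0 := by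
  constructor
  · rintro ⟨γ, hγ, hγ0, hd⟩
    refine ⟨⟨γ, fun t => (hγ t).1, hγ0, hd⟩, fun x hx => ?_⟩
    have h1 := hd.mul_const x
    have h2 := hd.const_mul x
    have e : (fun t => (γ t : Mat N) * x) = fun t => x * (γ t : Mat N) :=
      funext fun t => (hγ t).2 x hx
    rw [e] at h1
    exact lie_eq_zero_iff.2 (h1.unique h2)
  · rintro ⟨hX, hx⟩
    refine mem_lieAlg_of_exp_mem fun t => ?_
    obtain ⟨g, hg, hge⟩ := exp_smul_mem_matSet hK hX t
    refine ⟨g, ⟨hg, fun x hxA => ?_⟩, hge⟩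
    simp only at hge
    rw [hge]
    exact exp_comm_of_lie_eq_zero (by rw [smul_lie, hx x hxA, smul_zero])

theorem mem_lieAlgC_centralizerIn {K : Subgroup (UGroup N)} (hK : IsClosed (K : Set (UGroup N)))
    {A : Set (Mat N)} (hA : ∀ x ∈ A, star x = -x) {w : Mat N} (hw : w ∈ lieAlgC K)
    (h : ∀ x ∈ A, ⁅w, x⁆ = 0) : w ∈ lieAlgC (centralizerIn K A) := by
  obtain ⟨a, ha, b, hb, rfl⟩ := mem_lieAlgC_iff.1 hw
  have key : ∀ x ∈ A, ⁅a, x⁆ = 0 ∧ ⁅b, x⁆ = 0 := fun x hx => by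
    have h1 := h x hx
    rw [add_lie, smul_lie] at h1
    have h2 : -⁅a, x⁆ + Complex.I • ⁅b, x⁆ = 0 := by
      have := congrArg star h1
      rw [star_add, star_smul, star_lie_mat, star_lie_mat, hA x hx, star_eq_neg_of_mem ha,
        star_eq_neg_of_mem hb, star_zero, Complex.star_def, Complex.conj_I] at this
      rw [← this]
      simp only [lie_neg, neg_lie, neg_neg, neg_smul]
      rw [← lie_skew x a, ← lie_skew x b, smul_neg, neg_neg]
    have h3 : ⁅a, x⁆ = 0 := by
      have : (2 : ℂ) • ⁅a, x⁆ = 0 := by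
        calc (2 : ℂ) • ⁅a, x⁆
            = (⁅a, x⁆ + Complex.I • ⁅b, x⁆) - (-⁅a, x⁆ + Complex.I • ⁅b, x⁆) := by
              rw [two_smul]; abel
          _ = 0 := by rw [h1, h2, sub_zero]
      exact (smul_eq_zero_iff_right two_ne_zero).1 this
    rw [h3, zero_add] at h1
    exact ⟨h3, (smul_eq_zero_iff_right Complex.I_ne_zero).1 h1⟩
  exact mem_lieAlgC_iff.2 ⟨a, (mem_lieAlg_centralizerIn hK).2 ⟨ha, fun x hx => (key x hx).1⟩,
    b, (mem_lieAlg_centralizerIn hK).2 ⟨hb, fun x hx => (key x hx).2⟩, rfl⟩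

/-! ### Conjugating two elements into a common chamber -/

theorem ip_im_of_skew {x y : Mat N} (hx : star x = -x) (hy : star y = -y) : (ip x y).im = 0 := by
  have h : star (ip x y) = ip x y := by
    rw [ip_conj_symm, ip, ip, hx, hy, neg_mul, neg_mul, Matrix.trace_neg, Matrix.trace_neg,
      Matrix.trace_mul_comm]
  have := congrArg Complex.im h
  simp at this
  linarith

/-- A conjugate of `X` that maximizes the inner product with `Y` commutes with `Y` and satisfies the
second order condition, which says that it lies in a common closed Weyl chamber with `Y`. -/
theorem exists_conj_dominant {Q : Subgroup (UGroup N)} (hQ : IsClosed (Q : Set (UGroup N)))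
    {X Y : Mat N} (hX : X ∈ lieAlg Q) (hY : Y ∈ lieAlg Q) :
    ∃ g ∈ Q, ⁅(g : Mat N) * X * star (g : Mat N), Y⁆ = 0 ∧ ∀ w ∈ lieAlgC Q,
      0 ≤ (ip ⁅w, (g : Mat N) * X * star (g : Mat N)⁆ ⁅w, Y⁆).re := by
  have hcont : Continuous fun g : Mat N => (ip Y (g * X * star g)).re := by
    unfold ip
    fun_prop
  obtain ⟨g, ⟨g, hg, rfl⟩, hmax⟩ := (isCompact_matSet hQ).exists_isMaxOn
    ⟨1, one_mem_matSet Q⟩ hcont.continuousOn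
  refine ⟨g, hg, ?_⟩
  set X' := (g : Mat N) * X * star (g : Mat N) with hX'
  have hX'Q : X' ∈ lieAlg Q := conj_mem_lieAlg hg hX
  have hX's := star_eq_neg_of_mem hX'Q
  have hYs := star_eq_neg_of_mem hY
  have hder : ∀ W Z : Mat N, ∀ t : ℝ,
      HasDerivAt (fun t : ℝ => (ip Y (exp (t • W) * Z * exp (t • (-W)))).re)
        (ip Y (exp (t • W) * ⁅W, Z⁆ * exp (t • (-W)))).re t := fun W Z t => by
    have h1 := ((hasDerivAt_exp_smul W t).mul_const Z).mul (hasDerivAt_exp_smul' (-W) t)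
    have h2 := hasDerivAt_trace_re (h1.const_mul (star Y))
    refine h2.congr_deriv ?_
    rw [ip, Ring.lie_def]
    congr 3
    noncomm_ring
  have hle : ∀ W ∈ lieAlg Q, ∀ t : ℝ, (ip Y (exp (t • W) * X' * exp (t • (-W)))).re ≤
      (ip Y (exp ((0 : ℝ) • W) * X' * exp ((0 : ℝ) • (-W)))).re := fun W hW t => by
    have hs := star_smul_skew (star_eq_neg_of_mem hW) t
    have h1 := hmax (mul_mem_matSet (exp_smul_mem_matSet hQ hW t) ⟨g, hg, rfl⟩)
    simp only [Set.mem_ofPred_eq, star_mul, star_exp_skew hs] at h1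
    simp only [zero_smul, exp_zero, one_mul, mul_one]
    rw [hX']
    simp only [smul_neg, mul_assoc] at h1 ⊢
    exact h1
  have hlocmax : ∀ W ∈ lieAlg Q,
      IsLocalMax (fun t : ℝ => (ip Y (exp (t • W) * X' * exp (t • (-W)))).re) 0 :=
    fun W hW => Eventually.of_forall (hle W hW)
  have hfirst : ∀ W ∈ lieAlg Q, (ip Y ⁅W, X'⁆).re = 0 := fun W hW => by
    simpa using (hlocmax W hW).hasDerivAt_eq_zero (hder W X' 0)
  have hcomm : ⁅X', Y⁆ = 0 := by
    have hm : ⁅X', Y⁆ ∈ lieAlg Q := (lieAlg Q).lie_mem hX'Q hY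
    have h1 := hfirst _ hm
    have h2 : ip Y ⁅⁅X', Y⁆, X'⁆ = ip ⁅X', Y⁆ ⁅X', Y⁆ := by
      rw [← lie_skew, ip_neg_right, ip_lie_right, hX's, neg_lie, ip_neg_left, neg_neg]
    rw [h2] at h1
    exact ip_self_re_eq_zero.1 h1
  refine ⟨hcomm, ?_⟩
  have hsecond : ∀ W ∈ lieAlg Q, 0 ≤ (ip ⁅W, X'⁆ ⁅W, Y⁆).re := fun W hW => by
    by_contra hneg
    push Not at hneg
    set f := fun t : ℝ => (ip Y (exp (t • W) * X' * exp (t • (-W)))).re with hf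
    have hd1 : deriv f = fun t => (ip Y (exp (t • W) * ⁅W, X'⁆ * exp (t • (-W)))).re :=
      funext fun t => (hder W X' t).deriv
    have hd2 : deriv (deriv f) 0 = -(ip ⁅W, X'⁆ ⁅W, Y⁆).re := by
      rw [hd1, (hder W ⁅W, X'⁆ 0).deriv]
      simp only [zero_smul, exp_zero, one_mul, mul_one]
      rw [ip_lie_right W, star_eq_neg_of_mem hW, neg_lie, ip_neg_left, Complex.neg_re, ip_re_comm]
    have hmin : IsLocalMin f 0 := isLocalMin_of_deriv_deriv_pos (by rw [hd2]; linarith)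
      (by rw [hd1]; simpa using hfirst W hW) (hder W X' 0).continuousAt
    have hconst : f =ᶠ[𝓝 0] fun _ => f 0 := by
      filter_upwards [hmin, hlocmax W hW] with t h1 h2
      exact le_antisymm h2 h1
    have h0 : deriv (deriv f) 0 = 0 := by
      rw [hconst.deriv.deriv_eq]; simp
    rw [hd2] at h0
    linarith
  intro w hw
  obtain ⟨a, ha, b, hb, rfl⟩ := mem_lieAlgC_iff.1 hw
  have hreal : ∀ p ∈ lieAlg Q, ∀ q ∈ lieAlg Q, (ip ⁅p, X'⁆ ⁅q, Y⁆).im = 0 := fun p hp q hq =>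
    ip_im_of_skew (star_eq_neg_of_mem ((lieAlg Q).lie_mem hp hX'Q))
      (star_eq_neg_of_mem ((lieAlg Q).lie_mem hq hY))
  simp only [add_lie, smul_lie, ip_add_left, ip_add_right, ip_smul_left, ip_smul_right]
  have h1 := hsecond a ha
  have h2 := hsecond b hb
  have h3 := hreal a ha b hb
  have h4 := hreal b hb a ha
  simp [h3, h4]
  linarith

/-- In a connected compact group, an element fixing two commuting elements of the Lie algebra is
the exponential of an element commuting with both. -/
theorem exists_exp_eq_commuting {K : Subgroup (UGroup N)} (hK : IsClosed (K : Set (UGroup N)))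
    (hc : IsConnected (K : Set (UGroup N))) {k : UGroup N} (hk : k ∈ K) {Y H : Mat N}
    (hY : Y ∈ lieAlg K) (hH : H ∈ lieAlg K) (hYH : ⁅Y, H⁆ = 0)
    (hkY : (k : Mat N) * Y = Y * (k : Mat N)) (hkH : (k : Mat N) * H = H * (k : Mat N)) :
    ∃ X ∈ lieAlg K, exp X = (k : Mat N) ∧ ⁅X, Y⁆ = 0 ∧ ⁅X, H⁆ = 0 := by
  have hconjexp : ∀ (g : UGroup N) (X : Mat N), (g : Mat N) * (k : Mat N) = (k : Mat N) * g →
      exp X = (k : Mat N) → exp ((g : Mat N) * X * star (g : Mat N)) = (k : Mat N) :=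
    fun g X hg hX => by
      have := Matrix.exp_units_conj
        ⟨(g : Mat N), star (g : Mat N), coe_mul_star g, star_mul_coe g⟩ X
      simp only [Units.inv_mk] at this
      rw [this, hX, hg, mul_assoc, coe_mul_star, mul_one]
  obtain ⟨X₀, hX₀, hX₀e⟩ := exists_exp_eq hK hc hk
  have hQ := isClosed_centralizerIn hK {(k : Mat N)}
  have hX₀Q : X₀ ∈ lieAlg (centralizerIn K {(k : Mat N)}) := by
    refine (mem_lieAlg_centralizerIn hK).2 ⟨hX₀, fun x hx => ?_⟩
    rw [Set.mem_singleton_iff.1 hx, ← hX₀e, ← lie_skew, neg_eq_zero, lie_eq_zero_iff]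
    exact exp_comm_of_lie_eq_zero (lie_self _)
  have hYQ : Y ∈ lieAlg (centralizerIn K {(k : Mat N)}) := by
    refine (mem_lieAlg_centralizerIn hK).2 ⟨hY, fun x hx => ?_⟩
    rw [Set.mem_singleton_iff.1 hx, lie_eq_zero_iff, hkY]
  obtain ⟨g, hg, hgY, -⟩ := exists_conj_dominant hQ hX₀Q hYQ
  have hX₁e := hconjexp g X₀ (hg.2 _ rfl) hX₀e
  set X₁ := (g : Mat N) * X₀ * star (g : Mat N)
  have hX₁ : X₁ ∈ lieAlg K := conj_mem_lieAlg hg.1 hX₀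
  have hQ' := isClosed_centralizerIn hK {(k : Mat N), Y}
  have hX₁Q : X₁ ∈ lieAlg (centralizerIn K {(k : Mat N), Y}) := by
    refine (mem_lieAlg_centralizerIn hK).2 ⟨hX₁, fun x hx => ?_⟩
    rcases hx with rfl | rfl
    · rw [← hX₁e, ← lie_skew, neg_eq_zero, lie_eq_zero_iff]
      exact exp_comm_of_lie_eq_zero (lie_self _)
    · exact hgY
  have hHQ : H ∈ lieAlg (centralizerIn K {(k : Mat N), Y}) := by
    refine (mem_lieAlg_centralizerIn hK).2 ⟨hH, fun x hx => ?_⟩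
    rcases hx with rfl | rfl
    · rw [lie_eq_zero_iff, hkH]
    · rw [← lie_skew, hYH, neg_zero]
  obtain ⟨g', hg', hgH, -⟩ := exists_conj_dominant hQ' hX₁Q hHQ
  refine ⟨_, conj_mem_lieAlg hg'.1 hX₁, hconjexp g' X₁ (hg'.2 _ (by simp)) hX₁e, ?_, hgH⟩
  have h1 := conj_lie g' X₁ Y
  rw [hgY, conj_eq_self_iff.2 (hg'.2 Y (by simp))] at h1
  rw [← h1]; simp

end EYM
end

noncomputable section

namespace EYM

open NormedSpace Filter

variable {N : ℕ}

/-! ### Orthogonal projections and eigenspace decompositions -/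

/-- Matrices with the Hilbert-Schmidt inner product, as a Euclidean space. -/
def hsEquiv (N : ℕ) : Mat N ≃ₗ[ℂ] EuclideanSpace ℂ (Fin N × Fin N) where
  toFun x := WithLp.toLp 2 fun p => x p.1 p.2
  invFun v := Matrix.of fun i j => v (i, j)
  map_add' _ _ := rfl
  map_smul' _ _ := rfl
  left_inv _ := rfl
  right_inv _ := rfl

theorem inner_hsEquiv (x y : Mat N) : inner ℂ (hsEquiv N x) (hsEquiv N y) = ip x y := by
  rw [PiLp.inner_apply, Fintype.sum_prod_type, Finset.sum_comm]
  simp only [ip, Matrix.trace, Matrix.diag, Matrix.mul_apply, Matrix.star_apply]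
  exact Finset.sum_congr rfl fun _ _ => Finset.sum_congr rfl fun _ _ => mul_comm _ _

theorem exists_orthogonal_projection (b : Submodule ℂ (Mat N)) (x : Mat N) :
    ∃ y ∈ b, ∀ z ∈ b, ip z (x - y) = 0 := by
  obtain ⟨y, hy, z, hz, h⟩ :=
    (b.map (hsEquiv N).toLinearMap).exists_add_mem_mem_orthogonal (hsEquiv N x)
  obtain ⟨y, hy, rfl⟩ := hy
  refine ⟨y, hy, fun w hw => ?_⟩
  have h1 := (Submodule.mem_orthogonal _ _).1 hz _ (Submodule.mem_map_of_mem hw)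
  rw [← inner_hsEquiv, map_sub, h]
  simpa using h1

/-- The adjoint action of a Hermitian matrix is diagonalisable, with real eigenvalues, on each
invariant subspace. -/
theorem induction_on_eigenvectors {h : Mat N} (hh : star h = h) {W : Submodule ℂ (Mat N)}
    (hW : ∀ x ∈ W, ⁅h, x⁆ ∈ W) {p : Mat N → Prop}
    (eig : ∀ (μ : ℝ) (x : Mat N), x ∈ W → ⁅h, x⁆ = (μ : ℂ) • x → p x) (zero : p 0)
    (add : ∀ x y, p x → p y → p (x + y)) {x : Mat N} (hx : x ∈ W) : p x := by
  let A : EuclideanSpace ℂ (Fin N × Fin N) →ₗ[ℂ] EuclideanSpace ℂ (Fin N × Fin N) :=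
    (hsEquiv N).toLinearMap ∘ₗ (LieAlgebra.ad ℂ (Mat N) h) ∘ₗ (hsEquiv N).symm.toLinearMap
  have hA : ∀ y, A (hsEquiv N y) = hsEquiv N ⁅h, y⁆ := fun y => by simp [A]
  have hsymm : A.IsSymmetric := by
    intro v w
    obtain ⟨v, rfl⟩ := (hsEquiv N).surjective v
    obtain ⟨w, rfl⟩ := (hsEquiv N).surjective w
    rw [hA, hA, inner_hsEquiv, inner_hsEquiv, ip_lie_left, hh]
  set E := W.map (hsEquiv N).toLinearMap
  have hE : ∀ v ∈ E, A v ∈ E := by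
    rintro _ ⟨y, hy, rfl⟩
    exact ⟨⁅h, y⁆, hW y hy, (hA y).symm⟩
  have hT := hsymm.restrict_invariant hE
  have htop : (⨆ μ, Module.End.eigenspace (A.restrict hE) μ) = ⊤ :=
    (Submodule.orthogonal_eq_bot_iff).1 hT.orthogonalComplement_iSup_eigenspaces_eq_bot
  have key : ∀ v : E, p ((hsEquiv N).symm v) := fun v => by
    have hv : v ∈ ⨆ μ, Module.End.eigenspace (A.restrict hE) μ := htop ▸ Submodule.mem_top
    induction hv using Submodule.iSup_induction' with
    | mem μ v hv =>
      by_cases hv0 : v = 0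
      · rw [hv0]; simpa using zero
      have hμ : starRingEnd ℂ μ = μ := hT.conj_eigenvalue_eq_self
        (Module.End.hasEigenvalue_of_hasEigenvector ⟨hv, hv0⟩)
      obtain ⟨r, rfl⟩ := Complex.conj_eq_iff_real.1 hμ
      obtain ⟨_, ⟨y, hy, rfl⟩⟩ := v
      have h1 := congrArg Subtype.val (Module.End.mem_eigenspace_iff.1 hv)
      refine eig r _ (by simpa using hy) ?_
      apply (hsEquiv N).injective
      have h2 : A (hsEquiv N y) = (r : ℂ) • hsEquiv N y := h1
      rw [hA] at h2
      change hsEquiv N ⁅h, (hsEquiv N).symm (hsEquiv N y)⁆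
        = hsEquiv N ((r : ℂ) • (hsEquiv N).symm (hsEquiv N y))
      rw [LinearEquiv.symm_apply_apply, map_smul, h2]
    | zero => simpa using zero
    | add v w _ _ hv hw => simpa using add _ _ hv hw
  simpa using key ⟨hsEquiv N x, Submodule.mem_map_of_mem hx⟩

theorem exp_conj_of_lie_eq {X y : Mat N} {c : ℂ} (h : ⁅X, y⁆ = c • y) :
    exp X * y * exp (-X) = Complex.exp c • y := by
  let := NormedAlgebra.restrictScalars ℚ ℝ (Mat N)
  have hs : SemiconjBy y (X + algebraMap ℂ (Mat N) c) X := by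
    rw [Ring.lie_def, sub_eq_iff_eq_add] at h
    rw [SemiconjBy, mul_add, h, ← Algebra.commutes, Algebra.algebraMap_eq_smul_one]
    simp [add_comm]
  have h1 : y * exp (X + algebraMap ℂ (Mat N) c) = exp X * y := hs.exp_right
  rw [Matrix.exp_add_of_commute _ _ (Algebra.commutes c X).symm, ← algebraMap_exp_comm,
    ← Algebra.commutes, ← Complex.exp_eq_exp_ℂ, Algebra.algebraMap_eq_smul_one] at h1
  rw [← h1]
  simp only [Algebra.smul_mul_assoc, one_mul, Algebra.mul_smul_comm, mul_assoc, exp_mul_exp_neg,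
    mul_one]

/-! ### Triples with the commutation relations of `su(2)` -/

/-- Anti-Hermitian matrices with `[L₁, L₂] = L₃` and cyclic permutations (indices `0, 1, 2` stand
for `1, 2, 3`). -/
structure IsSu2 (L : Fin 3 → Mat N) : Prop where
  skew : ∀ k, star (L k) = -L k
  lie01 : ⁅L 0, L 1⁆ = L 2
  lie12 : ⁅L 1, L 2⁆ = L 0
  lie20 : ⁅L 2, L 0⁆ = L 1

theorem IsSu2.conj {L : Fin 3 → Mat N} (hL : IsSu2 L) (g : UGroup N) :
    IsSu2 fun k => (g : Mat N) * L k * star (g : Mat N) where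
  skew k := by simp [hL.skew, mul_assoc]
  lie01 := by rw [← conj_lie, hL.lie01]
  lie12 := by rw [← conj_lie, hL.lie12]
  lie20 := by rw [← conj_lie, hL.lie20]

/-- The orthogonal projection of an `su(2)`-triple to an invariant reductive subalgebra `b`
is an `su(2)`-triple; the complementary part is an `su(2)`-triple which centralises `b`. -/
theorem IsSu2.exists_split {L : Fin 3 → Mat N} (hL : IsSu2 L) {b : Submodule ℂ (Mat N)}
    (hlie : ∀ x ∈ b, ∀ y ∈ b, ⁅x, y⁆ ∈ b) (hstar : ∀ x ∈ b, star x ∈ b)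
    (hLb : ∀ k, ∀ x ∈ b, ⁅L k, x⁆ ∈ b) :
    ∃ P Q : Fin 3 → Mat N, IsSu2 P ∧ IsSu2 Q ∧ (∀ k, L k = P k + Q k) ∧ (∀ k, P k ∈ b) ∧
      (∀ k, ∀ x ∈ b, ⁅Q k, x⁆ = 0) ∧ ∀ k, ∀ x ∈ b, ip x (Q k) = 0 := by
  choose P hPb hPo using fun k => exists_orthogonal_projection b (L k)
  obtain ⟨Q, hQ⟩ : ∃ Q : Fin 3 → Mat N, ∀ k, Q k = L k - P k := ⟨_, fun _ => rfl⟩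
  simp only [← hQ] at hPo
  have huniq : ∀ x ∈ b, (∀ z ∈ b, ip z x = 0) → x = 0 := fun x hx h =>
    ip_self_eq_zero.1 (h x hx)
  have hcomm : ∀ k, ∀ x ∈ b, ⁅Q k, x⁆ = 0 := fun k x hx => by
    refine huniq _ ?_ fun z hz => ?_
    · rw [hQ, sub_lie]
      exact b.sub_mem (hLb k x hx) (hlie _ (hPb k) _ hx)
    · rw [← lie_skew, ip_neg_right, ip_lie_right, hPo k _ (hlie _ (hstar x hx) _ hz), neg_zero]
  have hPskew : ∀ k, star (P k) = -P k := fun k => by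
    rw [eq_neg_iff_add_eq_zero]
    refine huniq _ (b.add_mem (hstar _ (hPb k)) (hPb k)) fun z hz => ?_
    have h1 : star (P k) + P k = -(star (Q k) + Q k) := by
      rw [hQ, star_sub, hL.skew]; abel
    have h2 : ip z (star (Q k)) = 0 := by
      have : ip z (star (Q k)) = star (ip (star z) (Q k)) := by
        rw [ip_conj_symm, ip, ip, Matrix.trace_mul_comm]
      rw [this, hPo k _ (hstar z hz), star_zero]
    rw [h1, ip_neg_right, ip_add_right, h2, hPo k z hz, add_zero, neg_zero]
  have hQskew : ∀ k, star (Q k) = -Q k := fun k => by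
    rw [hQ, star_sub, hL.skew, hPskew]; abel
  have hsplit : ∀ k, L k = P k + Q k := fun k => by rw [hQ]; abel
  have hbr : ∀ i j k, ⁅L i, L j⁆ = L k → ⁅P i, P j⁆ = P k ∧ ⁅Q i, Q j⁆ = Q k := by
    intro i j k h
    have hPQ : ⁅P i, Q j⁆ = 0 := by rw [← lie_skew, hcomm j _ (hPb i), neg_zero]
    rw [hsplit i, hsplit j, hsplit k, add_lie, lie_add, lie_add, hPQ, hcomm i _ (hPb j), add_zero,
      zero_add] at h
    have h0 : ⁅P i, P j⁆ - P k = 0 := by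
      refine huniq _ (b.sub_mem (hlie _ (hPb i) _ (hPb j)) (hPb k)) fun z hz => ?_
      have e : ⁅P i, P j⁆ - P k = Q k - ⁅Q i, Q j⁆ := by
        rw [sub_eq_sub_iff_add_eq_add, h, add_comm]
      rw [e, ip_sub_right, hPo k z hz, ip_lie_right, hQskew, neg_lie, hcomm i z hz]
      simp
    have hP := sub_eq_zero.1 h0
    exact ⟨hP, by rw [hP] at h; exact add_left_cancel h⟩
  exact ⟨P, Q, ⟨hPskew, (hbr _ _ _ hL.lie01).1, (hbr _ _ _ hL.lie12).1, (hbr _ _ _ hL.lie20).1⟩,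
    ⟨hQskew, (hbr _ _ _ hL.lie01).2, (hbr _ _ _ hL.lie12).2, (hbr _ _ _ hL.lie20).2⟩, hsplit, hPb,
    hcomm, hPo⟩

theorem IsSu2.isSl2Triple {M : Fin 3 → Mat N} (hM : IsSu2 M) (h2 : M 2 ≠ 0) :
    IsSl2Triple ((2 * Complex.I) • M 2) (M 0 + Complex.I • M 1) (-M 0 + Complex.I • M 1) := by
  have h01 := hM.lie01
  have h10 : ⁅M 1, M 0⁆ = -M 2 := by rw [← lie_skew, h01]
  have h20 := hM.lie20
  have h21 : ⁅M 2, M 1⁆ = -M 0 := by rw [← lie_skew, hM.lie12]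
  refine ⟨by simpa using h2, ?_, ?_, ?_⟩
  · simp only [add_lie, lie_add, smul_lie, lie_smul, lie_neg, lie_self, h01, h10]
    module
  · simp only [lie_add, smul_lie, lie_smul, h20, h21, smul_neg, smul_add, smul_smul, ← mul_assoc]
    rw [mul_right_comm, Complex.I_mul_I]
    module
  · simp only [lie_add, smul_lie, lie_smul, lie_neg, h20, h21, smul_neg, smul_add, smul_smul,
      ← mul_assoc]
    rw [mul_right_comm, Complex.I_mul_I]
    module

/-- If the weight zero does not occur in a representation of `su(2)`, then all weights are half-odd,
and therefore `exp (2π M₃)` acts as `-1`. -/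
theorem IsSu2.conj_exp_eq_neg {M : Fin 3 → Mat N} (hM : IsSu2 M) {n : Submodule ℂ (Mat N)}
    (hn : ∀ k, ∀ x ∈ n, ⁅M k, x⁆ ∈ n) (h0 : ∀ x ∈ n, ⁅M 2, x⁆ = 0 → x = 0) {x : Mat N}
    (hx : x ∈ n) :
    exp ((2 * Real.pi) • M 2) * x * exp (-((2 * Real.pi) • M 2)) = -x := by
  by_cases h2 : M 2 = 0
  · rw [h0 x hx (by rw [h2, zero_lie])]; simp
  have ht := hM.isSl2Triple h2
  set h := (2 * Complex.I) • M 2 with hh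
  have hnh : ∀ x ∈ n, ⁅h, x⁆ ∈ n := fun x hx => by
    rw [hh, smul_lie]; exact n.smul_mem _ (hn 2 x hx)
  have hstar : star h = h := by
    rw [hh, star_smul, hM.skew]; simp
  refine induction_on_eigenvectors (p := fun x =>
    exp ((2 * Real.pi) • M 2) * x * exp (-((2 * Real.pi) • M 2)) = -x) hstar hnh ?_ (by simp)
    (fun x y hx hy => by rw [mul_add, add_mul, hx, hy, neg_add]) hx
  intro μ x hx hμ
  by_cases hx0 : x = 0
  · simp [hx0]
  -- raise `x` to a primitive vector
  have hEn : ∀ k, ((LieModule.toEnd ℂ (Mat N) (Mat N) (M 0 + Complex.I • M 1)) ^ k) x ∈ n := by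
    intro k
    induction k with
    | zero => simpa using hx
    | succ k ih =>
      rw [← IsSl2Triple.lie_e_pow_toEnd_e, add_lie, smul_lie]
      exact n.add_mem (hn 0 _ ih) (n.smul_mem _ (hn 1 _ ih))
  have hEh := fun k => IsSl2Triple.lie_h_pow_toEnd_e (R := ℂ) ht hμ k
  obtain ⟨k, hk, hk'⟩ : ∃ k, ((LieModule.toEnd ℂ (Mat N) (Mat N) (M 0 + Complex.I • M 1)) ^ k) x ≠ 0
      ∧ ((LieModule.toEnd ℂ (Mat N) (Mat N) (M 0 + Complex.I • M 1)) ^ (k + 1)) x = 0 := by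
    refine Nat.exists_not_and_succ_of_not_zero_of_exists (p := fun k =>
      ((LieModule.toEnd ℂ (Mat N) (Mat N) (M 0 + Complex.I • M 1)) ^ k) x = 0)
      (by simpa using hx0) ?_
    by_contra! hcon
    have hfin := (LieModule.toEnd ℂ (Mat N) (Mat N) h).finite_hasEigenvalue
    refine Set.infinite_range_of_injective (f := fun k : ℕ => (μ : ℂ) + 2 * k)
      (fun a b hab => by simpa using hab) (hfin.subset ?_)
    rintro _ ⟨k, rfl⟩
    exact Module.End.hasEigenvalue_of_hasEigenvector
      ⟨Module.End.mem_eigenspace_iff.2 (hEh k), hcon k⟩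
  set y := ((LieModule.toEnd ℂ (Mat N) (Mat N) (M 0 + Complex.I • M 1)) ^ k) x with hy
  have P : ht.HasPrimitiveVectorWith y ((μ : ℂ) + 2 * k) :=
    ⟨hk, hEh k, by rw [hy, IsSl2Triple.lie_e_pow_toEnd_e, hk']⟩
  obtain ⟨m, hm⟩ := P.exists_nat
  have hodd : Odd m := by
    rw [← Nat.not_even_iff_odd]
    rintro ⟨j, hj⟩
    have hFn : ∀ i, ((LieModule.toEnd ℂ (Mat N) (Mat N) (-M 0 + Complex.I • M 1)) ^ i) y ∈ n := by
      intro i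
      induction i with
      | zero => rw [pow_zero]; exact hEn k
      | succ i ih =>
        rw [← P.lie_f_pow_toEnd_f, add_lie, smul_lie, neg_lie]
        exact n.add_mem (n.neg_mem (hn 0 _ ih)) (n.smul_mem _ (hn 1 _ ih))
    refine P.pow_toEnd_f_ne_zero_of_eq_nat hm (i := j) (by omega) (h0 _ (hFn j) ?_)
    have h1 := P.lie_h_pow_toEnd_f j
    rw [hm, hj, hh, smul_lie] at h1
    have h3 : ((j + j : ℕ) : ℂ) - 2 * j = 0 := by push_cast; ring
    rw [h3, zero_smul] at h1
    exact (smul_eq_zero_iff_right (by simp)).1 h1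
  obtain ⟨j, hj⟩ := hodd
  have hμ' : (μ : ℂ) = 2 * j + 1 - 2 * k := by
    rw [eq_sub_iff_add_eq, hm, hj]; push_cast; ring
  have h1 : ⁅(2 * Real.pi) • M 2, x⁆ = (-(Real.pi * Complex.I * μ) : ℂ) • x := by
    have e : ((2 * Real.pi) • M 2 : Mat N) = (-(Real.pi * Complex.I) : ℂ) • h := by
      rw [hh, smul_smul, ← Complex.coe_smul]
      congr 1
      push_cast
      linear_combination (2 * Real.pi : ℂ) * Complex.I_sq
    rw [e, smul_lie, hμ, smul_smul, neg_mul]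
  rw [exp_conj_of_lie_eq h1, hμ']
  have e : (-(Real.pi * Complex.I * (2 * j + 1 - 2 * k)) : ℂ)
      = Real.pi * Complex.I + ((k - j - 1 : ℤ) : ℂ) * (2 * Real.pi * Complex.I) := by
    push_cast; ring
  rw [e, Complex.exp_add, Complex.exp_int_mul_two_pi_mul_I, Complex.exp_pi_mul_I]
  simp

end EYM
end

noncomputable section

namespace EYM

open NormedSpace Filter

variable {N : ℕ}

/-! ### The adjoint action -/

/-- The adjoint action `x ↦ g x g⁻¹` of a unitary matrix on all matrices. -/
def Ad (g : UGroup N) : Mat N →ₗ[ℂ] Mat N where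
  toFun x := (g : Mat N) * x * star (g : Mat N)
  map_add' x y := by rw [mul_add, add_mul]
  map_smul' c x := by simp

theorem Ad_apply (g : UGroup N) (x : Mat N) :
    Ad g x = (g : Mat N) * x * star (g : Mat N) := rfl

theorem Ad_lie (g : UGroup N) (x y : Mat N) : Ad g ⁅x, y⁆ = ⁅Ad g x, Ad g y⁆ := conj_lie g x y

theorem Ad_mul (g h : UGroup N) (x : Mat N) : Ad (g * h) x = Ad g (Ad h x) := by
  simp [Ad_apply, mul_assoc]

@[simp] theorem Ad_one (x : Mat N) : Ad (1 : UGroup N) x = x := by simp [Ad_apply]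

@[simp] theorem Ad_inv_Ad (g : UGroup N) (x : Mat N) : Ad g⁻¹ (Ad g x) = x := by
  rw [← Ad_mul, inv_mul_cancel, Ad_one]

@[simp] theorem Ad_Ad_inv (g : UGroup N) (x : Mat N) : Ad g (Ad g⁻¹ x) = x := by
  rw [← Ad_mul, mul_inv_cancel, Ad_one]

theorem star_Ad (g : UGroup N) (x : Mat N) : star (Ad g x) = Ad g (star x) := by
  simp [Ad_apply, mul_assoc]

theorem Ad_mem_lieAlg {G : Subgroup (UGroup N)} {g : UGroup N} (hg : g ∈ G) {x : Mat N}
    (hx : x ∈ lieAlg G) : Ad g x ∈ lieAlg G := conj_mem_lieAlg hg hx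

theorem Ad_mem_lieAlgC {G : Subgroup (UGroup N)} {g : UGroup N} (hg : g ∈ G) {x : Mat N}
    (hx : x ∈ lieAlgC G) : Ad g x ∈ lieAlgC G := conj_mem_lieAlgC hg hx

theorem Ad_eq_self_iff {g : UGroup N} {x : Mat N} :
    Ad g x = x ↔ (g : Mat N) * x = x * (g : Mat N) := conj_eq_self_iff

/-! ### Quadratic forms of the adjoint action -/

/-- If the eigenvalues of `ad h` on `W`, with `h` Hermitian, are at least `c`, then so is the
quadratic form of `ad h`. -/
theorem mul_ip_le_ip_lie {h : Mat N} (hh : star h = h) {W : Submodule ℂ (Mat N)}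
    (hW : ∀ x ∈ W, ⁅h, x⁆ ∈ W) {c : ℝ}
    (hc : ∀ (μ : ℝ) (x : Mat N), x ∈ W → x ≠ 0 → ⁅h, x⁆ = (μ : ℂ) • x → c ≤ μ) {x : Mat N}
    (hx : x ∈ W) : c * (ip x x).re ≤ (ip x ⁅h, x⁆).re := by
  obtain ⟨f, hf, rfl⟩ : ∃ f : ℝ →₀ Mat N, (∀ μ, f μ ∈ W ∧ ⁅h, f μ⁆ = (μ : ℂ) • f μ) ∧
      f.sum (fun _ y => y) = x := by
    refine induction_on_eigenvectors (p := fun x => ∃ f : ℝ →₀ Mat N,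
      (∀ μ, f μ ∈ W ∧ ⁅h, f μ⁆ = (μ : ℂ) • f μ) ∧ f.sum (fun _ y => y) = x) hh hW ?_ ?_ ?_ hx
    · intro μ x hx hμ
      refine ⟨Finsupp.single μ x, fun ν => ?_, by simp⟩
      by_cases hν : μ = ν
      · subst hν; simpa using ⟨hx, hμ⟩
      · simp [hν]
    · exact ⟨0, fun μ => by simp, by simp⟩
    · rintro x y ⟨f, hf, rfl⟩ ⟨g, hg, rfl⟩
      refine ⟨f + g, fun μ => ⟨W.add_mem (hf μ).1 (hg μ).1, ?_⟩,
        Finsupp.sum_add_index' (fun _ => rfl) fun _ _ _ => rfl⟩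
      rw [Finsupp.add_apply, lie_add, (hf μ).2, (hg μ).2, smul_add]
  have horth : ∀ μ ν, μ ≠ ν → ip (f μ) (f ν) = 0 := fun μ ν hμν => by
    have h1 : ip ⁅h, f μ⁆ (f ν) = ip (f μ) ⁅h, f ν⁆ := by rw [ip_lie_left, hh]
    rw [(hf μ).2, (hf ν).2, ip_smul_left, ip_smul_right, Complex.star_def, Complex.conj_ofReal,
      ← sub_eq_zero, ← sub_mul] at h1
    exact (mul_eq_zero.1 h1).resolve_left
      (sub_ne_zero.2 fun h => hμν (Complex.ofReal_injective h))
  have hsl : ∀ (s : Finset ℝ) (a : ℝ → Mat N) (y : Mat N),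
      ip (∑ μ ∈ s, a μ) y = ∑ μ ∈ s, ip (a μ) y := fun s a y => by
    simp [ip, Finset.sum_mul, Matrix.trace_sum]
  have hsr : ∀ (s : Finset ℝ) (a : ℝ → Mat N) (y : Mat N),
      ip y (∑ μ ∈ s, a μ) = ∑ μ ∈ s, ip y (a μ) := fun s a y => by
    simp [ip, Finset.mul_sum, Matrix.trace_sum]
  have e1 : ip (f.sum fun _ y => y) (f.sum fun _ y => y) = ∑ μ ∈ f.support, ip (f μ) (f μ) := by
    rw [Finsupp.sum, hsl]
    refine Finset.sum_congr rfl fun μ hμ => ?_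
    rw [hsr]
    exact Finset.sum_eq_single_of_mem μ hμ fun ν _ hν => horth _ _ hν.symm
  have e2 : ip (f.sum fun _ y => y) ⁅h, f.sum fun _ y => y⁆
      = ∑ μ ∈ f.support, (μ : ℂ) * ip (f μ) (f μ) := by
    rw [Finsupp.sum, hsl, lie_sum]
    refine Finset.sum_congr rfl fun μ hμ => ?_
    simp only [hsr, (hf _).2, ip_smul_right]
    exact Finset.sum_eq_single_of_mem μ hμ fun ν _ hν => by rw [horth _ _ hν.symm, mul_zero]
  rw [e1, e2, Complex.re_sum, Complex.re_sum, Finset.mul_sum]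
  refine Finset.sum_le_sum fun μ hμ => ?_
  rw [Complex.re_ofReal_mul]
  exact mul_le_mul_of_nonneg_right (hc μ _ (hf μ).1 (Finsupp.mem_support_iff.1 hμ) (hf μ).2)
    (ip_self_re_nonneg _)

theorem lie_eq_zero_of_lie_lie_eq_zero {u x : Mat N} (hu : star u = -u) (h : ⁅u, ⁅u, x⁆⁆ = 0) :
    ⁅u, x⁆ = 0 := by
  rw [← ip_self_eq_zero, ip_lie_left, hu, neg_lie, h, neg_zero, ip_zero_right]

theorem IsSu2.lie_raise {S : Fin 3 → Mat N} (hS : IsSu2 S) :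
    ⁅Complex.I • S 2, S 0 + Complex.I • S 1⁆ = S 0 + Complex.I • S 1 := by
  have h21 : ⁅S 2, S 1⁆ = -S 0 := by rw [← lie_skew, hS.lie12]
  rw [smul_lie, lie_add, lie_smul, hS.lie20, h21, smul_add, smul_smul, Complex.I_mul_I]
  simp [add_comm]

theorem IsSu2.ip_raise {S : Fin 3 → Mat N} (hS : IsSu2 S) {r : Mat N} (hr : star r = -r) :
    ip (S 0 + Complex.I • S 1) ⁅Complex.I • r, S 0 + Complex.I • S 1⁆ = 2 * ip r (S 2) := by
  have h01 := hS.lie01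
  have h10 : ⁅S 1, S 0⁆ = -S 2 := by rw [← lie_skew, h01]
  have e : ⁅S 0 + Complex.I • S 1, star (S 0 + Complex.I • S 1)⁆ = (2 * Complex.I) • S 2 := by
    rw [star_add, star_smul, hS.skew, hS.skew, Complex.star_def, Complex.conj_I]
    simp only [add_lie, lie_add, smul_lie, lie_smul, lie_neg, lie_self, h01, h10]
    module
  have e' : ⁅star (S 0 + Complex.I • S 1), S 0 + Complex.I • S 1⁆ = -((2 * Complex.I) • S 2) := by
    rw [← lie_skew, e]
  rw [← lie_skew, ip_neg_right, ip_lie_right, e']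
  have e3 : ip (-((2 * Complex.I) • S 2)) (Complex.I • r) = -2 * ip (S 2) r := by
    rw [ip_neg_left, ip_smul_left, ip_smul_right]
    simp only [Complex.star_def, map_mul, Complex.conj_I, Complex.conj_ofNat]
    linear_combination (2 * ip (S 2) r) * Complex.I_sq
  rw [e3]
  have e4 : ip (S 2) r = ip r (S 2) := by
    rw [ip, ip, hS.skew, hr, neg_mul, neg_mul, Matrix.trace_neg, Matrix.trace_neg,
      Matrix.trace_mul_comm]
  rw [e4]; ring

/-- Two `su(2)`-triples in `b` whose third elements commute and lie in the same closed Weyl chamber: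
if `i R₃` is regular with integral eigenvalues, then `⟨R₃, S₃⟩ ≥ ⟨S₃, S₃⟩`, since `i R₃` has only
positive integral eigenvalues on the vectors raised by `i S₃`. -/
theorem IsSu2.ip_le_ip {S R : Fin 3 → Mat N} (hS : IsSu2 S) (hR : star (R 2) = -R 2)
    {b : Submodule ℂ (Mat N)} (hlie : ∀ x ∈ b, ∀ y ∈ b, ⁅x, y⁆ ∈ b) (hSb : ∀ k, S k ∈ b)
    (hRb : R 2 ∈ b) (hcomm : ⁅S 2, R 2⁆ = 0)
    (hint : ∀ (μ : ℝ) (x : Mat N), x ∈ b → x ≠ 0 → ⁅Complex.I • R 2, x⁆ = (μ : ℂ) • x →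
      ∃ m : ℤ, μ = m)
    (hreg : ∀ x ∈ b, ∀ y ∈ b, ⁅R 2, x⁆ = 0 → ⁅R 2, y⁆ = 0 → ⁅x, y⁆ = 0)
    (hdom : ∀ x ∈ b, 0 ≤ (ip ⁅x, S 2⁆ ⁅x, R 2⁆).re) :
    (ip (S 2) (S 2)).re ≤ (ip (R 2) (S 2)).re := by
  let W : Submodule ℂ (Mat N) :=
    { carrier := {x | x ∈ b ∧ ⁅Complex.I • S 2, x⁆ = x}
      add_mem' := fun hx hy => ⟨b.add_mem hx.1 hy.1, by rw [lie_add, hx.2, hy.2]⟩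
      zero_mem' := ⟨b.zero_mem, lie_zero _⟩
      smul_mem' := fun c x hx => ⟨b.smul_mem c hx.1, by rw [lie_smul, hx.2]⟩ }
  have hstar : star (Complex.I • R 2) = Complex.I • R 2 := by
    rw [star_smul, hR]; simp
  have hW : ∀ x ∈ W, ⁅Complex.I • R 2, x⁆ ∈ W := fun x hx => by
    refine ⟨hlie _ (b.smul_mem _ hRb) _ hx.1, ?_⟩
    rw [leibniz_lie, hx.2, smul_lie, lie_smul, hcomm, smul_zero, smul_zero, zero_lie, zero_add]
  have hI : ∀ {a x : Mat N} {c : ℂ}, ⁅Complex.I • a, x⁆ = c • x → ⁅a, x⁆ = (-Complex.I * c) • x :=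
    fun {a x c} h => by
      rw [mul_smul, ← h, smul_lie, smul_smul]; simp
  have key : ∀ (μ : ℝ) (x : Mat N), x ∈ W → x ≠ 0 → ⁅Complex.I • R 2, x⁆ = (μ : ℂ) • x →
      (1 : ℝ) ≤ μ := by
    intro μ x hx hx0 hμ
    have h1 : ⁅S 2, x⁆ = (-Complex.I * 1) • x := hI (by rw [one_smul]; exact hx.2)
    have h2 := hI hμ
    have hpos : 0 < (ip x x).re := lt_of_le_of_ne (ip_self_re_nonneg x)
      fun h => hx0 (ip_self_re_eq_zero.1 h.symm)
    obtain ⟨m, rfl⟩ := hint μ x hx.1 hx0 hμ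
    have h3 := hdom x hx.1
    rw [← lie_skew, ← lie_skew (x : Mat N) (R 2), h1, h2, ip_neg_left, ip_neg_right, neg_neg,
      ip_smul_left, ip_smul_right] at h3
    have e : star (-Complex.I * 1) * (-Complex.I * ((m : ℝ) : ℂ) * ip x x)
        = ((m : ℝ) : ℂ) * ip x x := by
      simp only [Complex.star_def, map_mul, map_neg, Complex.conj_I, map_one]
      linear_combination (-((m : ℝ) : ℂ) * ip x x) * Complex.I_sq
    rw [e, Complex.re_ofReal_mul] at h3
    have h4 : (0 : ℝ) ≤ m := nonneg_of_mul_nonneg_left h3 hpos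
    have h5 : m ≠ 0 := by
      rintro rfl
      have h6 := hreg _ (hSb 2) x hx.1 (by rw [← lie_skew, hcomm, neg_zero]) (by simpa using h2)
      rw [h6] at h1
      exact hx0 ((smul_eq_zero_iff_right (by simp)).1 h1.symm)
    have h6 : 0 ≤ m := by exact_mod_cast h4
    exact_mod_cast (by omega : (1 : ℤ) ≤ m)
  have hmem : S 0 + Complex.I • S 1 ∈ W :=
    ⟨b.add_mem (hSb 0) (b.smul_mem _ (hSb 1)), hS.lie_raise⟩
  have h1 := mul_ip_le_ip_lie hstar hW key hmem
  have h2 := hS.ip_raise (hS.skew 2)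
  rw [hS.lie_raise] at h2
  rw [hS.ip_raise hR, h2, one_mul] at h1
  simp only [Complex.mul_re, Complex.re_ofNat, Complex.im_ofNat, zero_mul, sub_zero] at h1
  linarith

end EYM
end

noncomputable section

namespace EYM

open NormedSpace Filter

variable {N : ℕ}

/-! ### Vanishing of vectors reversed by a group element -/

theorem Ad_exp {X : Mat N} (hX : star X = -X) (x : Mat N) :
    Ad (expU X hX) x = exp X * x * exp (-X) := by
  rw [Ad_apply, coe_expU, star_exp_skew hX]

theorem Ad_exp_eq_self {X : Mat N} (hX : star X = -X) {x : Mat N} (h : ⁅X, x⁆ = 0) :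
    Ad (expU X hX) x = x :=
  Ad_eq_self_iff.2 (by rw [coe_expU]; exact exp_comm_of_lie_eq_zero h)

/-- If `exp (2π R)` acts trivially on `x`, an eigenvector of `i R`, the eigenvalue is integral. -/
theorem exists_int_of_Ad_exp_eq {R : Mat N} (hR : star R = -R) {x : Mat N} (hx0 : x ≠ 0)
    (h1 : Ad (expU ((2 * Real.pi) • R) (star_smul_skew hR _)) x = x) {μ : ℝ}
    (hμ : ⁅Complex.I • R, x⁆ = (μ : ℂ) • x) : ∃ m : ℤ, μ = m := by
  have h2 : ⁅(2 * Real.pi) • R, x⁆ = (-(2 * Real.pi * Complex.I * μ) : ℂ) • x := by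
    have e : ((2 * Real.pi) • R : Mat N) = (-(2 * Real.pi * Complex.I) : ℂ) • (Complex.I • R) := by
      rw [smul_smul, ← Complex.coe_smul]
      congr 1
      push_cast
      linear_combination (2 * Real.pi : ℂ) * Complex.I_sq
    rw [e, smul_lie, hμ, smul_smul, neg_mul]
  rw [Ad_exp, exp_conj_of_lie_eq h2] at h1
  have h3 : Complex.exp (-(2 * Real.pi * Complex.I * μ)) = 1 := by
    have h4 : (Complex.exp (-(2 * Real.pi * Complex.I * μ)) - 1) • x = 0 := by
      rw [sub_smul, h1, one_smul, sub_self]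
    exact sub_eq_zero.1 ((smul_eq_zero_iff_left hx0).1 h4)
  obtain ⟨m, hm⟩ := Complex.exp_eq_one_iff.1 h3
  refine ⟨-m, ?_⟩
  have h5 : (2 * Real.pi * Complex.I : ℂ) ≠ 0 := Complex.two_pi_I_ne_zero
  have h6 : (μ : ℂ) = -m := mul_left_cancel₀ h5 (by linear_combination -hm)
  exact_mod_cast h6

/-- The case of `eq_zero_of_Ad_eq_neg` in which the `su(2)`-triple `M` commutes with the vector `u`
that is reversed, and the element `Y + M₃` is regular. The representation of `M` on `[u, Z(Y)]` has
only half-odd weights, hence the weights on the subalgebra generated by brackets are integral, which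
allows the correction of `k` to an element that commutes with `Y` and with the third element of the
part of `M` in this subalgebra. Such an element is `exp X` with `X` commuting with both, and then
`[u, X]` has weight zero, so it vanishes and `exp X` cannot reverse `u` unless `u = 0`. -/
theorem eq_zero_of_commuting_triple {G : Subgroup (UGroup N)} (hG : IsClosed (G : Set (UGroup N)))
    (hc : IsConnected (G : Set (UGroup N))) {M : Fin 3 → Mat N} (hM : IsSu2 M)
    (hMG : ∀ k, M k ∈ lieAlg G) {Y u : Mat N} (hY : Y ∈ lieAlg G) (hu : u ∈ lieAlg G)
    (hMY : ∀ k, ⁅M k, Y⁆ = 0) (hMu : ∀ k, ⁅M k, u⁆ = 0) (huY : ⁅u, Y⁆ = 0)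
    (hreg : ∀ x ∈ lieAlgC G, ∀ y ∈ lieAlgC G, ⁅Y, x⁆ = 0 → ⁅M 2, x⁆ = 0 → ⁅Y, y⁆ = 0 →
      ⁅M 2, y⁆ = 0 → ⁅x, y⁆ = 0)
    {k : UGroup N} (hk : k ∈ G) (hkY : Ad k Y = Y) (hku : Ad k u = -u) : u = 0 := by
  have hus := star_eq_neg_of_mem hu
  have hYs := star_eq_neg_of_mem hY
  have hYu : ⁅Y, u⁆ = 0 := by rw [← lie_skew, huY, neg_zero]
  -- `m` is the centralizer of `Y`, and `n = [u, m]`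
  let m : Submodule ℂ (Mat N) :=
    { carrier := {x | x ∈ lieAlgC G ∧ ⁅Y, x⁆ = 0}
      add_mem' := fun hx hy => ⟨add_mem hx.1 hy.1, by rw [lie_add, hx.2, hy.2, add_zero]⟩
      zero_mem' := ⟨zero_mem _, lie_zero _⟩
      smul_mem' := fun c x hx => ⟨Submodule.smul_mem _ c hx.1, by rw [lie_smul, hx.2, smul_zero]⟩ }
  let n : Submodule ℂ (Mat N) := m.map (LieAlgebra.ad ℂ (Mat N) u)
  have hn_mk : ∀ x ∈ m, ⁅u, x⁆ ∈ n := fun x hx => ⟨x, hx, rfl⟩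
  have hn_el : ∀ {x}, x ∈ n → ∃ y ∈ m, ⁅u, y⁆ = x := fun h => h
  have hm_lie : ∀ x ∈ m, ∀ y ∈ m, ⁅x, y⁆ ∈ m := fun x hx y hy =>
    ⟨lie_mem_lieAlgC hx.1 hy.1, by rw [leibniz_lie, hx.2, hy.2, zero_lie, lie_zero, add_zero]⟩
  have hum : u ∈ m := ⟨lieAlg_le_lieAlgC hu, hYu⟩
  have hMm : ∀ k, M k ∈ m := fun k =>
    ⟨lieAlg_le_lieAlgC (hMG k), by rw [← lie_skew, hMY, neg_zero]⟩
  have hm_star : ∀ x ∈ m, star x ∈ m := fun x hx =>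
    ⟨star_mem_lieAlgC hx.1, by
      have h := congrArg star hx.2
      rw [star_lie_mat, hYs, lie_neg, star_zero, neg_eq_zero] at h
      rw [← lie_skew, h, neg_zero]⟩
  have hnm : ∀ x ∈ n, x ∈ m := fun x hx => by
    obtain ⟨y, hy, rfl⟩ := hn_el hx
    exact hm_lie u hum y hy
  have hn_of_comm : ∀ a ∈ m, ⁅a, u⁆ = 0 → ∀ x ∈ n, ⁅a, x⁆ ∈ n := fun a ha hau x hx => by
    obtain ⟨y, hy, rfl⟩ := hn_el hx
    rw [leibniz_lie, hau, zero_lie, zero_add]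
    exact hn_mk _ (hm_lie a ha y hy)
  have hMn : ∀ k, ∀ x ∈ n, ⁅M k, x⁆ ∈ n := fun k => hn_of_comm _ (hMm k) (hMu k)
  have hn_star : ∀ x ∈ n, star x ∈ n := fun x hx => by
    obtain ⟨y, hy, rfl⟩ := hn_el hx
    rw [star_lie_mat, hus, lie_neg, lie_skew]
    exact hn_mk _ (hm_star y hy)
  have h0 : ∀ x ∈ n, ⁅M 2, x⁆ = 0 → x = 0 := fun x hx hx2 => by
    obtain ⟨y, hy, rfl⟩ := hn_el hx
    exact lie_eq_zero_of_lie_lie_eq_zero hus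
      (hreg _ hum.1 _ (hnm _ hx).1 hum.2 (hMu 2) (hnm _ hx).2 hx2)
  set z := expU ((2 * Real.pi) • M 2) (star_smul_skew (hM.skew 2) _) with hz
  have hzn : ∀ x ∈ n, Ad z x = -x := fun x hx => by
    rw [hz, Ad_exp]; exact hM.conj_exp_eq_neg hMn h0 hx
  have hzu : Ad z u = u := Ad_exp_eq_self _ (by rw [smul_lie, hMu, smul_zero])
  -- `b` is spanned by the brackets of `n`
  let b : Submodule ℂ (Mat N) := Submodule.span ℂ {w | ∃ x ∈ n, ∃ y ∈ n, ⁅x, y⁆ = w}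
  have hb_mk : ∀ x ∈ n, ∀ y ∈ n, ⁅x, y⁆ ∈ b := fun x hx y hy =>
    Submodule.subset_span ⟨x, hx, y, hy, rfl⟩
  have hbm : ∀ w ∈ b, w ∈ m := fun w hw => by
    refine Submodule.span_le.2 ?_ hw
    rintro _ ⟨x, hx, y, hy, rfl⟩
    exact hm_lie x (hnm x hx) y (hnm y hy)
  have hzb : ∀ w ∈ b, Ad z w = w := fun w hw => by
    induction hw using Submodule.span_induction with
    | mem w hw =>
      obtain ⟨x, hx, y, hy, rfl⟩ := hw
      rw [Ad_lie, hzn x hx, hzn y hy, neg_lie, lie_neg, neg_neg]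
    | zero => rw [map_zero]
    | add x y _ _ hx hy => rw [map_add, hx, hy]
    | smul c x _ hx => rw [map_smul, hx]
  have hbu : ∀ w ∈ b, ⁅u, w⁆ = 0 := fun w hw => by
    have h1 := hzn _ (hn_mk w (hbm w hw))
    rw [Ad_lie, hzu, hzb w hw, eq_neg_iff_add_eq_zero, ← two_smul ℂ] at h1
    exact (smul_eq_zero_iff_right two_ne_zero).1 h1
  have hub : ∀ w ∈ b, ⁅w, u⁆ = 0 := fun w hw => by rw [← lie_skew, hbu w hw, neg_zero]
  have hb_of_n : ∀ a : Mat N, (∀ x ∈ n, ⁅a, x⁆ ∈ n) → ∀ w ∈ b, ⁅a, w⁆ ∈ b := fun a ha w hw => by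
    induction hw using Submodule.span_induction with
    | mem w hw =>
      obtain ⟨x, hx, y, hy, rfl⟩ := hw
      rw [leibniz_lie]
      exact b.add_mem (hb_mk _ (ha x hx) _ hy) (hb_mk _ hx _ (ha y hy))
    | zero => rw [lie_zero]; exact b.zero_mem
    | add x y _ _ hx hy => rw [lie_add]; exact b.add_mem hx hy
    | smul c x _ hx => rw [lie_smul]; exact b.smul_mem c hx
  have hbn : ∀ w ∈ b, ∀ x ∈ n, ⁅w, x⁆ ∈ n := fun w hw => hn_of_comm w (hbm w hw) (hub w hw)
  have hb_lie : ∀ x ∈ b, ∀ y ∈ b, ⁅x, y⁆ ∈ b := fun x hx => hb_of_n x (hbn x hx)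
  have hb_star : ∀ w ∈ b, star w ∈ b := fun w hw => by
    induction hw using Submodule.span_induction with
    | mem w hw =>
      obtain ⟨x, hx, y, hy, rfl⟩ := hw
      rw [star_lie_mat]
      exact hb_mk _ (hn_star y hy) _ (hn_star x hx)
    | zero => rw [star_zero]; exact b.zero_mem
    | add x y _ _ hx hy => rw [star_add]; exact b.add_mem hx hy
    | smul c x _ hx => rw [star_smul]; exact b.smul_mem _ hx
  obtain ⟨P, Q, hP, hQ, hPQ, hPb, hQb, hQo⟩ := hM.exists_split hb_lie hb_star
    fun k => hb_of_n _ (hMn k)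
  have hQn : ∀ x ∈ n, ⁅Q 2, x⁆ = 0 := fun x hx => by
    have e : Q 2 = M 2 - P 2 := by rw [hPQ]; abel
    have h1 : ⁅Q 2, x⁆ ∈ n := by
      rw [e, sub_lie]; exact n.sub_mem (hMn 2 x hx) (hbn _ (hPb 2) x hx)
    rw [← ip_self_eq_zero]
    nth_rewrite 2 [← lie_skew]
    rw [ip_neg_right, ip_lie_right, hQo 2 _ (hb_mk _ (hn_star x hx) _ h1), neg_zero]
  have hPG : ∀ k, P k ∈ lieAlg G := fun k => mem_lieAlg_of_skew (hbm _ (hPb k)).1 (hP.skew k)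
  have hPY : ⁅P 2, Y⁆ = 0 := by rw [← lie_skew, (hbm _ (hPb 2)).2, neg_zero]
  have hMPb : ∀ x ∈ b, ⁅M 2, x⁆ = ⁅P 2, x⁆ := fun x hx => by
    rw [hPQ, add_lie, hQb 2 x hx, add_zero]
  -- move `Ad k P₃` to the closed Weyl chamber of `P₃` within the centralizer of `u` and `Y`
  have hAc : ∀ x ∈ ({u, Y} : Set (Mat N)), star x = -x := by
    rintro x (rfl | rfl)
    · exact hus
    · exact hYs
  have hmemQ : ∀ {w}, w ∈ lieAlg G → ⁅w, u⁆ = 0 → ⁅w, Y⁆ = 0 →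
      w ∈ lieAlg (centralizerIn G {u, Y}) := fun hw h1 h2 =>
    (mem_lieAlg_centralizerIn hG).2 ⟨hw, by rintro x (rfl | rfl) <;> assumption⟩
  have hkP : Ad k (P 2) ∈ lieAlg (centralizerIn G {u, Y}) := by
    refine hmemQ (Ad_mem_lieAlg hk (hPG 2)) ?_ ?_
    · have h := congrArg (Ad k) (hub _ (hPb 2))
      rw [Ad_lie, hku, lie_neg, map_zero, neg_eq_zero] at h
      exact h
    · have h := congrArg (Ad k) hPY
      rwa [Ad_lie, hkY, map_zero] at h
  obtain ⟨g, hg, hgcomm, hgdom⟩ := exists_conj_dominant (isClosed_centralizerIn hG {u, Y}) hkP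
    (hmemQ (hPG 2) (hub _ (hPb 2)) hPY)
  set k' := g * k with hk'
  have hk'G : k' ∈ G := G.mul_mem hg.1 hk
  have hgY : Ad g Y = Y := Ad_eq_self_iff.2 (hg.2 Y (by simp))
  have hgu : Ad g u = u := Ad_eq_self_iff.2 (hg.2 u (by simp))
  have hk'Y : Ad k' Y = Y := by rw [hk', Ad_mul, hkY, hgY]
  have hk'u : Ad k' u = -u := by rw [hk', Ad_mul, hku, map_neg, hgu]
  rw [← Ad_apply, ← Ad_mul, ← hk'] at hgcomm hgdom
  have hik : ∀ {w}, Ad k' w = w → Ad k'⁻¹ w = w := fun {w} h => by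
    rw [← h, Ad_inv_Ad, h]
  have hk'iu : Ad k'⁻¹ u = -u := by
    have h := congrArg (Ad k'⁻¹) hk'u
    rw [Ad_inv_Ad, map_neg] at h
    exact (neg_eq_iff_eq_neg.2 h).symm
  have hstab : ∀ (q : UGroup N), q ∈ G → Ad q Y = Y → Ad q u = -u → ∀ w ∈ b, Ad q w ∈ b := by
    intro q hq hqY hqu w hw
    have hqm : ∀ x ∈ m, Ad q x ∈ m := fun x hx => ⟨Ad_mem_lieAlgC hq hx.1, by
      nth_rewrite 1 [← hqY]
      rw [← Ad_lie, hx.2, map_zero]⟩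
    have hqn : ∀ x ∈ n, Ad q x ∈ n := fun x hx => by
      obtain ⟨y, hy, rfl⟩ := hn_el hx
      rw [Ad_lie, hqu, neg_lie]
      exact n.neg_mem (hn_mk _ (hqm y hy))
    induction hw using Submodule.span_induction with
    | mem w hw =>
      obtain ⟨x, hx, y, hy, rfl⟩ := hw
      rw [Ad_lie]
      exact hb_mk _ (hqn x hx) _ (hqn y hy)
    | zero => rw [map_zero]; exact b.zero_mem
    | add x y _ _ hx hy => rw [map_add]; exact b.add_mem hx hy
    | smul c x _ hx => rw [map_smul]; exact b.smul_mem _ hx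
  have hkb := hstab k' hk'G hk'Y hk'u
  have hkb' := hstab k'⁻¹ (G.inv_mem hk'G) (hik hk'Y) hk'iu
  -- integrality and regularity of `P₃` on `b`
  have hintP : ∀ (μ : ℝ) (x : Mat N), x ∈ b → x ≠ 0 → ⁅Complex.I • P 2, x⁆ = (μ : ℂ) • x →
      ∃ m : ℤ, μ = m := fun μ x hx hx0 hμ =>
    exists_int_of_Ad_exp_eq (hM.skew 2) hx0 (hzb x hx)
      (by rw [smul_lie, hMPb x hx, ← smul_lie, hμ])
  have hregP : ∀ x ∈ b, ∀ y ∈ b, ⁅P 2, x⁆ = 0 → ⁅P 2, y⁆ = 0 → ⁅x, y⁆ = 0 :=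
    fun x hx y hy h1 h2 => hreg x (hbm x hx).1 y (hbm y hy).1 (hbm x hx).2
      (by rw [hMPb x hx, h1]) (hbm y hy).2 (by rw [hMPb y hy, h2])
  have hS := hP.conj k'
  simp only [← Ad_apply] at hS
  have hpull : ∀ {x w : Mat N}, ⁅Ad k' w, x⁆ = Ad k' ⁅w, Ad k'⁻¹ x⁆ := fun {x w} => by
    rw [Ad_lie, Ad_Ad_inv]
  have hinj : ∀ {x y : Mat N}, Ad k' x = y ↔ x = Ad k'⁻¹ y := fun {x y} =>
    ⟨fun h => by rw [← h, Ad_inv_Ad], fun h => by rw [h, Ad_Ad_inv]⟩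
  have hintS : ∀ (μ : ℝ) (x : Mat N), x ∈ b → x ≠ 0 →
      ⁅Complex.I • Ad k' (P 2), x⁆ = (μ : ℂ) • x → ∃ m : ℤ, μ = m := by
    intro μ x hx hx0 hμ
    rw [← map_smul, hpull, hinj, map_smul] at hμ
    refine hintP μ _ (hkb' x hx) (fun h => hx0 ?_) hμ
    rw [← hinj.2 h.symm, map_zero]
  have hregS : ∀ x ∈ b, ∀ y ∈ b, ⁅Ad k' (P 2), x⁆ = 0 → ⁅Ad k' (P 2), y⁆ = 0 → ⁅x, y⁆ = 0 := by
    intro x hx y hy h1 h2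
    rw [hpull, hinj, map_zero] at h1 h2
    have h3 := congrArg (Ad k') (hregP _ (hkb' x hx) _ (hkb' y hy) h1 h2)
    rwa [Ad_lie, Ad_Ad_inv, Ad_Ad_inv, map_zero] at h3
  have hdom : ∀ x ∈ b, 0 ≤ (ip ⁅x, Ad k' (P 2)⁆ ⁅x, P 2⁆).re := fun x hx =>
    hgdom x (mem_lieAlgC_centralizerIn hG hAc (hbm x hx).1 (by
      rintro y (rfl | rfl)
      · exact hub x hx
      · rw [← lie_skew, (hbm x hx).2, neg_zero]))
  have hle1 := hS.ip_le_ip (hP.skew 2) hb_lie (fun k => hkb _ (hPb k)) (hPb 2) hgcomm hintP hregP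
    hdom
  have hle2 := hP.ip_le_ip (R := fun k => Ad k' (P k)) (hS.skew 2) hb_lie hPb (hkb _ (hPb 2))
    (by rw [← lie_skew, hgcomm, neg_zero]) hintS hregS
    (fun x hx => by rw [ip_re_comm]; exact hdom x hx)
  have hfix : Ad k' (P 2) = P 2 := by
    rw [← sub_eq_zero, ← ip_self_re_eq_zero]
    refine le_antisymm ?_ (ip_self_re_nonneg _)
    have h3 := ip_re_comm (Ad k' (P 2)) (P 2)
    simp only [ip_sub_left, ip_sub_right, Complex.sub_re] at hle1 hle2 ⊢
    linarith
  obtain ⟨X, hX, hXk, hXY, hXP⟩ := exists_exp_eq_commuting hG hc hk'G hY (hPG 2)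
    (by rw [← lie_skew, hPY, neg_zero]) (Ad_eq_self_iff.1 hk'Y) (Ad_eq_self_iff.1 hfix)
  have hXm : X ∈ m := ⟨lieAlg_le_lieAlgC hX, by rw [← lie_skew, hXY, neg_zero]⟩
  have h1 : ⁅u, X⁆ = 0 := by
    refine h0 _ (hn_mk X hXm) ?_
    rw [hPQ, add_lie, hQn _ (hn_mk X hXm), add_zero, leibniz_lie, hub _ (hPb 2), zero_lie,
      zero_add, ← lie_skew (P 2) X, hXP, neg_zero, lie_zero]
  have h2 : Ad k' u = u := Ad_eq_self_iff.2 (by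
    rw [← hXk]; exact exp_comm_of_lie_eq_zero (by rw [← lie_skew, h1, neg_zero]))
  rw [hk'u, neg_eq_iff_add_eq_zero, ← two_smul ℂ] at h2
  exact (smul_eq_zero_iff_right two_ne_zero).1 h2

/-- Let `L` be an `su(2)`-triple in `LG`, with `L₃` regular, and let `U` be a representation of `L`
in the complexified Lie algebra on which some `k ∈ G` acts as `-1`. Then the weight zero does not
occur in `U`. -/
theorem eq_zero_of_Ad_eq_neg {G : Subgroup (UGroup N)} (hG : IsClosed (G : Set (UGroup N)))
    (hc : IsConnected (G : Set (UGroup N))) {L : Fin 3 → Mat N} (hL : IsSu2 L)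
    (hLG : ∀ k, L k ∈ lieAlg G)
    (hreg : ∀ x ∈ lieAlgC G, ∀ y ∈ lieAlgC G, ⁅L 2, x⁆ = 0 → ⁅L 2, y⁆ = 0 → ⁅x, y⁆ = 0)
    {U : Submodule ℂ (Mat N)} (hUG : U ≤ lieAlgC G) (hUs : ∀ x ∈ U, star x ∈ U)
    (hLU : ∀ i, ∀ x ∈ U, ⁅L i, x⁆ ∈ U) {k : UGroup N} (hk : k ∈ G) (hkU : ∀ x ∈ U, Ad k x = -x)
    {u : Mat N} (hu : u ∈ U) (hus : star u = -u) (hLu : ⁅L 2, u⁆ = 0) : u = 0 := by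
  let a := LieSubalgebra.lieSpan ℂ (Mat N) (U : Set (Mat N))
  have hUa : ∀ x ∈ U, x ∈ a := fun x hx => LieSubalgebra.subset_lieSpan hx
  have haG : ∀ x ∈ a, x ∈ lieAlgC G := fun x hx => by
    induction hx using LieSubalgebra.lieSpan_induction with
    | mem x h => exact hUG h
    | zero => exact zero_mem _
    | add x y _ _ hx hy => exact add_mem hx hy
    | smul c x _ hx => exact Submodule.smul_mem _ c hx
    | lie x y _ _ hx hy => exact lie_mem_lieAlgC hx hy
  have has : ∀ x ∈ a, star x ∈ a := fun x hx => by
    induction hx using LieSubalgebra.lieSpan_induction with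
    | mem x h => exact hUa _ (hUs x h)
    | zero => rw [star_zero]; exact zero_mem _
    | add x y _ _ hx hy => rw [star_add]; exact add_mem hx hy
    | smul c x _ hx => rw [star_smul]; exact a.smul_mem _ hx
    | lie x y _ _ hx hy => rw [star_lie_mat]; exact a.lie_mem hy hx
  have haL : ∀ i, ∀ x ∈ a, ⁅L i, x⁆ ∈ a := fun i x hx => by
    induction hx using LieSubalgebra.lieSpan_induction with
    | mem x h => exact hUa _ (hLU i x h)
    | zero => rw [lie_zero]; exact zero_mem _
    | add x y _ _ hx hy => rw [lie_add]; exact add_mem hx hy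
    | smul c x _ hx => rw [lie_smul]; exact a.smul_mem _ hx
    | lie x y hx' hy' hx hy => rw [leibniz_lie]; exact add_mem (a.lie_mem hx hy') (a.lie_mem hx' hy)
  have hstab : ∀ q : UGroup N, (∀ x ∈ U, Ad q x = -x) → ∀ x ∈ a, Ad q x ∈ a := by
    intro q hq x hx
    induction hx using LieSubalgebra.lieSpan_induction with
    | mem x h => rw [hq x h]; exact hUa _ (U.neg_mem h)
    | zero => rw [map_zero]; exact zero_mem _
    | add x y _ _ hx hy => rw [map_add]; exact add_mem hx hy
    | smul c x _ hx => rw [map_smul]; exact a.smul_mem _ hx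
    | lie x y _ _ hx hy => rw [Ad_lie]; exact a.lie_mem hx hy
  have hka := hstab k hkU
  have hka' := hstab k⁻¹ fun x hx => by
    have h := congrArg (Ad k⁻¹) (hkU x hx)
    rw [Ad_inv_Ad, map_neg] at h
    exact (neg_eq_iff_eq_neg.2 h).symm
  have hkL : ∀ i, ∀ x ∈ a, Ad k ⁅L i, x⁆ = ⁅L i, Ad k x⁆ := fun i x hx => by
    induction hx using LieSubalgebra.lieSpan_induction with
    | mem x h => rw [hkU x h, hkU _ (hLU i x h), lie_neg]
    | zero => rw [map_zero, lie_zero, map_zero]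
    | add x y _ _ hx hy => rw [lie_add, map_add, hx, hy, map_add, lie_add]
    | smul c x _ hx => rw [lie_smul, map_smul, hx, map_smul, lie_smul]
    | lie x y _ _ hx hy =>
      rw [leibniz_lie, map_add, Ad_lie k ⁅L i, x⁆ y, Ad_lie k x, hx, hy, Ad_lie k x y,
        leibniz_lie (L i)]
  obtain ⟨P, Q, hP, hQ, hPQ, hPa, hQa, -⟩ := hL.exists_split (b := a.toSubmodule)
    (fun x hx y hy => a.lie_mem hx hy) has haL
  have hLP : ∀ i, ∀ x ∈ a, ⁅L i, x⁆ = ⁅P i, x⁆ := fun i x hx => by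
    rw [hPQ, add_lie, hQa i x hx, add_zero]
  -- `Ad k P` and `P` act in the same way on `a`
  have hd : ∀ i, ∀ x ∈ a, ⁅Ad k (P i), x⁆ = ⁅P i, x⁆ := fun i x hx => by
    have h := hkL i _ (hka' x hx)
    rw [Ad_Ad_inv, hLP i _ (hka' x hx), Ad_lie, Ad_Ad_inv, hLP i x hx] at h
    exact h
  have hfix : Ad k (P 2) = P 2 := by
    rw [← hP.lie01, Ad_lie, hd 0 _ (hka _ (hPa 1)), ← lie_skew, hd 1 _ (hPa 0), lie_skew]
  have hPG : ∀ i, P i ∈ lieAlg G := fun i => mem_lieAlg_of_skew (haG _ (hPa i)) (hP.skew i)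
  have hQG : ∀ i, Q i ∈ lieAlg G := fun i => by
    have e : Q i = L i - P i := by rw [hPQ]; abel
    rw [e]; exact (lieAlg G).sub_mem (hLG i) (hPG i)
  have hPu : ⁅P 2, u⁆ = 0 := by rw [← hLP 2 u (hUa u hu), hLu]
  refine eq_zero_of_commuting_triple hG hc hQ hQG (hPG 2) (mem_lieAlg_of_skew (hUG hu) hus)
    (fun i => hQa i _ (hPa 2)) (fun i => hQa i _ (hUa u hu)) (by rw [← lie_skew, hPu, neg_zero])
    (fun x hx y hy h1 h2 h3 h4 => hreg x hx y hy ?_ ?_) hk hfix (hkU u hu)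
  · rw [hPQ, add_lie, h1, h2, add_zero]
  · rw [hPQ, add_lie, h3, h4, add_zero]

end EYM
end

noncomputable section

namespace EYM

open NormedSpace Filter

variable {N : ℕ}

/-! ### One-parameter groups -/

/-- A continuous one-parameter group of matrices is generated by its derivative at zero: it is
differentiable because its product with an invertible mean value is an integral. -/
theorem eq_exp_of_continuous {φ : ℝ → Mat N} (hc : Continuous φ) (h0 : φ 0 = 1)
    (hadd : ∀ s t, φ (s + t) = φ s * φ t) (t : ℝ) : φ t = exp (t • deriv φ 0) := by
  set F : ℝ → Mat N := fun x => ∫ s in (0 : ℝ)..x, φ s with hF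
  have hFd : ∀ x, HasDerivAt F (φ x) x := fun x => (hc.integral_hasStrictDerivAt 0 x).hasDerivAt
  obtain ⟨a, ha⟩ : ∃ a, IsUnit (F a) := by
    have h1 := (hasDerivAt_iff_tendsto_slope.1 (hFd 0))
    rw [h0] at h1
    have h2 := h1.eventually (Units.isOpen.mem_nhds (show IsUnit (1 : Mat N) from isUnit_one))
    obtain ⟨a, ha, ha0⟩ := (h2.and self_mem_nhdsWithin).exists
    refine ⟨a, ?_⟩
    have h3 : slope F 0 a = a⁻¹ • F a := by simp [slope, hF]
    have h4 : IsUnit (slope F 0 a) := ha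
    rw [h3] at h4
    have ha' : a ≠ 0 := ha0
    have h5 := h4.smul (Units.mk0 a ha')
    simpa [Units.smul_def, smul_smul, ha'] using h5
  have hFa : ∀ t, φ t * F a = F (t + a) - F t := fun t => by
    have h1 := (ContinuousLinearMap.mul ℝ (Mat N) (φ t)).intervalIntegral_comp_comm
      (hc.intervalIntegrable (μ := MeasureTheory.volume) 0 a)
    simp only [ContinuousLinearMap.mul_apply', ← hadd] at h1
    rw [intervalIntegral.integral_comp_add_left, add_zero] at h1
    rw [hF]
    simp only
    rw [← h1, intervalIntegral.integral_interval_sub_left] <;> exact hc.intervalIntegrable _ _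
  obtain ⟨b, hb⟩ := ha.exists_right_inv
  have hφ : φ = fun t => (F (t + a) - F t) * b := funext fun t => by
    rw [← hFa, mul_assoc, hb, mul_one]
  have hd0 : HasDerivAt φ (deriv φ 0) 0 := by
    refine DifferentiableAt.hasDerivAt ?_
    rw [hφ]
    exact ((((hFd _).comp_add_const 0 a).sub (hFd 0)).mul_const b).differentiableAt
  have hd : ∀ t, HasDerivAt φ (φ t * deriv φ 0) t := fun t => by
    have h1 : HasDerivAt (fun s => φ t * φ (s - t)) (φ t * deriv φ 0) t := by
      refine HasDerivAt.const_mul _ ?_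
      exact HasDerivAt.comp_sub_const t t (by rwa [sub_self])
    refine h1.congr_of_eventuallyEq (Eventually.of_forall fun s => ?_)
    simp only
    rw [← hadd]; congr 1; ring
  have hconst : ∀ t, φ t * exp (t • -deriv φ 0) = 1 := fun t => by
    have h1 : ∀ t, HasDerivAt (fun t => φ t * exp (t • -deriv φ 0)) 0 t := fun t => by
      have h := (hd t).mul (hasDerivAt_exp_smul' (-deriv φ 0) t)
      refine h.congr_deriv ?_
      noncomm_ring
    have h2 := is_const_of_deriv_eq_zero (fun t => (h1 t).differentiableAt)
      (fun t => (h1 t).deriv) t 0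
    simpa [h0] using h2
  have h1 := hconst t
  rw [smul_neg] at h1
  calc φ t = φ t * (exp (-(t • deriv φ 0)) * exp (t • deriv φ 0)) := by
        rw [exp_neg_mul_exp, mul_one]
    _ = _ := by rw [← mul_assoc, h1, one_mul]

/-! ### The rotations induced by `SU(2)` -/

/-- The anti-Hermitian matrix `x · τ = ∑ x_k τ_k`. -/
def tauVec (x : E3) : Mat 2 := ∑ j, ((x j : ℝ) : ℂ) • tau j

theorem tauVec_eq (x : E3) : tauVec x =
    !![-Complex.I / 2 * x 2, -(x 1 : ℂ) / 2 - Complex.I / 2 * x 0;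
    (x 1 : ℂ) / 2 - Complex.I / 2 * x 0, Complex.I / 2 * x 2] := by
  have h : (2 * Complex.I)⁻¹ = -Complex.I / 2 := by
    rw [mul_inv, Complex.inv_I]; ring
  ext i j
  fin_cases i <;> fin_cases j <;>
    simp [tauVec, Fin.sum_univ_three, tau, h] <;> ring_nf <;>
    simp [Complex.I_sq] <;> ring

theorem tauVec_injective : Function.Injective tauVec := by
  intro x y h
  rw [tauVec_eq, tauVec_eq] at h
  have h1 := congrFun (congrFun h 0) 0
  have h2 := congrFun (congrFun h 1) 0
  simp [Complex.ext_iff] at h1 h2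
  ext k
  fin_cases k
  · exact h2.2
  · exact h2.1
  · exact h1

theorem tauVec_add (x y : E3) : tauVec (x + y) = tauVec x + tauVec y := by
  simp [tauVec, add_smul, Finset.sum_add_distrib]

theorem tauVec_smul (c : ℝ) (x : E3) : tauVec (c • x) = c • tauVec x := by
  simp only [tauVec, Finset.smul_sum, PiLp.smul_apply, smul_eq_mul, Complex.ofReal_mul, mul_smul,
    Complex.coe_smul]

theorem star_tauVec (x : E3) : star (tauVec x) = -tauVec x := by
  rw [tauVec_eq]
  ext i j
  fin_cases i <;> fin_cases j <;> simp [Matrix.star_apply] <;> ring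

theorem tauVec_mul_self (x : E3) : tauVec x * tauVec x = (-(‖x‖ ^ 2 / 4) : ℂ) • (1 : Mat 2) := by
  have h : (‖x‖ : ℂ) ^ 2 = (x 0 : ℂ) ^ 2 + (x 1 : ℂ) ^ 2 + (x 2 : ℂ) ^ 2 := by
    have := EuclideanSpace.norm_sq_eq x
    simp only [Fin.sum_univ_three, Real.norm_eq_abs, sq_abs] at this
    exact_mod_cast this
  rw [h, tauVec_eq]
  ext i j
  fin_cases i <;> fin_cases j <;> simp [Matrix.mul_apply] <;> ring_nf <;>
    simp [Complex.I_sq] <;> ring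

theorem exists_tauVec {m : Mat 2} (hs : star m = -m) (ht : m.trace = 0) : ∃ x, tauVec x = m := by
  have h00 := congrFun (congrFun hs 0) 0
  have h10 := congrFun (congrFun hs 1) 0
  simp only [Matrix.star_apply, Matrix.neg_apply, Complex.ext_iff, Complex.star_def,
    Complex.conj_re, Complex.conj_im, Complex.neg_re, Complex.neg_im] at h00 h10
  simp only [Matrix.trace_fin_two, Complex.ext_iff, Complex.add_re, Complex.add_im,
    Complex.zero_re, Complex.zero_im] at ht
  refine ⟨!₂[-2 * (m 1 0).im, 2 * (m 1 0).re, -2 * (m 0 0).im], ?_⟩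
  rw [tauVec_eq]
  ext i j
  fin_cases i <;> fin_cases j <;> simp [Complex.ext_iff] <;> constructor <;> linarith

theorem tauVec_apply (x : E3) (k : Fin 3) : x k = -2 * (Matrix.trace (tau k * tauVec x)).re := by
  have h : (2 * Complex.I)⁻¹ = -Complex.I / 2 := by
    rw [mul_inv, Complex.inv_I]; ring
  rw [tauVec_eq]
  fin_cases k <;> simp [tau, Matrix.trace_fin_two, h] <;> ring

/-- The element of `U(2)` underlying an element of `SU(2)`. -/
def toU2 (s : SU2) : UGroup 2 :=
  ⟨(s : Mat 2), Matrix.specialUnitaryGroup_le_unitaryGroup s.2⟩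

@[simp] theorem coe_toU2 (s : SU2) : (toU2 s : Mat 2) = (s : Mat 2) := rfl

theorem tauVec_rot (s : SU2) (x : E3) : tauVec (rot s x) = Ad (toU2 s) (tauVec x) := by
  obtain ⟨y, hy⟩ := exists_tauVec (m := Ad (toU2 s) (tauVec x))
    (by rw [star_Ad, star_tauVec, map_neg])
    (by
      rw [Ad_apply, Matrix.trace_mul_comm, ← mul_assoc, star_mul_coe, one_mul, tauVec_eq]
      simp [Matrix.trace_fin_two]; ring)
  have e : rot s x = y := by
    ext k
    rw [tauVec_apply y k, hy]
    rfl
  rw [e, hy]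

theorem rot_mul (s s' : SU2) (x : E3) : rot (s * s') x = rot s (rot s' x) := by
  apply tauVec_injective
  rw [tauVec_rot, tauVec_rot, tauVec_rot, ← Ad_mul]
  rfl

@[simp] theorem rot_one (x : E3) : rot 1 x = x := by
  apply tauVec_injective
  rw [tauVec_rot]
  exact Ad_one _

theorem rot_add (s : SU2) (x y : E3) : rot s (x + y) = rot s x + rot s y := by
  apply tauVec_injective
  rw [tauVec_add, tauVec_rot, tauVec_rot, tauVec_rot, tauVec_add, map_add]

theorem rot_smul (s : SU2) (c : ℝ) (x : E3) : rot s (c • x) = c • rot s x := by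
  apply tauVec_injective
  rw [tauVec_smul, tauVec_rot, tauVec_rot, tauVec_smul, ← Complex.coe_smul, map_smul,
    Complex.coe_smul]

theorem norm_rot (s : SU2) (x : E3) : ‖rot s x‖ = ‖x‖ := by
  have h := tauVec_mul_self (rot s x)
  rw [tauVec_rot] at h
  have h1 : Ad (toU2 s) (tauVec x) * Ad (toU2 s) (tauVec x)
      = Ad (toU2 s) (tauVec x * tauVec x) := by
    have := star_mul_coe (toU2 s)
    simp only [Ad_apply]
    calc _ = (toU2 s : Mat 2) * tauVec x * (star (toU2 s : Mat 2) * (toU2 s : Mat 2)) * tauVec x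
          * star (toU2 s : Mat 2) := by noncomm_ring
      _ = _ := by rw [this]; noncomm_ring
  rw [h1, tauVec_mul_self, map_smul, Ad_apply, mul_one, coe_mul_star] at h
  have h2 := congrFun (congrFun h 0) 0
  simp only [Matrix.smul_apply, Matrix.one_apply_eq, smul_eq_mul, mul_one, neg_inj] at h2
  have h3 : ‖x‖ ^ 2 / 4 = ‖rot s x‖ ^ 2 / 4 := by exact_mod_cast h2
  have h4 : ‖rot s x‖ ^ 2 = ‖x‖ ^ 2 := by linarith
  exact (pow_left_inj₀ (norm_nonneg _) (norm_nonneg _) two_ne_zero).1 h4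

/-- The rotation induced by an element of `SU(2)`, as a continuous linear map. -/
def rotL (s : SU2) : E3 →L[ℝ] E3 :=
  LinearMap.toContinuousLinearMap
    { toFun := rot s, map_add' := rot_add s, map_smul' := fun c x => rot_smul s c x }

@[simp] theorem rotL_apply (s : SU2) (x : E3) : rotL s x = rot s x := rfl

theorem cos_eq_half (t : ℝ) : Real.cos t = Real.cos (t / 2) ^ 2 - Real.sin (t / 2) ^ 2 := by
  rw [← Real.cos_two_mul']; ring_nf

theorem sin_eq_half (t : ℝ) : Real.sin t = 2 * Real.sin (t / 2) * Real.cos (t / 2) := by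
  rw [← Real.sin_two_mul]; ring_nf

theorem expTauMat_eq (k : Fin 3) (t : ℝ) : expTauMat k t =
    ((Real.cos (t / 2) : ℝ) : ℂ) • (1 : Mat 2) + ((2 * Real.sin (t / 2) : ℝ) : ℂ) • tau k := rfl

theorem rot_expTau_zero (t : ℝ) (x : E3) : rot (expTau 0 t) x =
    !₂[x 0, Real.cos t * x 1 - Real.sin t * x 2, Real.sin t * x 1 + Real.cos t * x 2] := by
  apply tauVec_injective
  have h1 : (Real.cos (t / 2) : ℂ) ^ 2 + (Real.sin (t / 2) : ℂ) ^ 2 = 1 := by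
    exact_mod_cast Real.cos_sq_add_sin_sq (t / 2)
  have h : (2 * Complex.I)⁻¹ = -Complex.I / 2 := by
    rw [mul_inv, Complex.inv_I]; ring
  rw [tauVec_rot, Ad_apply, coe_toU2, tauVec_eq, tauVec_eq, cos_eq_half t, sin_eq_half t]
  change expTauMat 0 t * _ * star (expTauMat 0 t) = _
  rw [expTauMat_eq]
  generalize Real.cos (t / 2) = c at *
  generalize Real.sin (t / 2) = u at *
  have hI : Complex.I ^ 2 = -1 := Complex.I_sq
  have hI3 : Complex.I ^ 3 = -Complex.I := by rw [pow_succ, hI]; ring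
  have h2 : (starRingEnd ℂ) 2 = 2 := Complex.conj_ofNat 2
  ext i j
  fin_cases i <;> fin_cases j <;>
    simp [tau, Matrix.mul_apply, Matrix.star_apply, h, h2] <;> ring_nf <;>
    (try simp only [hI, hI3]) <;>
    first
      | ring1
      | linear_combination (-Complex.I / 2 * x 0) * h1

theorem rot_expTau_one (t : ℝ) (x : E3) : rot (expTau 1 t) x =
    !₂[Real.cos t * x 0 + Real.sin t * x 2, x 1, Real.cos t * x 2 - Real.sin t * x 0] := by
  apply tauVec_injective
  have h1 : (Real.cos (t / 2) : ℂ) ^ 2 + (Real.sin (t / 2) : ℂ) ^ 2 = 1 := by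
    exact_mod_cast Real.cos_sq_add_sin_sq (t / 2)
  have h : (2 * Complex.I)⁻¹ = -Complex.I / 2 := by
    rw [mul_inv, Complex.inv_I]; ring
  rw [tauVec_rot, Ad_apply, coe_toU2, tauVec_eq, tauVec_eq, cos_eq_half t, sin_eq_half t]
  change expTauMat 1 t * _ * star (expTauMat 1 t) = _
  rw [expTauMat_eq]
  generalize Real.cos (t / 2) = c at *
  generalize Real.sin (t / 2) = u at *
  have hI : Complex.I ^ 2 = -1 := Complex.I_sq
  have hI3 : Complex.I ^ 3 = -Complex.I := by rw [pow_succ, hI]; ring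
  have hI4 : Complex.I ^ 4 = 1 := Complex.I_pow_four
  have hI5 : Complex.I ^ 5 = Complex.I := by rw [pow_succ, hI4, one_mul]
  have h2 : (starRingEnd ℂ) 2 = 2 := Complex.conj_ofNat 2
  ext i j
  fin_cases i <;> fin_cases j <;>
    simp [tau, Matrix.mul_apply, Matrix.star_apply, h, h2] <;> ring_nf <;>
    (try simp only [hI3, hI4, hI5]) <;>
    first
      | ring1
      | linear_combination (-(x 1 : ℂ) / 2) * h1
      | linear_combination ((x 1 : ℂ) / 2) * h1

theorem rot_expTau_two (t : ℝ) (x : E3) : rot (expTau 2 t) x =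
    !₂[Real.cos t * x 0 - Real.sin t * x 1, Real.sin t * x 0 + Real.cos t * x 1, x 2] := by
  apply tauVec_injective
  have h1 : (Real.cos (t / 2) : ℂ) ^ 2 + (Real.sin (t / 2) : ℂ) ^ 2 = 1 := by
    exact_mod_cast Real.cos_sq_add_sin_sq (t / 2)
  have h : (2 * Complex.I)⁻¹ = -Complex.I / 2 := by
    rw [mul_inv, Complex.inv_I]; ring
  rw [tauVec_rot, Ad_apply, coe_toU2, tauVec_eq, tauVec_eq, cos_eq_half t, sin_eq_half t]
  change expTauMat 2 t * _ * star (expTauMat 2 t) = _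
  rw [expTauMat_eq]
  generalize Real.cos (t / 2) = c at *
  generalize Real.sin (t / 2) = u at *
  have hI : Complex.I ^ 2 = -1 := Complex.I_sq
  have hI3 : Complex.I ^ 3 = -Complex.I := by rw [pow_succ, hI]; ring
  have h2 : (starRingEnd ℂ) 2 = 2 := Complex.conj_ofNat 2
  ext i j
  fin_cases i <;> fin_cases j <;>
    simp [tau, Matrix.mul_apply, Matrix.star_apply, h, h2] <;> ring_nf <;>
    (try simp only [hI, hI3]) <;>
    first
      | ring1
      | linear_combination (-Complex.I / 2 * x 2) * h1
      | linear_combination (Complex.I / 2 * x 2) * h1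

/-- Rodrigues' formula. -/
theorem rot_expTau (k : Fin 3) (t : ℝ) (x : E3) : rot (expTau k t) x =
    x + (1 - Real.cos t) • Configuration.rotField k (Configuration.rotField k x)
      + Real.sin t • Configuration.rotField k x := by
  fin_cases k
  · refine (rot_expTau_zero t x).trans ?_
    ext i
    fin_cases i <;> simp [Configuration.rotField, axis, crossProduct] <;> ring
  · refine (rot_expTau_one t x).trans ?_
    ext i
    fin_cases i <;> simp [Configuration.rotField, axis, crossProduct] <;> ring
  · refine (rot_expTau_two t x).trans ?_
    ext i
    fin_cases i <;> simp [Configuration.rotField, axis, crossProduct] <;> ring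

theorem hasDerivAt_rot_expTau (k : Fin 3) (x : E3) :
    HasDerivAt (fun t => rot (expTau k t) x) (Configuration.rotField k x) 0 := by
  simp only [rot_expTau]
  have h1 := ((Real.hasDerivAt_cos 0).const_sub 1).smul_const
    (Configuration.rotField k (Configuration.rotField k x))
  have h2 := (Real.hasDerivAt_sin 0).smul_const (Configuration.rotField k x)
  have h3 := (h1.const_add x).fun_add h2
  simpa using h3

theorem tau_mul_self (k : Fin 3) : tau k * tau k = (-(1 / 4) : ℂ) • (1 : Mat 2) := by
  have h : (2 * Complex.I)⁻¹ = -Complex.I / 2 := by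
    rw [mul_inv, Complex.inv_I]; ring
  fin_cases k <;> ext i j <;> fin_cases i <;> fin_cases j <;>
    simp [tau, Matrix.mul_apply, h] <;> ring_nf <;> simp [Complex.I_sq, Complex.I_pow_four] <;>
    norm_num

theorem expTau_add (k : Fin 3) (s t : ℝ) : expTau k (s + t) = expTau k s * expTau k t := by
  apply Subtype.ext
  change expTauMat k (s + t) = expTauMat k s * expTauMat k t
  simp only [expTauMat_eq, add_mul, mul_add, smul_mul_assoc, mul_smul_comm, tau_mul_self, mul_one,
    one_mul, smul_smul, add_div, Real.cos_add, Real.sin_add]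
  push_cast
  module

@[simp] theorem expTau_zero (k : Fin 3) : expTau k 0 = 1 :=
  Subtype.ext (by simp [expTau, expTauMat])

theorem coe_expTau (k : Fin 3) (t : ℝ) : (expTau k t : Mat 2) = expTauMat k t := rfl

theorem hasDerivAt_expTauMat (k : Fin 3) : HasDerivAt (expTauMat k) (tau k) 0 := by
  have h0 : HasDerivAt (fun t : ℝ => t / 2) (1 / 2) 0 := (hasDerivAt_id _).div_const 2
  have h1 := h0.cos.ofReal_comp.smul_const (1 : Mat 2)
  have h2 := (h0.sin.const_mul 2).ofReal_comp.smul_const (tau k)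
  refine (h1.add h2).congr_deriv ?_
  simp

theorem continuous_expTau (k : Fin 3) : Continuous (expTau k) := by
  refine Continuous.subtype_mk ?_ _
  unfold expTauMat
  fun_prop

/-- Every point of space is obtained by rotating a point of the third axis. -/
theorem exists_rot_axis (x : E3) : ∃ a b : ℝ, x = rot (expTau 2 a * expTau 1 b) (‖x‖ • axis 2) := by
  set z : ℂ := ⟨x 0, x 1⟩ with hz
  set w : ℂ := ⟨x 2, ‖z‖⟩ with hw
  have hn : ‖x‖ = ‖w‖ := by
    rw [EuclideanSpace.norm_eq, Complex.norm_eq_sqrt_sq_add_sq w]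
    simp only [hw, Fin.sum_univ_three, Real.norm_eq_abs, sq_abs]
    rw [Complex.sq_norm, Complex.normSq_apply]
    congr 1
    simp only [hz]; ring
  have h1 := Complex.norm_mul_cos_arg z
  have h2 := Complex.norm_mul_sin_arg z
  have h3 := Complex.norm_mul_cos_arg w
  have h4 := Complex.norm_mul_sin_arg w
  have h4' : ‖w‖ * Real.sin w.arg = ‖z‖ := h4
  refine ⟨z.arg, w.arg, ?_⟩
  rw [rot_mul, rot_expTau_one, rot_expTau_two, hn]
  ext i
  fin_cases i
  · simp only [axis]
    simp
    rw [mul_comm (Real.sin _), h4', mul_comm, h1]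
  · simp only [axis]
    simp
    rw [mul_comm (Real.sin w.arg), h4', mul_comm, h2]
  · simp only [axis]
    simp
    rw [mul_comm, h3]

end EYM
end

noncomputable section

namespace EYM

open NormedSpace Filter

variable {N : ℕ}

/-! ### Homomorphisms from `SU(2)` -/

theorem hasDerivAt_exp_conj (X y : Mat N) :
    HasDerivAt (fun t : ℝ => exp (t • X) * y * exp (-(t • X))) ⁅X, y⁆ 0 := by
  have h1 := ((hasDerivAt_exp_smul X 0).mul_const y).fun_mul (hasDerivAt_exp_smul (-X) 0)
  simp only [smul_neg] at h1
  refine h1.congr_deriv ?_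
  simp [Ring.lie_def, sub_eq_add_neg]

theorem exp_smul_injective {X Y : Mat N} (h : ∀ t : ℝ, exp (t • X) = exp (t • Y)) : X = Y := by
  have h1 := hasDerivAt_exp_smul X 0
  have h2 := hasDerivAt_exp_smul Y 0
  simp only [h] at h1
  simpa using h1.unique h2

/-- A curve in `SU(2)` through `1` with velocity `x · τ`. -/
def tauCurve (x : E3) (t : ℝ) : SU2 :=
  expTau 0 (t * x 0) * expTau 1 (t * x 1) * expTau 2 (t * x 2)

theorem coe_tauCurve (x : E3) (t : ℝ) : (tauCurve x t : Mat 2) =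
    expTauMat 0 (t * x 0) * expTauMat 1 (t * x 1) * expTauMat 2 (t * x 2) := rfl

theorem tauCurve_zero (x : E3) : tauCurve x 0 = 1 := by simp [tauCurve]

theorem tendsto_tauCurve_pow (x : E3) :
    Tendsto (fun n : ℕ => ((tauCurve x ((n : ℝ) + 1)⁻¹ ^ (n + 1) : SU2) : Mat 2)) atTop
      (𝓝 (exp (tauVec x))) := by
  have h1 : ∀ k, HasDerivAt (fun t : ℝ => expTauMat k (t * x k)) (x k • tau k) 0 := fun k => by
    have h2 : HasDerivAt (fun t : ℝ => t * x k) (x k) 0 := by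
      simpa using (hasDerivAt_id (0 : ℝ)).mul_const (x k)
    have h3 : HasDerivAt (expTauMat k) (tau k) (0 * x k) := by
      rw [zero_mul]; exact hasDerivAt_expTauMat k
    exact h3.scomp (0 : ℝ) h2
  have h0 : ∀ k, expTauMat k 0 = 1 := fun k => by simp [expTauMat]
  have h2 : HasDerivAt (fun t => (toU2 (tauCurve x t) : Mat 2)) (tauVec x) 0 := by
    simp only [coe_toU2, coe_tauCurve]
    refine (((h1 0).fun_mul (h1 1)).fun_mul (h1 2)).congr_deriv ?_
    simp [h0, tauVec, Fin.sum_univ_three]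
  have h3 := tendsto_pow_exp (star_tauVec x) (γ := fun t => toU2 (tauCurve x t))
    (by simp only [tauCurve_zero]; rfl) h2
  refine h3.congr fun n => ?_
  rw [SubmonoidClass.coe_pow, coe_toU2]

/-- The element `exp (x · τ)` of `SU(2)`. -/
theorem exp_tauVec_mem (x : E3) : exp (tauVec x) ∈ Matrix.specialUnitaryGroup (Fin 2) ℂ := by
  rw [Matrix.mem_specialUnitaryGroup_iff]
  refine ⟨(isCompact_unitary 2).isClosed.mem_of_tendsto (tendsto_tauCurve_pow x)
    (Eventually.of_forall fun n => (Matrix.mem_specialUnitaryGroup_iff.1 (Subtype.prop _)).1), ?_⟩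
  have h1 := (Continuous.matrix_det continuous_id).continuousAt.tendsto.comp
    (tendsto_tauCurve_pow x)
  have h2 : (fun n : ℕ => (((tauCurve x ((n : ℝ) + 1)⁻¹ ^ (n + 1) : SU2) : Mat 2)).det)
      = fun _ => 1 := funext fun n => (Matrix.mem_specialUnitaryGroup_iff.1 (Subtype.prop _)).2
  exact tendsto_nhds_unique h1 (by
    change Tendsto (fun n : ℕ => (((tauCurve x ((n : ℝ) + 1)⁻¹ ^ (n + 1) : SU2) : Mat 2)).det)
      atTop _
    rw [h2]; exact tendsto_const_nhds)

/-- The image `L (x · τ) = ∑ x_k L_k` of `x · τ` under the infinitesimal homomorphism. -/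
def genVec (L : Fin 3 → Mat N) (x : E3) : Mat N := ∑ j, x j • L j

theorem genVec_axis (L : Fin 3 → Mat N) (k : Fin 3) : genVec L (axis k) = L k := by
  fin_cases k <;> simp [genVec, axis]

section

variable {Φ : SU2 →* UGroup N} (hΦ : Continuous Φ) {L : Fin 3 → Mat N}
  (hL : ∀ k, L k = deriv (fun t : ℝ => (Φ (expTau k t) : Mat N)) 0)

include hΦ hL

theorem coe_hom_expTau (k : Fin 3) (t : ℝ) : (Φ (expTau k t) : Mat N) = exp (t • L k) := by
  rw [hL]
  refine eq_exp_of_continuous (φ := fun t => (Φ (expTau k t) : Mat N)) ?_ ?_ ?_ t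
  · exact continuous_subtype_val.comp (hΦ.comp (continuous_expTau k))
  · simp
  · intro s t
    simp [expTau_add]

theorem hom_generator_skew (k : Fin 3) : star (L k) = -L k := by
  refine star_eq_neg_of_mem (K := ⊤) ⟨fun t => Φ (expTau k t), fun _ => trivial, by simp, ?_⟩
  have h := hasDerivAt_exp_smul (L k) 0
  simp only [← coe_hom_expTau hΦ hL] at h
  simpa using h

/-- The infinitesimal homomorphism is linear, by the product formula
`exp (X + Y) = lim (exp (X / n) exp (Y / n)) ^ n`. -/
theorem coe_hom_exp_tauVec (x : E3) :
    (Φ ⟨exp (tauVec x), exp_tauVec_mem x⟩ : Mat N) = exp (genVec L x) := by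
  have h1 : Tendsto (fun n : ℕ => tauCurve x ((n : ℝ) + 1)⁻¹ ^ (n + 1)) atTop
      (𝓝 ⟨exp (tauVec x), exp_tauVec_mem x⟩) :=
    tendsto_subtype_rng.2 (tendsto_tauCurve_pow x)
  have h2 := (continuous_subtype_val.comp hΦ).continuousAt.tendsto.comp h1
  have h3 : ∀ k, HasDerivAt (fun t : ℝ => (Φ (expTau k (t * x k)) : Mat N)) (x k • L k) 0 :=
    fun k => by
      have h := hasDerivAt_exp_smul (x k • L k) 0
      simp only [smul_smul, ← coe_hom_expTau hΦ hL] at h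
      simpa using h
  have h4 : HasDerivAt (fun t => (Φ (tauCurve x t) : Mat N)) (genVec L x) 0 := by
    have h := ((h3 0).fun_mul (h3 1)).fun_mul (h3 2)
    simp only [tauCurve, map_mul]
    refine h.congr_deriv ?_
    simp [genVec, Fin.sum_univ_three]
  have hs : star (genVec L x) = -genVec L x := by
    simp [genVec, Fin.sum_univ_three, hom_generator_skew hΦ hL]
    abel
  have h5 := tendsto_pow_exp hs (γ := fun t => Φ (tauCurve x t))
    (by simp only [tauCurve_zero, map_one]) h4
  refine tendsto_nhds_unique h2 (h5.congr fun n => ?_)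
  simp

theorem Ad_hom_genVec (s : SU2) (x : E3) : Ad (Φ s) (genVec L x) = genVec L (rot s x) := by
  refine exp_smul_injective fun t => ?_
  have hsm : ∀ y : E3, t • genVec L y = genVec L (t • y) := fun y => by
    simp [genVec, Finset.smul_sum, smul_smul]
  have hAd : ∀ {n : ℕ} (g : UGroup n) (y : Mat n), exp (Ad g y) = Ad g (exp y) := fun g y =>
    Matrix.exp_units_conj (Unitary.toUnits g) y
  rw [← Complex.coe_smul, ← map_smul, Complex.coe_smul, hAd, hsm, hsm, ← rot_smul,
    ← coe_hom_exp_tauVec hΦ hL, ← coe_hom_exp_tauVec hΦ hL]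
  have e : (⟨exp (tauVec (rot s (t • x))), exp_tauVec_mem _⟩ : SU2)
      = s * ⟨exp (tauVec (t • x)), exp_tauVec_mem _⟩ * s⁻¹ := by
    apply Subtype.ext
    change exp (tauVec (rot s (t • x))) = _
    rw [tauVec_rot, hAd]
    rfl
  rw [e, map_mul, map_mul, map_inv]
  rfl

theorem hom_isSu2 : IsSu2 L := by
  have key : ∀ i j, ⁅L i, L j⁆ = genVec L (Configuration.rotField i (axis j)) := fun i j => by
    have h1 := hasDerivAt_exp_conj (L i) (L j)
    have h2 : HasDerivAt (fun t : ℝ => genVec L (rot (expTau i t) (axis j)))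
        (genVec L (Configuration.rotField i (axis j))) 0 := by
      let f : E3 →L[ℝ] Mat N := LinearMap.toContinuousLinearMap
        { toFun := genVec L
          map_add' := fun x y => by simp [genVec, add_smul, Finset.sum_add_distrib]
          map_smul' := fun c x => by simp [genVec, Finset.smul_sum, smul_smul] }
      exact f.hasFDerivAt.comp_hasDerivAt 0 (hasDerivAt_rot_expTau i (axis j))
    refine h1.unique (h2.congr_of_eventuallyEq (Eventually.of_forall fun t => ?_))
    simp only
    rw [← Ad_hom_genVec hΦ hL, genVec_axis, Ad_apply, coe_hom_expTau hΦ hL, star_exp,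
      star_smul_skew (hom_generator_skew hΦ hL i)]
  refine ⟨hom_generator_skew hΦ hL, ?_, ?_, ?_⟩ <;> rw [key] <;>
    simp [genVec, Configuration.rotField, axis, crossProduct, Fin.sum_univ_three]

end

end EYM
end

noncomputable section

namespace EYM

open NormedSpace Filter

variable {N : ℕ}

/-! ### Invariance of the potential -/

theorem rotField_zero (v : E3) : Configuration.rotField 0 v = !₂[0, -v 2, v 1] := by
  ext i; fin_cases i <;> simp [Configuration.rotField, axis, crossProduct]

theorem rotField_one (v : E3) : Configuration.rotField 1 v = !₂[v 2, 0, -v 0] := by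
  ext i; fin_cases i <;> simp [Configuration.rotField, axis, crossProduct]

theorem rotField_two (v : E3) : Configuration.rotField 2 v = !₂[-v 1, v 0, 0] := by
  ext i; fin_cases i <;> simp [Configuration.rotField, axis, crossProduct]

theorem rotField_zero_axis (r : ℝ) :
    Configuration.rotField 0 (r • axis 2) = (-r) • axis 1 := by
  rw [rotField_zero]; ext i; fin_cases i <;> simp [axis]

theorem rotField_one_axis (r : ℝ) : Configuration.rotField 1 (r • axis 2) = r • axis 0 := by
  rw [rotField_one]; ext i; fin_cases i <;> simp [axis]

theorem rotField_two_axis (r : ℝ) : Configuration.rotField 2 (r • axis 2) = 0 := by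
  rw [rotField_two]; ext i; fin_cases i <;> simp [axis]

theorem eq_sum_axis (v : E3) : v = v 0 • axis 0 + v 1 • axis 1 + v 2 • axis 2 := by
  ext i; fin_cases i <;> simp [axis]

theorem rot_expTau_two_axis (t r : ℝ) : rot (expTau 2 t) (r • axis 2) = r • axis 2 := by
  rw [rot_expTau, rotField_two_axis]
  have : Configuration.rotField 2 0 = 0 := by
    rw [rotField_two]; ext i; fin_cases i <;> simp
  simp [this]

/-- Any two vectors are reversed by a common rotation by `π`. -/
theorem exists_rot_eq_neg (x v : E3) : ∃ s : SU2, rot s x = -x ∧ rot s v = -v := by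
  obtain ⟨a, b, hx⟩ := exists_rot_axis x
  set s₁ := expTau 2 a * expTau 1 b
  set y := rot s₁⁻¹ v with hy
  have hv : v = rot s₁ y := by rw [hy, ← rot_mul, mul_inv_cancel, rot_one]
  set z : ℂ := ⟨y 0, y 1⟩ with hz
  have h1 := Complex.norm_mul_cos_arg z
  have h2 := Complex.norm_mul_sin_arg z
  have hy' : y = rot (expTau 2 z.arg) !₂[‖z‖, 0, y 2] := by
    rw [rot_expTau_two]
    ext i
    fin_cases i
    · simp; rw [mul_comm, h1]
    · simp; rw [mul_comm, h2]
    · simp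
  set s₂ := s₁ * expTau 2 z.arg with hs₂
  have hx2 : x = rot s₂ (‖x‖ • axis 2) := by rw [hs₂, rot_mul, rot_expTau_two_axis, ← hx]
  have hv2 : v = rot s₂ !₂[‖z‖, 0, y 2] := by rw [hs₂, rot_mul, ← hy', ← hv]
  have hneg : ∀ (s : SU2) (w : E3), rot s (-w) = -rot s w := fun s w => by
    simpa using rot_smul s (-1) w
  have key : ∀ w w' : E3, w = rot s₂ w' → rot (expTau 1 Real.pi) w' = -w' →
      rot (s₂ * expTau 1 Real.pi * s₂⁻¹) w = -w := by
    rintro w w' rfl h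
    rw [rot_mul, rot_mul, ← rot_mul s₂⁻¹, inv_mul_cancel, rot_one, h, hneg]
  refine ⟨s₂ * expTau 1 Real.pi * s₂⁻¹, key _ _ hx2 ?_, key _ _ hv2 ?_⟩ <;>
  · rw [rot_expTau_one]
    ext i
    fin_cases i <;> simp [axis]

namespace Configuration

variable {G : Subgroup (UGroup N)} (c : Configuration G)

theorem isSu2_LPhi : IsSu2 c.LPhi := hom_isSu2 c.Phi_continuous fun _ => rfl

theorem coe_Phi_expTau (k : Fin 3) (t : ℝ) : (c.Phi (expTau k t) : Mat N) = exp (t • c.LPhi k) :=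
  coe_hom_expTau c.Phi_continuous (fun _ => rfl) k t

theorem Phi_expTau (k : Fin 3) (t : ℝ) :
    c.Phi (expTau k t) = expU (t • c.LPhi k) (star_smul_skew (c.isSu2_LPhi.skew k) t) :=
  Subtype.ext (c.coe_Phi_expTau k t)

theorem A_rot_eq (s : SU2) (t : ℝ) (x : E3) (u : ℝ) (v : E3) :
    c.A (t, rot s x) (u, rot s v) = Ad (c.Phi s) (c.A (t, x) (u, v)) := c.A_rot s t x u v

theorem hasDerivAt_Ad_Phi (k : Fin 3) (y : Mat N) :
    HasDerivAt (fun t : ℝ => Ad (c.Phi (expTau k t)) y) ⁅c.LPhi k, y⁆ 0 := by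
  refine (hasDerivAt_exp_conj (c.LPhi k) y).congr_of_eventuallyEq
    (Eventually.of_forall fun t => ?_)
  simp only
  rw [Phi_expTau, Ad_exp]

theorem lie_LPhi_two_A (r u : ℝ) (v : E3) :
    ⁅c.LPhi 2, c.A (0, r • axis 2) (u, v)⁆ = c.A (0, r • axis 2) (0, rotField 2 v) := by
  have h1 := c.hasDerivAt_Ad_Phi 2 (c.A (0, r • axis 2) (u, v))
  have h2 : HasDerivAt (fun t : ℝ => c.A (0, r • axis 2) (u, rot (expTau 2 t) v))
      (c.A (0, r • axis 2) (0, rotField 2 v)) 0 :=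
    (c.A (0, r • axis 2)).hasFDerivAt.comp_hasDerivAt 0
      ((hasDerivAt_const (0 : ℝ) u).prodMk (hasDerivAt_rot_expTau 2 v))
  refine h1.unique (h2.congr_of_eventuallyEq (Eventually.of_forall fun t => ?_))
  simp only
  rw [← A_rot_eq, rot_expTau_two_axis]

/-- The magnetic part of the Wang map, `A (X_k)` at the point `r e_3`. -/
def magnetic (k : Fin 3) (r : ℝ) : Mat N := c.A (0, r • axis 2) (0, rotField k (r • axis 2))

theorem wang_eq (k : Fin 3) (r : ℝ) : c.wang k r = c.LPhi k + c.magnetic k r := rfl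

theorem magnetic_mem (k : Fin 3) (r : ℝ) : c.magnetic k r ∈ lieAlg G := c.A_mem _ _

theorem magnetic_zero_eq (r : ℝ) :
    c.magnetic 0 r = (-r) • c.A (0, r • axis 2) (0, axis 1) := by
  rw [magnetic, rotField_zero_axis, ← map_smul, Prod.smul_mk, smul_zero]

theorem magnetic_one_eq (r : ℝ) : c.magnetic 1 r = r • c.A (0, r • axis 2) (0, axis 0) := by
  rw [magnetic, rotField_one_axis, ← map_smul, Prod.smul_mk, smul_zero]

theorem lie_LPhi_two_magnetic_zero (r : ℝ) : ⁅c.LPhi 2, c.magnetic 0 r⁆ = c.magnetic 1 r := by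
  rw [magnetic, lie_LPhi_two_A, magnetic, rotField_zero_axis, rotField_one_axis, rotField_two]
  congr 2
  ext i; fin_cases i <;> simp [axis]

theorem lie_LPhi_two_magnetic_one (r : ℝ) : ⁅c.LPhi 2, c.magnetic 1 r⁆ = -c.magnetic 0 r := by
  rw [magnetic, lie_LPhi_two_A, magnetic, rotField_zero_axis, rotField_one_axis, rotField_two,
    ← map_neg, Prod.neg_mk, neg_zero]
  congr 2
  ext i; fin_cases i <;> simp [axis]

theorem lie_LPhi_two_electric (r : ℝ) : ⁅c.LPhi 2, c.electric r⁆ = 0 := by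
  rw [electric, lie_LPhi_two_A, rotField_two]
  have : (!₂[-(0 : E3) 1, (0 : E3) 0, 0] : E3) = 0 := by
    ext i; fin_cases i <;> simp
  rw [this]
  exact map_zero _

theorem lie_LPhi_two_wang_zero (r : ℝ) : ⁅c.LPhi 2, c.wang 0 r⁆ = c.wang 1 r := by
  rw [wang_eq, wang_eq, lie_add, lie_LPhi_two_magnetic_zero, c.isSu2_LPhi.lie20]

theorem lie_LPhi_two_wang_one (r : ℝ) : ⁅c.LPhi 2, c.wang 1 r⁆ = -c.wang 0 r := by
  rw [wang_eq, wang_eq, lie_add, lie_LPhi_two_magnetic_one, ← lie_skew, c.isSu2_LPhi.lie12, neg_add]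

theorem A_spatial_zero (t : ℝ) (v : E3) : c.A (t, 0) (0, v) = 0 := by
  -- no radial component along the line through `v`
  have h1 : Tendsto (fun e : ℝ => c.A (t, e • v) (0, v)) (𝓝[≠] 0) (𝓝 (c.A (t, 0) (0, v))) := by
    have hc : Continuous fun e : ℝ => c.A (t, e • v) (0, v) :=
      (c.A_smooth.continuous.comp (by fun_prop)).clm_apply continuous_const
    have := hc.tendsto 0
    simp only [zero_smul] at this
    exact this.mono_left nhdsWithin_le_nhds
  refine tendsto_nhds_unique h1 (tendsto_const_nhds.congr' ?_)
  filter_upwards [self_mem_nhdsWithin] with e he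
  have h2 := c.A_radial t (e • v)
  have h3 : ((0 : ℝ), e • v) = e • ((0 : ℝ), v) := by simp
  rw [h3, map_smul] at h2
  exact ((smul_eq_zero_iff_right (show e ≠ 0 from he)).1 h2).symm

theorem A_eq_add (t : ℝ) (x : E3) (u : ℝ) (v : E3) :
    c.A (t, x) (u, v) = u • c.A (t, x) (1, 0) + c.A (t, x) (0, v) := by
  rw [← map_smul, ← map_add]; simp

theorem A_origin (t : ℝ) : c.A (t, 0) = 0 := by
  refine ContinuousLinearMap.ext fun m => ?_
  rw [← Prod.mk.eta (p := m), A_eq_add, A_spatial_zero, A_time_zero]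
  simp

theorem magnetic_at_zero (k : Fin 3) : c.magnetic k 0 = 0 := by
  rw [magnetic, zero_smul, A_origin]; rfl

/-- The potential at `r e_3` in terms of the Wang map. -/
theorem smul_A_axis (r : ℝ) (v : E3) :
    r • c.A (0, r • axis 2) (0, v) = v 0 • c.magnetic 1 r - v 1 • c.magnetic 0 r := by
  have h : ((0 : ℝ), v) = v 0 • ((0 : ℝ), axis 0) + v 1 • ((0 : ℝ), axis 1)
      + v 2 • ((0 : ℝ), axis 2) := by
    conv_lhs => rw [eq_sum_axis v]
    simp
  have h2 : r • c.A (0, r • axis 2) (0, axis 2) = 0 := by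
    rw [← map_smul, Prod.smul_mk, smul_zero, c.A_radial]
  rw [h, map_add, map_add, map_smul, map_smul, map_smul, smul_add, smul_add, smul_comm r (v 2), h2,
    magnetic_zero_eq, magnetic_one_eq]
  module

theorem fderiv_A_rotField (k : Fin 3) (x : E3) (u : ℝ) (v : E3) :
    fderiv ℝ c.A (0, x) (0, rotField k x) (u, v) + c.A (0, x) (0, rotField k v)
      = ⁅c.LPhi k, c.A (0, x) (u, v)⁆ := by
  have h1 := c.hasDerivAt_Ad_Phi k (c.A (0, x) (u, v))
  have h0 : rot (expTau k 0) x = x := by simp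
  have hA : HasFDerivAt c.A (fderiv ℝ c.A (0, x)) (0, rot (expTau k 0) x) := by
    rw [h0]
    exact (c.A_smooth.differentiable (by simp) _).hasFDerivAt
  have h2 : HasDerivAt (fun t : ℝ => c.A (0, rot (expTau k t) x))
      (fderiv ℝ c.A (0, x) (0, rotField k x)) 0 :=
    HasFDerivAt.comp_hasDerivAt (f := fun t : ℝ => ((0, rot (expTau k t) x) : M4))
      (l := fun m : M4 => c.A m) (0 : ℝ) hA
      ((hasDerivAt_const (0 : ℝ) (0 : ℝ)).prodMk (hasDerivAt_rot_expTau k x))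
  have h3 : HasDerivAt (fun t : ℝ => ((u, rot (expTau k t) v) : M4)) (0, rotField k v) 0 :=
    (hasDerivAt_const (0 : ℝ) u).prodMk (hasDerivAt_rot_expTau k v)
  have h4 := h2.clm_apply h3
  simp only [expTau_zero, rot_one] at h4
  refine (h1.unique (h4.congr_of_eventuallyEq (Eventually.of_forall fun t => ?_))).symm
  simp only
  rw [← A_rot_eq]

/-- The flux density in terms of the Wang map. -/
theorem sq_smul_curvature (r : ℝ) :
    r ^ 2 • curvature c.A (0, r • axis 2) (0, axis 0) (0, axis 1)
      = ⁅c.wang 0 r, c.wang 1 r⁆ - c.LPhi 2 := by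
  have h0 : rotField 0 (axis 0) = 0 := by
    rw [rotField_zero]; ext i; fin_cases i <;> simp [axis]
  have h1 : rotField 1 (axis 1) = 0 := by
    rw [rotField_one]; ext i; fin_cases i <;> simp [axis]
  have hm : ((0 : ℝ), (0 : E3)) = 0 := rfl
  have e0 := c.fderiv_A_rotField 0 (r • axis 2) 0 (axis 0)
  have e1 := c.fderiv_A_rotField 1 (r • axis 2) 0 (axis 1)
  have s0 : ((0 : ℝ), (-r) • axis 1) = (-r) • ((0 : ℝ), axis 1) := by simp
  have s1 : ((0 : ℝ), r • axis 0) = r • ((0 : ℝ), axis 0) := by simp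
  rw [h0, rotField_zero_axis, hm, map_zero, add_zero, s0, map_smul,
    smul_apply] at e0
  rw [h1, rotField_one_axis, hm, map_zero, add_zero, s1, map_smul,
    smul_apply] at e1
  rw [curvature, wang_eq, wang_eq, add_lie, lie_add, lie_add, c.isSu2_LPhi.lie01, magnetic_zero_eq,
    magnetic_one_eq]
  have f0 : r ^ 2 • fderiv ℝ c.A (0, r • axis 2) (0, axis 0) (0, axis 1)
      = r • ⁅c.LPhi 1, c.A (0, r • axis 2) (0, axis 1)⁆ := by rw [← e1, smul_smul, sq]
  have f1 : r ^ 2 • fderiv ℝ c.A (0, r • axis 2) (0, axis 1) (0, axis 0)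
      = (-r) • ⁅c.LPhi 0, c.A (0, r • axis 2) (0, axis 0)⁆ := by
    rw [← e0, smul_smul, sq, neg_mul_neg]
  rw [smul_add, smul_sub, f0, f1]
  simp only [smul_lie, lie_smul]
  rw [← lie_skew (c.A (0, r • axis 2) (0, axis 1)) (c.LPhi 1),
    ← lie_skew (c.A (0, r • axis 2) (0, axis 1)) (c.A (0, r • axis 2) (0, axis 0))]
  module

/-- Time components vanish everywhere for a purely magnetic configuration. -/
theorem IsPurelyMagnetic.A_time {c : Configuration G} (h : c.IsPurelyMagnetic) (t : ℝ) (x : E3)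
    (u : ℝ) (v : E3) : c.A (t, x) (u, v) = c.A (0, x) (0, v) := by
  have h1 : c.A (0, x) (1, 0) = 0 := by
    obtain ⟨a, b, hx⟩ := exists_rot_axis x
    have h2 := c.A_rot_eq (expTau 2 a * expTau 1 b) 0 (‖x‖ • axis 2) 1 0
    have h3 : rot (expTau 2 a * expTau 1 b) 0 = 0 := by simpa using rot_smul _ 0 (0 : E3)
    have h4 : c.A (0, ‖x‖ • axis 2) (1, 0) = 0 := h ‖x‖ (norm_nonneg x)
    rw [← hx, h3, h4, map_zero] at h2
    exact h2
  rw [c.A_static, A_eq_add, h1, smul_zero, zero_add]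

theorem metric_parity (m v w : M4) :
    c.metric (parity m) (parity v) (parity w) = c.metric m v w := by
  have h1 : ∀ x, c.lapse (-x) = c.lapse x := fun x => by
    obtain ⟨s, hs, -⟩ := exists_rot_eq_neg x 0
    rw [← hs, c.lapse_rot]
  have h2 : ∀ x v, c.h (-x) v v = c.h x v v := fun x v => by
    obtain ⟨s, hs, hs'⟩ := exists_rot_eq_neg x v
    have := c.h_rot s x v v
    rw [hs, hs'] at this
    simpa using this
  have h3 : ∀ x v w, c.h (-x) v w = c.h x v w := fun x v w => by
    have a := h2 x (v + w)
    simp only [map_add, add_apply, h2] at a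
    have b := c.h_symm x v w
    have b' := c.h_symm (-x) v w
    linarith
  simp [metric, parity, h1, h3]

end Configuration

end EYM
end

noncomputable section

namespace EYM

open NormedSpace Filter

variable {N : ℕ}

/-! ### Lie algebra automorphisms and the adjoint action -/

/-- An endomorphism of the complexified Lie algebra intertwines the one-parameter groups of `X` and
of its image. -/
theorem map_Ad_exp {G : Subgroup (UGroup N)} (hG : IsClosed (G : Set (UGroup N)))
    {D : Mat N →ₗ[ℂ] Mat N}
    (hD : ∀ x ∈ lieAlgC G, ∀ y ∈ lieAlgC G, D ⁅x, y⁆ = ⁅D x, D y⁆) {X X' : Mat N}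
    (hX : X ∈ lieAlg G) (hX' : star X' = -X') (hDX : D X = X') {x : Mat N} (hx : x ∈ lieAlgC G) :
    D (Ad (expU X (star_eq_neg_of_mem hX)) x) = Ad (expU X' hX') (D x) := by
  have hXs := star_eq_neg_of_mem hX
  have hmem : ∀ t : ℝ, exp (t • X) * x * exp (-(t • X)) ∈ lieAlgC G := fun t => by
    obtain ⟨g, hg, hgX⟩ := exp_smul_mem_matSet hG hX t
    replace hgX : (g : Mat N) = exp (t • X) := hgX
    have h1 := Ad_mem_lieAlgC hg hx
    rwa [Ad_apply, hgX, star_exp_skew (star_smul_skew hXs t)] at h1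
  let D' : Mat N →L[ℝ] Mat N := LinearMap.toContinuousLinearMap (D.restrictScalars ℝ)
  have hderiv : ∀ t : ℝ, HasDerivAt (fun t : ℝ => exp (-(t • X')) * D (exp (t • X) * x *
      exp (-(t • X))) * exp (t • X')) 0 t := by
    intro t
    have h1 : HasDerivAt (fun t : ℝ => exp (t • X) * x * exp (-(t • X)))
        ⁅X, exp (t • X) * x * exp (-(t • X))⁆ t := by
      have h := ((hasDerivAt_exp_smul' X t).mul_const x).fun_mul (hasDerivAt_exp_smul (-X) t)
      simp only [smul_neg] at h
      refine h.congr_deriv ?_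
      rw [Ring.lie_def]
      noncomm_ring
    have h2 : HasDerivAt (fun t : ℝ => D (exp (t • X) * x * exp (-(t • X))))
        (D ⁅X, exp (t • X) * x * exp (-(t • X))⁆) t := D'.hasFDerivAt.comp_hasDerivAt t h1
    rw [hD _ (lieAlg_le_lieAlgC hX) _ (hmem t), hDX] at h2
    have h3 := hasDerivAt_exp_smul (-X') t
    simp only [smul_neg] at h3
    refine ((h3.fun_mul h2).fun_mul (hasDerivAt_exp_smul' X' t)).congr_deriv ?_
    rw [Ring.lie_def]
    noncomm_ring
  have hconst := is_const_of_deriv_eq_zero (fun t => (hderiv t).differentiableAt)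
    (fun t => (hderiv t).deriv) 1 0
  simp only [one_smul, zero_smul, neg_zero, exp_zero, one_mul, mul_one] at hconst
  rw [Ad_exp, Ad_exp, ← hconst]
  simp only [← mul_assoc, exp_mul_exp_neg, one_mul]
  simp only [mul_assoc, exp_mul_exp_neg, mul_one]

/-! ### Roots and the Chevalley automorphism -/

theorem lieAlg_mono {T G : Subgroup (UGroup N)} (h : T ≤ G) {X : Mat N} (hX : X ∈ lieAlg T) :
    X ∈ lieAlg G := by
  obtain ⟨γ, hγ, h0, hd⟩ := hX
  exact ⟨γ, fun t => h (hγ t), h0, hd⟩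

theorem IsTorusIn.lie_eq_zero {T G : Subgroup (UGroup N)} (hT : IsTorusIn T G) {X Y : Mat N}
    (hX : X ∈ lieAlg T) (hY : Y ∈ lieAlg T) : ⁅X, Y⁆ = 0 := by
  have h1 : ∀ g ∈ T, (g : Mat N) * Y = Y * g := fun g hg => by
    obtain ⟨γ, hγ, -, hd⟩ := hY
    refine (hd.const_mul (g : Mat N)).unique ((hd.mul_const (g : Mat N)).congr_of_eventuallyEq
      (Eventually.of_forall fun t => ?_))
    exact congrArg Subtype.val (hT.comm g hg _ (hγ t))
  obtain ⟨γ, hγ, -, hd⟩ := hX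
  rw [lie_eq_zero_iff]
  exact (hd.mul_const Y).unique ((hd.const_mul Y).congr_of_eventuallyEq
      (Eventually.of_forall fun t => h1 _ (hγ t)))

theorem IsTorusIn.lie_eq_zero' {T G : Subgroup (UGroup N)} (hT : IsTorusIn T G) {x y : Mat N}
    (hx : x ∈ lieAlgC T) (hy : y ∈ lieAlgC T) : ⁅x, y⁆ = 0 := by
  obtain ⟨a, ha, b, hb, rfl⟩ := mem_lieAlgC_iff.1 hx
  obtain ⟨a', ha', b', hb', rfl⟩ := mem_lieAlgC_iff.1 hy
  simp [hT.lie_eq_zero ha ha', hT.lie_eq_zero ha hb', hT.lie_eq_zero hb ha',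
    hT.lie_eq_zero hb hb']

theorem InRootSpace.star {G T : Subgroup (UGroup N)} {α : LTDual T} {e : Mat N}
    (h : InRootSpace G T α e) : InRootSpace G T (-α) (star e) := by
  refine ⟨star_mem_lieAlgC h.1, fun X => ?_⟩
  have h1 := congrArg Star.star (h.2 X)
  rw [star_lie_mat, star_eq_neg_of_mem X.2, lie_neg, star_smul] at h1
  rw [← lie_skew, h1]
  congr 1
  simp

theorem neg_mem_roots {G T : Subgroup (UGroup N)} {α : LTDual T} (h : α ∈ roots G T) :
    -α ∈ roots G T := by
  obtain ⟨h0, e, he, hr⟩ := h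
  exact ⟨neg_ne_zero.2 h0, star e, star_ne_zero.2 he, hr.star⟩

theorem InRootSpace.lie {G T : Subgroup (UGroup N)} {α β : LTDual T} {x y : Mat N}
    (hx : InRootSpace G T α x) (hy : InRootSpace G T β y) :
    InRootSpace G T (α + β) ⁅x, y⁆ := by
  refine ⟨lie_mem_lieAlgC hx.1 hy.1, fun X => ?_⟩
  rw [leibniz_lie, hx.2 X, hy.2 X, smul_lie, lie_smul, ← add_smul]
  congr 1
  simp; ring

/-- A matrix in a root space of a non-root vanishes. -/
theorem InRootSpace.eq_zero {G T : Subgroup (UGroup N)} {α : LTDual T} {x : Mat N}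
    (hx : InRootSpace G T α x) (h0 : α ≠ 0) (h : α ∉ roots G T) : x = 0 := by
  by_contra hne
  exact h ⟨h0, x, hne, hx⟩

theorem InRootSpace.ip_eq_zero {G T : Subgroup (UGroup N)} {α β : LTDual T} {x y : Mat N}
    (hx : InRootSpace G T α x) (hy : InRootSpace G T β y) (h : α ≠ β) : ip x y = 0 := by
  obtain ⟨X, hX⟩ : ∃ X, α X ≠ β X := by
    by_contra! hcon
    exact h (LinearMap.ext hcon)
  have h1 : ip ⁅(X : Mat N), x⁆ y = -ip x ⁅(X : Mat N), y⁆ := by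
    rw [ip_lie_left, star_eq_neg_of_mem X.2, neg_lie, ip_neg_right]
  rw [hx.2 X, hy.2 X, ip_smul_left, ip_smul_right] at h1
  simp only [Complex.star_def, map_mul, Complex.conj_I, Complex.conj_ofReal,
    Complex.conj_ofNat] at h1
  have h2 : (2 * Real.pi * Complex.I : ℂ) * (((β X - α X : ℝ) : ℂ) * ip x y) = 0 := by
    push_cast
    linear_combination h1
  have h3 := (mul_eq_zero.1 h2).resolve_left Complex.two_pi_I_ne_zero
  refine (mul_eq_zero.1 h3).resolve_left ?_
  exact_mod_cast sub_ne_zero.2 (Ne.symm hX)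

theorem weylChamber_pos {T : Subgroup (UGroup N)} {S : Set (LTDual T)} {H : lieAlg T}
    (hH : H ∈ weylChamber S) {α : LTDual T} (hα : α ∈ AddSubmonoid.closure S) :
    α = 0 ∨ 0 < α H := by
  induction hα using AddSubmonoid.closure_induction with
  | mem α h => exact Or.inr (hH α h)
  | zero => exact Or.inl rfl
  | add α β _ _ h1 h2 =>
    rcases h1 with rfl | h1
    · simpa using h2
    rcases h2 with rfl | h2
    · right; simpa using h1
    · right; simp only [LinearMap.add_apply]; linarith

theorem IsRootBase.apply_ne_zero {G T : Subgroup (UGroup N)} {S : Set (LTDual T)}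
    (hS : IsRootBase G T S) {H : lieAlg T} (hH : H ∈ weylChamber S) {α : LTDual T}
    (hα : α ∈ roots G T) : α H ≠ 0 := by
  rcases hS.pos_or_neg α hα with h | h
  · rcases weylChamber_pos hH h with h | h
    · exact absurd h hα.1
    · exact h.ne'
  · rcases weylChamber_pos hH h with h | h
    · exact absurd (neg_eq_zero.1 h) hα.1
    · intro h0
      simp [h0] at h

theorem IsRootBase.mem_levelTwoRoots {G T : Subgroup (UGroup N)} {S : Set (LTDual T)}
    (hS : IsRootBase G T S) {H : lieAlg T} (hH : H ∈ weylChamber S) {α : LTDual T}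
    (hα : α ∈ roots G T) (h2 : α H = 2) : α ∈ levelTwoRoots G T S H := by
  refine ⟨⟨hα, (hS.pos_or_neg α hα).resolve_right fun h => ?_⟩, h2⟩
  rcases weylChamber_pos hH h with h | h
  · exact hα.1 (neg_eq_zero.1 h)
  · rw [LinearMap.neg_apply, h2] at h
    norm_num at h

namespace ChevalleyWeylBasis

variable {G T : Subgroup (UGroup N)} {S : Set (LTDual T)} (B : ChevalleyWeylBasis G T S)

theorem finite_index (B : ChevalleyWeylBasis G T S) : Finite (S ⊕ roots G T) :=
  Module.Finite.finite_basis B.basis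

theorem h_mem {α : LTDual T} (hα : α ∈ roots G T) : B.h α ∈ lieAlgC T := by
  have h1 : B.h α = (-Complex.I) • (Complex.I • B.h α) := by
    rw [smul_smul]; simp
  rw [h1]
  exact Submodule.smul_mem _ _ (lieAlg_le_lieAlgC (B.I_smul_h_mem α hα))

theorem star_h {α : LTDual T} (hα : α ∈ roots G T) : star (B.h α) = B.h α := by
  have h1 := star_eq_neg_of_mem (B.I_smul_h_mem α hα)
  rw [star_smul, Complex.star_def, Complex.conj_I, neg_smul, neg_inj] at h1
  exact smul_right_injective _ Complex.I_ne_zero h1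

theorem star_e {α : LTDual T} (hα : α ∈ roots G T) : star (B.e α) = -B.e (-α) := by
  have h1 := star_eq_neg_of_mem (B.add_mem α hα)
  have h2 := star_eq_neg_of_mem (B.I_smul_sub_mem α hα)
  rw [star_smul, Complex.star_def, Complex.conj_I, neg_smul, neg_inj] at h2
  have h3 := smul_right_injective _ Complex.I_ne_zero h2
  rw [star_add] at h1
  rw [star_sub] at h3
  have h4 : (2 : ℂ) • star (B.e α) = (2 : ℂ) • (-B.e (-α)) := by
    have := congrArg₂ (· + ·) h1 h3
    calc (2 : ℂ) • star (B.e α)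
        = star (B.e α) + star (B.e (-α)) + (star (B.e α) - star (B.e (-α))) := by module
      _ = -(B.e α + B.e (-α)) + (B.e α - B.e (-α)) := this
      _ = _ := by module
  exact smul_right_injective _ two_ne_zero h4

theorem eq_sum [Fintype (S ⊕ roots G T)] (x : lieAlgC G) :
    (x : Mat N) = ∑ i, B.basis.repr x i • (B.basis i : Mat N) := by
  calc (x : Mat N) = ((∑ i, B.basis.repr x i • B.basis i : lieAlgC G) : Mat N) := by
        rw [B.basis.sum_repr]
    _ = _ := by rw [Submodule.coe_sum]; rfl

/-- Induction over the basis of the complexified Lie algebra. -/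
theorem mem_induction {p : Mat N → Prop} (hh : ∀ α ∈ S, p (B.h α))
    (he : ∀ α ∈ roots G T, p (B.e α)) (zero : p 0) (add : ∀ x y, p x → p y → p (x + y))
    (smul : ∀ (c : ℂ) x, p x → p (c • x)) {x : Mat N} (hx : x ∈ lieAlgC G) : p x := by
  have := B.finite_index
  let := Fintype.ofFinite (S ⊕ roots G T)
  have e : x = _ := B.eq_sum ⟨x, hx⟩
  rw [e]
  refine Finset.sum_induction _ p add zero fun i _ => smul _ _ ?_
  rcases i with α | α
  · rw [B.basis_inl]; exact hh _ α.2
  · rw [B.basis_inr]; exact he _ α.2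

/-- The Chevalley automorphism, extended to a linear map on all matrices. -/
def chev : Mat N →ₗ[ℂ] Mat N := Classical.choose (LinearMap.exists_extend B.chevalley)

theorem chev_coe (x : lieAlgC G) : B.chev x = B.chevalley x :=
  LinearMap.congr_fun (Classical.choose_spec (LinearMap.exists_extend B.chevalley)) x

theorem chev_e {α : LTDual T} (hα : α ∈ roots G T) : B.chev (B.e α) = B.e (-α) := by
  rw [← B.basis_inr ⟨α, hα⟩, chev_coe, chevalley, Module.Basis.constr_basis]
  rfl

theorem chev_h_base {α : LTDual T} (hα : α ∈ S) : B.chev (B.h α) = -B.h α := by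
  rw [← B.basis_inl ⟨α, hα⟩, chev_coe, chevalley, Module.Basis.constr_basis]
  rw [B.basis_inl]
  rfl

theorem chev_star (hS : IsRootBase G T S) {x : Mat N} (hx : x ∈ lieAlgC G) :
    B.chev (star x) = star (B.chev x) :=
  B.mem_induction (p := fun x => B.chev (star x) = star (B.chev x))
    (fun α hα => by
      rw [B.star_h (hS.subset hα), B.chev_h_base hα, star_neg, B.star_h (hS.subset hα)])
    (fun α hα => by
      rw [B.star_e hα, map_neg, B.chev_e (neg_mem_roots hα), B.chev_e hα,
        B.star_e (neg_mem_roots hα)])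
    (by simp) (fun x y h1 h2 => by rw [star_add, map_add, h1, h2, map_add, star_add])
    (fun c x h => by rw [star_smul, map_smul, h, map_smul, star_smul]) hx

theorem lie_mem (hT : IsTorusIn T G) (X : lieAlg T) {x : Mat N} (hx : x ∈ lieAlgC G) :
    ⁅(X : Mat N), x⁆ ∈ lieAlgC G :=
  lie_mem_lieAlgC (lieAlg_le_lieAlgC (lieAlg_mono hT.le X.2)) hx

/-- The antilinear involution `x ↦ -𝒞 (x*)` fixes the basis, so its fixed vectors are those with
real coordinates. -/
theorem neg_chev_star_eq_iff (hS : IsRootBase G T S) (x : lieAlgC G) :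
    -B.chev (star (x : Mat N)) = x ↔
    ∀ i, (B.basis.repr x i).im = 0 := by
  have := B.finite_index
  let := Fintype.ofFinite (S ⊕ roots G T)
  have hb : ∀ i, -B.chev (star (B.basis i : Mat N)) = B.basis i := by
    rintro (α | α)
    · rw [B.basis_inl, B.star_h (hS.subset α.2), B.chev_h_base α.2, neg_neg]
    · rw [B.basis_inr, B.star_e α.2, map_neg, neg_neg, B.chev_e (neg_mem_roots α.2), neg_neg]
  have h1 : -B.chev (star (x : Mat N))
      = ∑ i, (starRingEnd ℂ) (B.basis.repr x i) • (B.basis i : Mat N) := by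
    conv_lhs => rw [B.eq_sum x]
    rw [star_sum, map_sum, ← Finset.sum_neg_distrib]
    refine Finset.sum_congr rfl fun i _ => ?_
    rw [star_smul, map_smul, ← smul_neg, hb]; rfl
  rw [h1]
  constructor
  · intro h i
    have h2 : ∑ i, (starRingEnd ℂ) (B.basis.repr x i) • B.basis i = x := by
      apply Subtype.ext
      rw [← h]; simp
    have h3 := congrArg (fun y => B.basis.repr y i) h2
    simp only [Module.Basis.repr_sum_self] at h3
    exact Complex.conj_eq_iff_im.1 h3
  · intro h
    conv_rhs => rw [B.eq_sum x]
    exact Finset.sum_congr rfl fun i _ => by rw [Complex.conj_eq_iff_im.2 (h i)]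

section

variable (hT : IsTorusIn T G) (hS : IsRootBase G T S)

include hT

theorem lie_h_base (hS : IsRootBase G T S) (X : lieAlg T) {α : LTDual T} (hα : α ∈ S) :
    ⁅(X : Mat N), B.h α⁆ = 0 :=
  hT.lie_eq_zero' (lieAlg_le_lieAlgC X.2) (B.h_mem (hS.subset hα))

include hS

/-- The adjoint action of `LT` in coordinates. -/
theorem repr_lie (X : lieAlg T) (x : lieAlgC G) (i : S ⊕ roots G T) :
    B.basis.repr ⟨⁅(X : Mat N), (x : Mat N)⁆, lie_mem hT X x.2⟩ i
      = Sum.elim (fun _ => 0)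
          (fun α : roots G T => 2 * (Real.pi : ℂ) * Complex.I * (((α : LTDual T) X : ℝ) : ℂ)) i
        * B.basis.repr x i := by
  let f : lieAlgC G →ₗ[ℂ] lieAlgC G :=
    (LieAlgebra.ad ℂ (Mat N) (X : Mat N)).restrict fun x hx => lie_mem hT X hx
  set w : S ⊕ roots G T → ℂ := Sum.elim (fun _ => 0)
    (fun α : roots G T => 2 * (Real.pi : ℂ) * Complex.I * (((α : LTDual T) X : ℝ) : ℂ)) with hw
  have hf : ∀ j, f (B.basis j) = w j • B.basis j := by
    intro j
    apply Subtype.ext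
    change ⁅(X : Mat N), (B.basis j : Mat N)⁆ = w j • (B.basis j : Mat N)
    rcases j with α | α
    · rw [B.basis_inl, B.lie_h_base hT hS X α.2, hw, Sum.elim_inl, zero_smul]
    · rw [B.basis_inr, (B.e_mem _ α.2).2 X]; rfl
  have key : (Finsupp.lapply i ∘ₗ B.basis.repr.toLinearMap ∘ₗ f)
      = w i • (Finsupp.lapply i ∘ₗ B.basis.repr.toLinearMap) := by
    refine B.basis.ext fun j => ?_
    simp only [LinearMap.comp_apply, hf, map_smul, LinearMap.smul_apply, LinearEquiv.coe_coe,
      Finsupp.lapply_apply, Module.Basis.repr_self, smul_eq_mul]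
    by_cases hij : j = i
    · rw [hij]
    · rw [Finsupp.single_eq_of_ne (Ne.symm hij), mul_zero, mul_zero]
  exact LinearMap.congr_fun key x

/-- Eigenvectors of `H` belonging to the level two. -/
theorem repr_eq_zero_of_level (H : lieAlg T) {x : Mat N} (hx : x ∈ lieAlgC G)
    (h2 : ⁅(H : Mat N), x⁆ = (2 * (Real.pi : ℂ) * Complex.I * 2) • x) (i : S ⊕ roots G T)
    (hi : ∀ α : roots G T, i = Sum.inr α → (α : LTDual T) H ≠ 2) :
    B.basis.repr ⟨x, hx⟩ i = 0 := by
  have h1 := B.repr_lie hT hS H ⟨x, hx⟩ i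
  have h3 : (⟨⁅(H : Mat N), x⁆, lie_mem hT H hx⟩ : lieAlgC G)
      = (2 * (Real.pi : ℂ) * Complex.I * 2) • ⟨x, hx⟩ := Subtype.ext h2
  simp only at h1
  rw [h3, map_smul, Finsupp.smul_apply, smul_eq_mul] at h1
  rcases i with α | α
  · rw [Sum.elim_inl, zero_mul] at h1
    exact (mul_eq_zero.1 h1).resolve_left (mul_ne_zero Complex.two_pi_I_ne_zero two_ne_zero)
  · rw [Sum.elim_inr, ← sub_eq_zero, ← sub_mul, ← mul_sub] at h1
    refine (mul_eq_zero.1 h1).resolve_left (mul_ne_zero Complex.two_pi_I_ne_zero ?_)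
    have := hi α rfl
    rw [sub_ne_zero]
    exact_mod_cast Ne.symm this

variable {H : lieAlg T} (hH : H ∈ weylChamber S)

include hH

theorem repr_inr_eq_zero {x : Mat N} (hx : x ∈ lieAlgC G) (h0 : ⁅(H : Mat N), x⁆ = 0)
    (α : roots G T) : B.basis.repr ⟨x, hx⟩ (Sum.inr α) = 0 := by
  have h1 := B.repr_lie hT hS H ⟨x, hx⟩ (Sum.inr α)
  have h2 : (⟨⁅(H : Mat N), x⁆, lie_mem hT H hx⟩ : lieAlgC G) = 0 := Subtype.ext h0
  simp only at h1
  rw [h2, map_zero, Finsupp.zero_apply, Sum.elim_inr] at h1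
  refine (mul_eq_zero.1 h1.symm).resolve_left (mul_ne_zero Complex.two_pi_I_ne_zero ?_)
  exact_mod_cast hS.apply_ne_zero hH α.2

/-- The centralizer of a regular element is spanned by the `h_α`. -/
theorem induction_centralizer {p : Mat N → Prop} (hh : ∀ α ∈ S, p (B.h α)) (zero : p 0)
    (add : ∀ x y, p x → p y → p (x + y)) (smul : ∀ (c : ℂ) x, p x → p (c • x)) {x : Mat N}
    (hx : x ∈ lieAlgC G) (h0 : ⁅(H : Mat N), x⁆ = 0) : p x := by
  have := B.finite_index
  let := Fintype.ofFinite (S ⊕ roots G T)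
  have e : x = _ := B.eq_sum ⟨x, hx⟩
  rw [e]
  refine Finset.sum_induction _ p add zero fun i _ => ?_
  rcases i with α | α
  · rw [B.basis_inl]; exact smul _ _ (hh _ α.2)
  · rw [B.repr_inr_eq_zero hT hS hH hx h0, zero_smul]; exact zero

theorem mem_lieAlgC_torus (B : ChevalleyWeylBasis G T S) {x : Mat N} (hx : x ∈ lieAlgC G)
    (h0 : ⁅(H : Mat N), x⁆ = 0) :
    x ∈ lieAlgC T :=
  B.induction_centralizer hT hS hH (p := fun x => x ∈ lieAlgC T)
    (fun _ hα => B.h_mem (hS.subset hα)) (zero_mem _) (fun _ _ => AddMemClass.add_mem)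
    (fun c _ h => Submodule.smul_mem _ c h) hx h0

theorem chev_of_lie_eq_zero {x : Mat N} (hx : x ∈ lieAlgC G) (h0 : ⁅(H : Mat N), x⁆ = 0) :
    B.chev x = -x :=
  B.induction_centralizer hT hS hH (p := fun x => B.chev x = -x) (fun _ hα => B.chev_h_base hα)
    (by simp) (fun x y h1 h2 => by rw [map_add, h1, h2, neg_add])
    (fun c x h => by rw [map_smul, h, smul_neg]) hx h0

theorem chev_torus {x : Mat N} (hx : x ∈ lieAlgC T) : B.chev x = -x := by
  refine B.chev_of_lie_eq_zero hT hS hH ?_ (hT.lie_eq_zero' (lieAlg_le_lieAlgC H.2) hx)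
  obtain ⟨a, ha, b, hb, rfl⟩ := mem_lieAlgC_iff.1 hx
  exact mem_lieAlgC_iff.2 ⟨a, lieAlg_mono hT.le ha, b, lieAlg_mono hT.le hb, rfl⟩

theorem chev_lie {x y : Mat N} (hx : x ∈ lieAlgC G) (hy : y ∈ lieAlgC G) :
    B.chev ⁅x, y⁆ = ⁅B.chev x, B.chev y⁆ := by
  have hhe : ∀ α ∈ S, ∀ β ∈ roots G T,
      B.chev ⁅B.h α, B.e β⁆ = ⁅B.chev (B.h α), B.chev (B.e β)⁆ := by
    intro α hα β hβ
    have h1 : B.h α = (-Complex.I) • (Complex.I • B.h α) := by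
      rw [smul_smul]; simp
    have h2 := (B.e_mem β hβ).2 ⟨_, B.I_smul_h_mem α (hS.subset hα)⟩
    have h3 := (B.e_mem (-β) (neg_mem_roots hβ)).2 ⟨_, B.I_smul_h_mem α (hS.subset hα)⟩
    simp only at h2 h3
    rw [B.chev_h_base hα, B.chev_e hβ, neg_lie, h1, smul_lie,
      smul_lie (-Complex.I) _ (B.e (-β)), h2, h3, map_smul, map_smul,
      B.chev_e hβ]
    simp only [LinearMap.neg_apply, Complex.ofReal_neg, mul_neg, neg_smul, smul_neg, neg_neg]
  have hee : ∀ α ∈ roots G T, ∀ β ∈ roots G T,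
      B.chev ⁅B.e α, B.e β⁆ = ⁅B.chev (B.e α), B.chev (B.e β)⁆ := by
    intro α hα β hβ
    have hα' := neg_mem_roots hα
    have hβ' := neg_mem_roots hβ
    rw [B.chev_e hα, B.chev_e hβ]
    by_cases h0 : α + β = 0
    · obtain rfl : β = -α := (neg_eq_of_add_eq_zero_right h0).symm
      rw [B.lie_e_neg α hα, map_neg, B.chev_torus hT hS hH (B.h_mem hα), neg_neg, neg_neg,
        ← lie_skew, B.lie_e_neg α hα, neg_neg]
    by_cases hr : α + β ∈ roots G T
    · obtain ⟨r, hr'⟩ := B.lie_e_e α hα β hβ hr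
      have h1 := congrArg star hr'
      rw [star_lie_mat, B.star_e hα, B.star_e hβ, star_smul, B.star_e hr, neg_lie, lie_neg,
        neg_neg, Complex.star_def, Complex.conj_ofReal, smul_neg, ← lie_skew, neg_inj] at h1
      rw [hr', map_smul, B.chev_e hr, h1]
    · rw [((B.e_mem α hα).lie (B.e_mem β hβ)).eq_zero h0 hr, map_zero]
      refine (((B.e_mem _ hα').lie (B.e_mem _ hβ')).eq_zero ?_ ?_).symm
      · rw [← neg_add]; exact neg_ne_zero.2 h0
      · rw [← neg_add]
        intro h
        exact hr (by simpa using neg_mem_roots h)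
  have ext2 : ∀ a : Mat N, (∀ α ∈ S, B.chev ⁅a, B.h α⁆ = ⁅B.chev a, B.chev (B.h α)⁆) →
      (∀ α ∈ roots G T, B.chev ⁅a, B.e α⁆ = ⁅B.chev a, B.chev (B.e α)⁆) →
      B.chev ⁅a, y⁆ = ⁅B.chev a, B.chev y⁆ := fun a h1 h2 =>
    B.mem_induction (p := fun y => B.chev ⁅a, y⁆ = ⁅B.chev a, B.chev y⁆) h1 h2 (by simp)
      (fun x y h1 h2 => by rw [lie_add, map_add, h1, h2, map_add, lie_add])
      (fun c x h => by rw [lie_smul, map_smul, h, map_smul, lie_smul]) hy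
  refine B.mem_induction (p := fun x => B.chev ⁅x, y⁆ = ⁅B.chev x, B.chev y⁆) (fun α hα => ?_)
    (fun α hα => ?_) (by simp) (fun x y h1 h2 => by rw [add_lie, map_add, h1, h2, map_add, add_lie])
    (fun c x h => by rw [smul_lie, map_smul, h, map_smul, smul_lie]) hx
  · refine ext2 _ (fun β hβ => ?_) (hhe α hα)
    rw [B.chev_h_base hα, B.chev_h_base hβ, neg_lie, lie_neg, neg_neg,
      hT.lie_eq_zero' (B.h_mem (hS.subset hα)) (B.h_mem (hS.subset hβ)), map_zero]
  · refine ext2 _ (fun β hβ => ?_) (hee α hα)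
    rw [← lie_skew, map_neg, hhe β hβ α hα, lie_skew]

end

end ChevalleyWeylBasis

end EYM
end

noncomputable section

namespace EYM

open NormedSpace Filter

variable {N : ℕ}

/-! ### Euler angles -/

theorem exists_eq_expTau_two {u : SU2} (hu : rot u (axis 2) = axis 2) : ∃ t, u = expTau 2 t := by
  have h1 := tauVec_rot u (axis 2)
  have h2 : tauVec (axis 2) = !![-Complex.I / 2, 0; 0, Complex.I / 2] := by
    rw [tauVec_eq]; ext i j; fin_cases i <;> fin_cases j <;> simp [axis]
  rw [hu, eq_comm, Ad_eq_self_iff, coe_toU2, h2] at h1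
  obtain ⟨hU, hdet⟩ := Matrix.mem_specialUnitaryGroup_iff.1 u.2
  set m : Mat 2 := (u : Mat 2)
  have h01 := congrFun (congrFun h1 0) 1
  have h10 := congrFun (congrFun h1 1) 0
  simp only [Matrix.mul_apply, Fin.sum_univ_two, Matrix.of_apply, Matrix.cons_val',
    Matrix.cons_val_zero,
    Matrix.cons_val_one, Matrix.cons_val_fin_one, mul_zero, zero_mul, zero_add, add_zero] at h01 h10
  have e01 : m 0 1 = 0 := by
    have : Complex.I * m 0 1 = 0 := by linear_combination h01
    exact (mul_eq_zero.1 this).resolve_left Complex.I_ne_zero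
  have e10 : m 1 0 = 0 := by
    have : Complex.I * m 1 0 = 0 := by linear_combination -h10
    exact (mul_eq_zero.1 this).resolve_left Complex.I_ne_zero
  have hU00 := congrFun (congrFun (Matrix.mem_unitaryGroup_iff.1 hU) 0) 0
  simp only [Matrix.mul_apply, Fin.sum_univ_two, Matrix.star_apply, e01, star_zero, mul_zero,
    add_zero, Matrix.one_apply_eq] at hU00
  rw [Matrix.det_fin_two, e01, zero_mul, sub_zero] at hdet
  have e11 : m 1 1 = star (m 0 0) := by
    have h0 : m 0 0 ≠ 0 := fun h => by rw [h, zero_mul] at hdet; exact zero_ne_one hdet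
    exact mul_left_cancel₀ h0 (hdet.trans hU00.symm)
  have hn : ‖m 0 0‖ = 1 := by
    have h3 : ((‖m 0 0‖ ^ 2 : ℝ) : ℂ) = 1 := by
      rw [← hU00]; push_cast; exact (Complex.mul_conj' _).symm
    have h4 : ‖m 0 0‖ ^ 2 = 1 := by exact_mod_cast h3
    exact (pow_eq_one_iff_of_nonneg (norm_nonneg _) two_ne_zero).1 h4
  have hc := Complex.norm_mul_cos_arg (m 0 0)
  have hs := Complex.norm_mul_sin_arg (m 0 0)
  rw [hn, one_mul] at hc hs
  refine ⟨-2 * (m 0 0).arg, Subtype.ext ?_⟩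
  rw [coe_expTau, expTauMat_eq]
  have hh : -2 * (m 0 0).arg / 2 = -(m 0 0).arg := by ring
  have hI : (2 * Complex.I)⁻¹ = -Complex.I / 2 := by
    rw [mul_inv, Complex.inv_I]; ring
  rw [hh, Real.cos_neg, Real.sin_neg, hc, hs]
  change m = _
  ext i j
  fin_cases i <;> fin_cases j
  · simp [tau, hI, Complex.ext_iff]; ring
  · simp [tau, e01]
  · simp [tau, e10]
  · simp [tau, hI, e11, Complex.ext_iff]; ring

theorem exists_euler_angles (s : SU2) :
    ∃ a b t : ℝ, s = expTau 2 a * expTau 1 b * expTau 2 t := by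
  obtain ⟨a, b, h⟩ := exists_rot_axis (rot s (axis 2))
  have hn : ‖axis 2‖ = 1 := by simp [axis]
  rw [norm_rot, hn, one_smul] at h
  obtain ⟨t, ht⟩ := exists_eq_expTau_two (u := (expTau 2 a * expTau 1 b)⁻¹ * s) (by
    rw [rot_mul, h, ← rot_mul, inv_mul_cancel, rot_one])
  exact ⟨a, b, t, by rw [← ht, mul_inv_cancel_left]⟩

/-! ### The eigenspace of level two -/

theorem IsSu2.star_raise {L : Fin 3 → Mat N} (hL : IsSu2 L) :
    star (L 0 + Complex.I • L 1) = -(L 0 - Complex.I • L 1) := by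
  rw [star_add, star_smul, hL.skew, hL.skew, Complex.star_def, Complex.conj_I]
  module

theorem IsSu2.lie_raise_lower {L : Fin 3 → Mat N} (hL : IsSu2 L) :
    ⁅L 0 + Complex.I • L 1, L 0 - Complex.I • L 1⁆ = (-2 * Complex.I) • L 2 := by
  have h10 : ⁅L 1, L 0⁆ = -L 2 := by rw [← lie_skew, hL.lie01]
  simp only [add_lie, lie_sub, smul_lie, lie_smul, lie_self, hL.lie01, h10]
  module

theorem IsSu2.lie_two_raise {L : Fin 3 → Mat N} (hL : IsSu2 L) :
    ⁅L 2, L 0 + Complex.I • L 1⁆ = (-Complex.I) • (L 0 + Complex.I • L 1) := by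
  have h21 : ⁅L 2, L 1⁆ = -L 0 := by rw [← lie_skew, hL.lie12]
  rw [lie_add, lie_smul, hL.lie20, h21, smul_add, smul_smul, neg_mul, Complex.I_mul_I]
  module

theorem IsSu2.lie_two_lower {L : Fin 3 → Mat N} (hL : IsSu2 L) :
    ⁅L 2, L 0 - Complex.I • L 1⁆ = Complex.I • (L 0 - Complex.I • L 1) := by
  have h21 : ⁅L 2, L 1⁆ = -L 0 := by rw [← lie_skew, hL.lie12]
  rw [lie_sub, lie_smul, hL.lie20, h21, smul_sub, smul_smul, Complex.I_mul_I]
  module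

/-- The lowering operator is injective on vectors of positive weight:
`|[L₋, x]|² = 2 |x|² + |[L₊, x]|²`. -/
theorem IsSu2.eq_zero_of_lie_lower {L : Fin 3 → Mat N} (hL : IsSu2 L) {x : Mat N}
    (hx : ⁅L 2, x⁆ = (-Complex.I) • x) (h0 : ⁅L 0 - Complex.I • L 1, x⁆ = 0) : x = 0 := by
  set P := L 0 + Complex.I • L 1
  set M := L 0 - Complex.I • L 1
  have h1 : ⁅M, ⁅P, x⁆⁆ = (2 : ℂ) • x := by
    have h2 := leibniz_lie P M x
    rw [h0, lie_zero, hL.lie_raise_lower, smul_lie, hx, smul_smul] at h2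
    have e : -2 * Complex.I * -Complex.I = -2 := by linear_combination 2 * Complex.I_sq
    rw [e, eq_comm, add_comm, ← eq_sub_iff_add_eq, zero_sub] at h2
    rw [h2]; module
  have h2 : ip ⁅P, x⁆ ⁅P, x⁆ = -(2 * ip x x) := by
    rw [ip_lie_left, hL.star_raise, neg_lie, h1, ip_neg_right, ip_smul_right]
  have h3 := congrArg Complex.re h2
  simp only [Complex.neg_re, Complex.mul_re, Complex.re_ofNat, Complex.im_ofNat, zero_mul,
    sub_zero] at h3
  have h4 := ip_self_re_nonneg ⁅P, x⁆
  have h5 := ip_self_re_nonneg x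
  exact ip_self_re_eq_zero.1 (by linarith)

/-- The raising operator maps the weight zero onto the next weight, dually to the injectivity of the
lowering operator. -/
theorem IsSu2.exists_lie_raise_eq {G : Subgroup (UGroup N)} {L : Fin 3 → Mat N} (hL : IsSu2 L)
    (hLG : ∀ k, L k ∈ lieAlg G) {y : Mat N} (hy : y ∈ lieAlgC G)
    (hy2 : ⁅L 2, y⁆ = (-Complex.I) • y) :
    ∃ z ∈ lieAlgC G, ⁅L 2, z⁆ = 0 ∧ ⁅L 0 + Complex.I • L 1, z⁆ = y := by
  have hPG : L 0 + Complex.I • L 1 ∈ lieAlgC G := add_mem (lieAlg_le_lieAlgC (hLG 0))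
    (Submodule.smul_mem _ _ (lieAlg_le_lieAlgC (hLG 1)))
  have hMG : L 0 - Complex.I • L 1 ∈ lieAlgC G := sub_mem (lieAlg_le_lieAlgC (hLG 0))
    (Submodule.smul_mem _ _ (lieAlg_le_lieAlgC (hLG 1)))
  let g0 : Submodule ℂ (Mat N) :=
    { carrier := {x | x ∈ lieAlgC G ∧ ⁅L 2, x⁆ = 0}
      add_mem' := fun hx hy => ⟨add_mem hx.1 hy.1, by rw [lie_add, hx.2, hy.2, add_zero]⟩
      zero_mem' := ⟨zero_mem _, lie_zero _⟩
      smul_mem' := fun c x hx => ⟨Submodule.smul_mem _ c hx.1, by rw [lie_smul, hx.2, smul_zero]⟩ }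
  obtain ⟨w, ⟨z, hz, hzw⟩, horth⟩ := exists_orthogonal_projection
    (g0.map (LieAlgebra.ad ℂ (Mat N) (L 0 + Complex.I • L 1))) y
  replace hzw : ⁅L 0 + Complex.I • L 1, z⁆ = w := hzw
  have hw2 : ⁅L 2, w⁆ = (-Complex.I) • w := by
    rw [← hzw, leibniz_lie, hL.lie_two_raise, hz.2, lie_zero, add_zero, smul_lie]
  have hwG : w ∈ lieAlgC G := hzw ▸ lie_mem_lieAlgC hPG hz.1
  refine ⟨z, hz.1, hz.2, ?_⟩
  rw [hzw, eq_comm, ← sub_eq_zero]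
  refine hL.eq_zero_of_lie_lower (by rw [lie_sub, hy2, hw2, smul_sub]) ?_
  have hd2 : ⁅L 2, y - w⁆ = (-Complex.I) • (y - w) := by rw [lie_sub, hy2, hw2, smul_sub]
  have hm : ⁅L 0 - Complex.I • L 1, y - w⁆ ∈ g0 :=
    ⟨lie_mem_lieAlgC hMG (sub_mem hy hwG), by
      rw [leibniz_lie, hL.lie_two_lower, hd2, smul_lie, lie_smul]; module⟩
  have h1 := horth _ (Submodule.mem_map_of_mem hm)
  change ip ⁅L 0 + Complex.I • L 1, ⁅L 0 - Complex.I • L 1, y - w⁆⁆ (y - w) = 0 at h1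
  rw [ip_lie_left, hL.star_raise, neg_lie, ip_neg_right, neg_eq_zero] at h1
  exact ip_self_eq_zero.1 h1

namespace ChevalleyWeylBasis

variable {G T : Subgroup (UGroup N)} {S : Set (LTDual T)} (B : ChevalleyWeylBasis G T S)

theorem Ad_torus (hT : IsTorusIn T G) {g : UGroup N} (hg : g ∈ T) {x : Mat N}
    (hx : x ∈ lieAlgC T) : Ad g x = x := by
  obtain ⟨X, hX, hXg⟩ := exists_exp_eq hT.closed hT.connected hg
  have e : g = expU X (star_eq_neg_of_mem hX) := Subtype.ext hXg.symm
  rw [e]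
  exact Ad_exp_eq_self _ (hT.lie_eq_zero' (lieAlg_le_lieAlgC hX) hx)

theorem expU_mem (hT : IsTorusIn T G) (X : lieAlg T) :
    expU (X : Mat N) (star_eq_neg_of_mem X.2) ∈ T := by
  obtain ⟨g, hg, hgX⟩ := exp_mem_matSet hT.closed X.2
  have e : g = expU (X : Mat N) (star_eq_neg_of_mem X.2) := Subtype.ext hgX
  exact e ▸ hg

/-- The adjoint action of the torus in coordinates. -/
theorem repr_Ad_exp (hT : IsTorusIn T G) (hS : IsRootBase G T S) (X : lieAlg T)
    (x y : lieAlgC G) (α : roots G T)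
    (hy : (y : Mat N) = Ad (expU (X : Mat N) (star_eq_neg_of_mem X.2)) x) :
    B.basis.repr y (Sum.inr α)
      = Complex.exp (2 * Real.pi * Complex.I * (((α : LTDual T) X : ℝ) : ℂ))
      * B.basis.repr x (Sum.inr α) := by
  set g := expU (X : Mat N) (star_eq_neg_of_mem X.2)
  have hgG : g ∈ G := hT.le (expU_mem hT X)
  let f : lieAlgC G →ₗ[ℂ] lieAlgC G := (Ad g).restrict fun x hx => Ad_mem_lieAlgC hgG hx
  obtain rfl : y = f x := Subtype.ext hy
  set r : ℂ := Complex.exp (2 * Real.pi * Complex.I * (((α : LTDual T) X : ℝ) : ℂ)) with hr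
  have key : (Finsupp.lapply (Sum.inr α) ∘ₗ B.basis.repr.toLinearMap ∘ₗ f)
      = r • (Finsupp.lapply (Sum.inr α) ∘ₗ B.basis.repr.toLinearMap) := by
    have hj : ∀ j : S ⊕ roots G T, ∀ s : ℂ, f (B.basis j) = s • B.basis j →
        (j = Sum.inr α → s = r) → (Finsupp.lapply (Sum.inr α) ∘ₗ B.basis.repr.toLinearMap ∘ₗ f)
          (B.basis j)
          = (r • (Finsupp.lapply (Sum.inr α) ∘ₗ B.basis.repr.toLinearMap)) (B.basis j) := by
      intro j s hs hr
      simp only [LinearMap.comp_apply, hs, map_smul, LinearMap.smul_apply, LinearEquiv.coe_coe,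
        Finsupp.lapply_apply, Module.Basis.repr_self, smul_eq_mul]
      by_cases hij : j = Sum.inr α
      · rw [hr hij]
      · rw [Finsupp.single_eq_of_ne (Ne.symm hij), mul_zero, mul_zero]
    refine B.basis.ext fun j => ?_
    rcases j with β | β
    · refine hj _ 1 (Subtype.ext ?_) (by simp)
      change Ad g (B.basis (Sum.inl β) : Mat N) = (1 : ℂ) • (B.basis (Sum.inl β) : Mat N)
      rw [one_smul]
      refine Ad_exp_eq_self _ ?_
      rw [B.basis_inl]
      exact B.lie_h_base hT hS X β.2
    · refine hj _ (Complex.exp (2 * Real.pi * Complex.I * (((β : LTDual T) X : ℝ) : ℂ)))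
        (Subtype.ext ?_) (by rintro ⟨⟩; rfl)
      change Ad g (B.basis (Sum.inr β) : Mat N) = _ • (B.basis (Sum.inr β) : Mat N)
      rw [Ad_exp, B.basis_inr]
      exact exp_conj_of_lie_eq ((B.e_mem β β.2).2 X)
  exact LinearMap.congr_fun key x

section

variable {H : lieAlg T} {L : Fin 3 → Mat N}

theorem lie_two_eq (hL2 : L 2 = -((4 * Real.pi)⁻¹ • (H : Mat N))) (x : Mat N) :
    ⁅L 2, x⁆ = (-(4 * Real.pi : ℂ)⁻¹) • ⁅(H : Mat N), x⁆ := by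
  rw [hL2, neg_lie, smul_lie, ← Complex.coe_smul, neg_smul]
  push_cast
  rfl

theorem lie_two_eq_zero (hL2 : L 2 = -((4 * Real.pi)⁻¹ • (H : Mat N))) {x : Mat N} :
    ⁅L 2, x⁆ = 0 ↔ ⁅(H : Mat N), x⁆ = 0 := by
  rw [lie_two_eq hL2]
  refine smul_eq_zero_iff_right (neg_ne_zero.2 (inv_ne_zero ?_))
  exact_mod_cast (by positivity : (4 * Real.pi) ≠ 0)

theorem lie_level (hL2 : L 2 = -((4 * Real.pi)⁻¹ • (H : Mat N))) {x : Mat N}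
    (hx : ⁅L 2, x⁆ = (-Complex.I) • x) :
    ⁅(H : Mat N), x⁆ = (2 * (Real.pi : ℂ) * Complex.I * 2) • x := by
  rw [lie_two_eq hL2] at hx
  have hpi : (4 * Real.pi : ℂ) ≠ 0 := by exact_mod_cast (by positivity : (4 * Real.pi) ≠ 0)
  have h1 := congrArg (fun y => (-(4 * Real.pi : ℂ)) • y) hx
  simp only [smul_smul, neg_mul_neg, mul_inv_cancel₀ hpi, one_smul] at h1
  rw [h1]
  congr 1
  ring

theorem raise_mem {G : Subgroup (UGroup N)} (hLG : ∀ k, L k ∈ lieAlg G) :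
    L 0 + Complex.I • L 1 ∈ lieAlgC G :=
  AddMemClass.add_mem (lieAlg_le_lieAlgC (hLG 0))
    (Submodule.smul_mem _ _ (lieAlg_le_lieAlgC (hLG 1)))

/-- In coordinates, the surjectivity of the raising operator onto the level two. -/
theorem exists_torus_of_level (hT : IsTorusIn T G) (hS : IsRootBase G T S)
    (hH : H ∈ weylChamber S) (hL : IsSu2 L) (hLG : ∀ k, L k ∈ lieAlg G)
    (hL2 : L 2 = -((4 * Real.pi)⁻¹ • (H : Mat N))) (t : LTDual T → ℂ) :
    ∃ a b : lieAlg T, ∀ α : roots G T, (α : LTDual T) H = 2 →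
      -(2 * Real.pi * Complex.I * ((((α : LTDual T) a : ℝ) : ℂ)
          + Complex.I * (((α : LTDual T) b : ℝ) : ℂ)))
        * B.basis.repr ⟨L 0 + Complex.I • L 1, raise_mem hLG⟩ (Sum.inr α) = t α := by
  classical
  have := B.finite_index
  let := Fintype.ofFinite (S ⊕ roots G T)
  let d : S ⊕ roots G T → ℂ := Sum.elim (fun _ => 0)
    (fun α : roots G T => if (α : LTDual T) H = 2 then t α else 0)
  let y : lieAlgC G := ∑ i, d i • B.basis i
  have hd : ∀ i, ⁅L 2, d i • (B.basis i : Mat N)⁆ = (-Complex.I) • d i • (B.basis i : Mat N) := by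
    rintro (α | α)
    · simp [d]
    · by_cases h2 : (α : LTDual T) H = 2
      · rw [lie_smul, lie_two_eq hL2, B.basis_inr, (B.e_mem α α.2).2 H, h2, smul_smul, smul_smul,
          smul_smul]
        congr 1
        have hpi : (Real.pi : ℂ) ≠ 0 := by exact_mod_cast Real.pi_ne_zero
        push_cast
        field_simp
        ring
      · simp [d, h2]
  have hy : (y : Mat N) = ∑ i, d i • (B.basis i : Mat N) := by
    simp only [y, Submodule.coe_sum, Submodule.coe_smul]
  have hy2 : ⁅L 2, (y : Mat N)⁆ = (-Complex.I) • (y : Mat N) := by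
    rw [hy, lie_sum, Finset.smul_sum]
    exact Finset.sum_congr rfl fun i _ => hd i
  obtain ⟨z, hz, hz0, hzy⟩ := hL.exists_lie_raise_eq hLG y.2 hy2
  obtain ⟨a, ha, b, hb, rfl⟩ := mem_lieAlgC_iff.1
    (B.mem_lieAlgC_torus hT hS hH hz ((lie_two_eq_zero hL2).1 hz0))
  refine ⟨⟨a, ha⟩, ⟨b, hb⟩, fun α h2 => ?_⟩
  set p : lieAlgC G := ⟨L 0 + Complex.I • L 1, raise_mem hLG⟩
  have e : y = -(⟨⁅a, (p : Mat N)⁆, lie_mem hT ⟨a, ha⟩ p.2⟩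
      + Complex.I • ⟨⁅b, (p : Mat N)⁆, lie_mem hT ⟨b, hb⟩ p.2⟩) := by
    apply Subtype.ext
    change (y : Mat N) = -(⁅a, (p : Mat N)⁆ + Complex.I • ⁅b, (p : Mat N)⁆)
    rw [← hzy, ← lie_skew, add_lie, smul_lie]
  have h3 := congrArg (fun y => B.basis.repr y (Sum.inr α)) e
  have ea := B.repr_lie hT hS ⟨a, ha⟩ p (Sum.inr α)
  have eb := B.repr_lie hT hS ⟨b, hb⟩ p (Sum.inr α)
  simp only [Sum.elim_inr] at ea eb
  simp only [map_neg, map_add, map_smul, Finsupp.neg_apply, Finsupp.add_apply, Finsupp.smul_apply,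
    smul_eq_mul, ea, eb] at h3
  have h4 : B.basis.repr y (Sum.inr α) = t α := by
    simp only [y, Module.Basis.repr_sum_self]
    simp [d, h2]
  rw [← h4, h3]
  ring

theorem coeff_raise_ne_zero (hT : IsTorusIn T G) (hS : IsRootBase G T S)
    (hH : H ∈ weylChamber S) (hL : IsSu2 L) (hLG : ∀ k, L k ∈ lieAlg G)
    (hL2 : L 2 = -((4 * Real.pi)⁻¹ • (H : Mat N))) (α : roots G T) (hα : (α : LTDual T) H = 2) :
    B.basis.repr ⟨L 0 + Complex.I • L 1, raise_mem hLG⟩ (Sum.inr α) ≠ 0 := by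
  obtain ⟨a, b, h⟩ := B.exists_torus_of_level hT hS hH hL hLG hL2 fun _ => 1
  intro h0
  have := h α hα
  rw [h0, mul_zero] at this
  exact zero_ne_one this

/-- The roots of level two are linearly independent: they take prescribed values. -/
theorem exists_root_values (B : ChevalleyWeylBasis G T S) (hT : IsTorusIn T G)
    (hS : IsRootBase G T S)
    (hH : H ∈ weylChamber S) (hL : IsSu2 L) (hLG : ∀ k, L k ∈ lieAlg G)
    (hL2 : L 2 = -((4 * Real.pi)⁻¹ • (H : Mat N))) (θ : LTDual T → ℝ) :
    ∃ X : lieAlg T, ∀ α : roots G T, (α : LTDual T) H = 2 → (α : LTDual T) X = θ α := by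
  classical
  obtain ⟨a, b, h⟩ := B.exists_torus_of_level hT hS hH hL hLG hL2 fun α =>
    if hα : α ∈ roots G T then -(2 * Real.pi * Complex.I * θ α)
      * B.basis.repr ⟨L 0 + Complex.I • L 1, raise_mem hLG⟩ (Sum.inr ⟨α, hα⟩) else 0
  refine ⟨a, fun α hα => ?_⟩
  have h1 := h α hα
  rw [dif_pos α.2] at h1
  have h2 := mul_right_cancel₀ (B.coeff_raise_ne_zero hT hS hH hL hLG hL2 α hα) h1
  have h3 := mul_left_cancel₀ Complex.two_pi_I_ne_zero (neg_injective h2)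
  simpa using congrArg Complex.re h3

end

end ChevalleyWeylBasis

/-! ### Twisted Chevalley automorphisms -/

/-- The properties of the conjugates of the Chevalley automorphism by torus elements that are used:
`Θ` is compatible with the bracket and with the conjugation of the complexified Lie algebra, and it
acts as `-1` on the torus. Its values off the complexified Lie algebra do not matter. -/
structure IsTwist (G T : Subgroup (UGroup N)) (Θ : Mat N →ₗ[ℂ] Mat N) : Prop where
  lie : ∀ x ∈ lieAlgC G, ∀ y ∈ lieAlgC G, Θ ⁅x, y⁆ = ⁅Θ x, Θ y⁆
  star : ∀ x ∈ lieAlgC G, Θ (star x) = star (Θ x)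
  torus : ∀ x ∈ lieAlgC T, Θ x = -x

namespace ChevalleyWeylBasis

variable {G T : Subgroup (UGroup N)} {S : Set (LTDual T)} (B : ChevalleyWeylBasis G T S)

theorem chev_Ad (hG : IsClosed (G : Set (UGroup N))) (hT : IsTorusIn T G) (hS : IsRootBase G T S)
    {H : lieAlg T} (hH : H ∈ weylChamber S) {g : UGroup N} (hg : g ∈ T) {x : Mat N}
    (hx : x ∈ lieAlgC G) : B.chev (Ad g x) = Ad g⁻¹ (B.chev x) := by
  obtain ⟨X, hX, hXg⟩ := exists_exp_eq hT.closed hT.connected hg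
  have hXs := star_eq_neg_of_mem hX
  have e : g = expU X hXs := Subtype.ext hXg.symm
  have e' : g⁻¹ = expU (-X) (by rw [star_neg, hXs]) := by
    apply Subtype.ext
    change star (g : Mat N) = exp (-X)
    rw [← hXg, star_exp_skew hXs]
  rw [e', e]
  exact map_Ad_exp hG (fun x hx y hy => B.chev_lie hT hS hH hx hy) (lieAlg_mono hT.le hX) _
    (B.chev_torus hT hS hH (lieAlg_le_lieAlgC hX)) hx

/-- The conjugate of the Chevalley automorphism by an element of the torus. -/
def twist (g : UGroup N) : Mat N →ₗ[ℂ] Mat N := Ad (g * g) ∘ₗ B.chev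

theorem twist_apply (g : UGroup N) (x : Mat N) : B.twist g x = Ad (g * g) (B.chev x) := rfl

theorem isTwist (hT : IsTorusIn T G)
    (hS : IsRootBase G T S) {H : lieAlg T} (hH : H ∈ weylChamber S) {g : UGroup N} (hg : g ∈ T) :
    IsTwist G T (B.twist g) where
  lie x hx y hy := by
    rw [twist_apply, B.chev_lie hT hS hH hx hy, Ad_lie]; rfl
  star x hx := by rw [twist_apply, B.chev_star hS hx, ← star_Ad]; rfl
  torus x hx := by
    rw [twist_apply, B.chev_torus hT hS hH hx, map_neg, Ad_torus hT (T.mul_mem hg hg) hx]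

/-- Real coordinates of `Ad g⁻¹ x`, in terms of the twisted automorphism. -/
theorem repr_real_iff (hG : IsClosed (G : Set (UGroup N))) (hT : IsTorusIn T G)
    (hS : IsRootBase G T S) {H : lieAlg T} (hH : H ∈ weylChamber S) {g : UGroup N} (hg : g ∈ T)
    {x y : Mat N} (hx : x ∈ lieAlgC G) (hy : y ∈ lieAlgC G) (hxy : y = Ad g⁻¹ x)
    (hx2 : ⁅(H : Mat N), x⁆ = (2 * (Real.pi : ℂ) * Complex.I * 2) • x) :
    (∀ α : roots G T, (α : LTDual T) ∈ levelTwoRoots G T S H →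
      (B.basis.repr ⟨y, hy⟩ (Sum.inr α)).im = 0) ↔ B.twist g (star x) = -x := by
  have hy2 : ⁅(H : Mat N), y⁆ = (2 * (Real.pi : ℂ) * Complex.I * 2) • y := by
    have h := congrArg (Ad g⁻¹) hx2
    rwa [Ad_lie, map_smul, ← hxy, Ad_torus hT (T.inv_mem hg) (lieAlg_le_lieAlgC H.2)] at h
  have h1 : (∀ α : roots G T, (α : LTDual T) ∈ levelTwoRoots G T S H →
      (B.basis.repr ⟨y, hy⟩ (Sum.inr α)).im = 0) ↔ ∀ i, (B.basis.repr ⟨y, hy⟩ i).im = 0 := by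
    refine ⟨fun h i => ?_, fun h α _ => h _⟩
    by_cases hi : ∃ α : roots G T, i = Sum.inr α ∧ (α : LTDual T) H = 2
    · obtain ⟨α, rfl, h2⟩ := hi
      exact h α (hS.mem_levelTwoRoots hH α.2 h2)
    · push Not at hi
      rw [B.repr_eq_zero_of_level hT hS H hy hy2 i hi, Complex.zero_im]
  rw [h1, ← B.neg_chev_star_eq_iff hS]
  change -B.chev (star y) = y ↔ _
  rw [hxy, star_Ad, B.chev_Ad hG hT hS hH (T.inv_mem hg) (star_mem_lieAlgC hx), inv_inv,
    twist_apply, Ad_mul, neg_eq_iff_eq_neg, ← map_neg]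
  constructor
  · intro h; rw [h, Ad_Ad_inv]
  · intro h; rw [← h, Ad_inv_Ad]

end ChevalleyWeylBasis

end EYM
end

noncomputable section

namespace EYM

open NormedSpace Filter

variable {N : ℕ}

/-! ### Real amplitudes and twisted Chevalley automorphisms -/

section

variable {G T : Subgroup (UGroup N)} {Θ : Mat N →ₗ[ℂ] Mat N}

theorem twist_star_raise_iff (hΘ : IsTwist G T Θ) {x y : Mat N} (hx : x ∈ lieAlg G)
    (hy : y ∈ lieAlg G) :
    Θ (star (x + Complex.I • y)) = -(x + Complex.I • y) ↔ Θ x = x ∧ Θ y = -y := by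
  have hxs := star_eq_neg_of_mem hx
  have hys := star_eq_neg_of_mem hy
  have hsx : star (Θ x) = -Θ x := by rw [← hΘ.star x (lieAlg_le_lieAlgC hx), hxs, map_neg]
  have hsy : star (Θ y) = -Θ y := by rw [← hΘ.star y (lieAlg_le_lieAlgC hy), hys, map_neg]
  have e : star (x + Complex.I • y) = -x + Complex.I • y := by
    simp [star_smul, hxs, hys]
  rw [e, map_add, map_neg, map_smul]
  constructor
  · intro h
    have h' := congrArg star h
    simp only [star_add, star_neg, star_smul, hsx, hsy, hxs, hys, Complex.star_def,
      Complex.conj_I, neg_neg, smul_neg, neg_smul] at h'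
    have h1 : (2 : ℂ) • Θ x = (2 : ℂ) • x := by
      rw [two_smul, two_smul]
      linear_combination (norm := module) h' - h
    have h2 : ((2 : ℂ) * Complex.I) • Θ y = ((2 : ℂ) * Complex.I) • (-y) := by
      rw [mul_smul, mul_smul, two_smul, two_smul, smul_neg]
      linear_combination (norm := module) h' + h
    have hI : (2 : ℂ) * Complex.I ≠ 0 := by simp
    exact ⟨smul_right_injective _ two_ne_zero h1, smul_right_injective _ hI h2⟩
  · rintro ⟨h1, h2⟩
    rw [h1, h2, smul_neg, neg_add]

end

namespace Configuration

variable {G T : Subgroup (UGroup N)} {S : Set (LTDual T)} (c : Configuration G)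

theorem wang_at_zero (k : Fin 3) : c.wang k 0 = c.LPhi k := by
  rw [wang_eq, magnetic_at_zero, add_zero]

theorem lie_LPhi_two_wang_raise (r : ℝ) :
    ⁅c.LPhi 2, c.wang 0 r + Complex.I • c.wang 1 r⁆
      = (-Complex.I) • (c.wang 0 r + Complex.I • c.wang 1 r) := by
  rw [lie_add, lie_smul, lie_LPhi_two_wang_zero, lie_LPhi_two_wang_one, smul_add, smul_smul,
    neg_mul, Complex.I_mul_I, neg_neg, one_smul, smul_neg, neg_smul]
  abel

theorem hasRealAmplitudes_iff (hG : IsClosed (G : Set (UGroup N))) (hT : IsTorusIn T G)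
    (hS : IsRootBase G T S) (B : ChevalleyWeylBasis G T S) {Hl : lieAlg T}
    (hgen : c.IsGeneric S Hl) :
    c.HasRealAmplitudes B Hl ↔ ∃ g ∈ T, ∀ r : ℝ, 0 ≤ r →
      B.twist g (c.wang 0 r) = c.wang 0 r ∧ B.twist g (c.wang 1 r) = -c.wang 1 r := by
  have key : ∀ (g : G) (_ : (g : UGroup N) ∈ T) (r : ℝ),
      (∀ α : roots G T, (α : LTDual T) ∈ levelTwoRoots G T S Hl →
        (c.amplitude B g r α).im = 0) ↔
      (B.twist g (c.wang 0 r) = c.wang 0 r ∧ B.twist g (c.wang 1 r) = -c.wang 1 r) := by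
    intro g hg r
    have hx : c.wang 0 r + Complex.I • c.wang 1 r ∈ lieAlgC G :=
      (lieAlgC G).add_mem (lieAlg_le_lieAlgC (c.wang_mem 0 r))
        ((lieAlgC G).smul_mem _ (lieAlg_le_lieAlgC (c.wang_mem 1 r)))
    have hy : c.wangPlusMat g r
        = Ad (g : UGroup N)⁻¹ (c.wang 0 r + Complex.I • c.wang 1 r) := by
      rw [Ad_apply, wangPlusMat]
      have e : (((g : UGroup N)⁻¹ : UGroup N) : Mat N) = star ((g : UGroup N) : Mat N) := rfl
      rw [e, star_star]
    have h1 := B.repr_real_iff hG hT hS hgen.2 hg hx (c.wangPlusMat_mem g r) hy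
      (ChevalleyWeylBasis.lie_level hgen.1 (c.lie_LPhi_two_wang_raise r))
    have h2 := twist_star_raise_iff (B.isTwist hT hS hgen.2 hg) (c.wang_mem 0 r)
      (c.wang_mem 1 r)
    exact h1.trans h2
  constructor
  · rintro ⟨g, hg, h⟩
    exact ⟨g, hg, fun r hr => (key g hg r).1 fun α hα => h α hα r hr⟩
  · rintro ⟨g, hg, h⟩
    exact ⟨⟨g, hT.le hg⟩, hg, fun α hα r hr => (key ⟨g, hT.le hg⟩ hg r).2 (h r hr) α hα⟩

/-- Some element of the torus makes the amplitudes at the origin real and positive. -/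
theorem exists_twist_LPhi (hG : IsClosed (G : Set (UGroup N))) (hT : IsTorusIn T G)
    (hS : IsRootBase G T S) (B : ChevalleyWeylBasis G T S) {Hl : lieAlg T}
    (hgen : c.IsGeneric S Hl) :
    ∃ g ∈ T, B.twist g (c.LPhi 0) = c.LPhi 0 ∧ B.twist g (c.LPhi 1) = -c.LPhi 1 := by
  classical
  set p : lieAlgC G := ⟨c.LPhi 0 + Complex.I • c.LPhi 1, ChevalleyWeylBasis.raise_mem c.LPhi_mem⟩
    with hp
  obtain ⟨X, hX⟩ := B.exists_root_values hT hS hgen.2 c.isSu2_LPhi c.LPhi_mem hgen.1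
    (fun α => if hα : α ∈ roots G T then
      (B.basis.repr p (Sum.inr ⟨α, hα⟩)).arg / (2 * Real.pi) else 0)
  have hXs := star_eq_neg_of_mem X.2
  have hg := ChevalleyWeylBasis.expU_mem hT X
  refine ⟨_, hg, ?_⟩
  have e' : (expU (X : Mat N) hXs)⁻¹
      = expU ((-X : lieAlg T) : Mat N) (star_eq_neg_of_mem (-X).2) := by
    apply Subtype.ext
    change star (exp (X : Mat N)) = exp (-(X : Mat N))
    rw [star_exp_skew hXs]
  have hy := Ad_mem_lieAlgC (hT.le (T.inv_mem hg)) p.2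
  have h1 := B.repr_real_iff hG hT hS hgen.2 hg p.2 hy rfl
    (ChevalleyWeylBasis.lie_level hgen.1 c.isSu2_LPhi.lie_two_raise)
  have h3 := twist_star_raise_iff (B.isTwist hT hS hgen.2 hg) (c.LPhi_mem 0) (c.LPhi_mem 1)
  refine h3.1 (h1.1 fun α hα => ?_)
  rw [B.repr_Ad_exp hT hS (-X) p ⟨_, hy⟩ α (congrArg (fun g => Ad g (p : Mat N)) e')]
  have h2 := hX α hα.2
  rw [dif_pos α.2] at h2
  rw [map_neg, h2]
  set z := B.basis.repr p (Sum.inr α)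
  have e2 : Complex.exp (2 * Real.pi * Complex.I * ((-(z.arg / (2 * Real.pi)) : ℝ) : ℂ)) * z
      = ((‖z‖ : ℝ) : ℂ) := by
    conv_lhs => rw [← Complex.norm_mul_exp_arg_mul_I z]
    rw [mul_left_comm, ← Complex.exp_add]
    have h0 : (Real.pi : ℂ) ≠ 0 := by exact_mod_cast Real.pi_ne_zero
    rw [Complex.norm_mul_exp_arg_mul_I]
    rw [show (2 * Real.pi * Complex.I * ((-(z.arg / (2 * Real.pi)) : ℝ) : ℂ)
        + (z.arg : ℂ) * Complex.I) = 0 by push_cast; field_simp; ring, Complex.exp_zero, mul_one]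
  rw [e2, Complex.ofReal_im]

/-! ### The parity-reflected potential -/

section Twist

variable {Θ : Mat N →ₗ[ℂ] Mat N}

theorem Ad_Phi_pi (k : Fin 3) :
    Ad (c.Phi (expTau 0 Real.pi)) (c.LPhi k) = if k = 0 then c.LPhi k else -c.LPhi k := by
  have h := Ad_hom_genVec (Φ := c.Phi) (L := c.LPhi) c.Phi_continuous (fun _ => rfl)
    (expTau 0 Real.pi) (axis k)
  rw [genVec_axis] at h
  rw [h, rot_expTau_zero]
  simp only [genVec, Fin.sum_univ_three, axis]
  fin_cases k <;> simp

/-- `Θ` commutes with the adjoint action of the rotation by `π` about the first axis, and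
composed with it commutes with the whole action of `SU(2)`. -/
theorem twist_Ad_Phi_pi (hG : IsClosed (G : Set (UGroup N))) (hΘ : IsTwist G T Θ)
    (h0 : Θ (c.LPhi 0) = c.LPhi 0) {x : Mat N} (hx : x ∈ lieAlgC G) :
    Θ (Ad (c.Phi (expTau 0 Real.pi)) x) = Ad (c.Phi (expTau 0 Real.pi)) (Θ x) := by
  rw [Phi_expTau]
  refine map_Ad_exp hG hΘ.lie ((lieAlg G).smul_mem _ (c.LPhi_mem 0)) _ ?_ hx
  rw [← Complex.coe_smul, map_smul, h0]

theorem twist_LPhi_two (hΘ : IsTwist G T Θ)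
    (h0 : Θ (c.LPhi 0) = c.LPhi 0) (h1 : Θ (c.LPhi 1) = -c.LPhi 1) :
    Θ (c.LPhi 2) = -c.LPhi 2 := by
  rw [← c.isSu2_LPhi.lie01, hΘ.lie _ (lieAlg_le_lieAlgC (c.LPhi_mem 0)) _
    (lieAlg_le_lieAlgC (c.LPhi_mem 1)), h0, h1, lie_neg]

theorem twist_Ad_Phi (hG : IsClosed (G : Set (UGroup N))) (hΘ : IsTwist G T Θ)
    (h0 : Θ (c.LPhi 0) = c.LPhi 0) (h1 : Θ (c.LPhi 1) = -c.LPhi 1) (s : SU2) {x : Mat N}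
    (hx : x ∈ lieAlgC G) :
    Ad (c.Phi (expTau 0 Real.pi))⁻¹ (Θ (Ad (c.Phi s) x))
      = Ad (c.Phi s) (Ad (c.Phi (expTau 0 Real.pi))⁻¹ (Θ x)) := by
  have h2 := c.twist_LPhi_two hΘ h0 h1
  set P := c.Phi (expTau 0 Real.pi) with hP
  set D : Mat N →ₗ[ℂ] Mat N := Ad P⁻¹ ∘ₗ Θ
  have hD : ∀ x ∈ lieAlgC G, ∀ y ∈ lieAlgC G, D ⁅x, y⁆ = ⁅D x, D y⁆ := fun x hx y hy => by
    change Ad P⁻¹ (Θ _) = _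
    rw [hΘ.lie x hx y hy, Ad_lie]; rfl
  have hDL : ∀ k, D (c.LPhi k) = c.LPhi k := by
    intro k
    change Ad P⁻¹ (Θ _) = _
    have hk := c.Ad_Phi_pi k
    rw [← hP] at hk
    have e : Θ (c.LPhi k) = Ad P (c.LPhi k) := by
      rw [hk]
      fin_cases k
      · simpa using h0
      · simpa using h1
      · simpa using h2
    rw [e, Ad_inv_Ad]
  have h : ∀ (k : Fin 3) (t : ℝ), ∀ x ∈ lieAlgC G,
      D (Ad (c.Phi (expTau k t)) x) = Ad (c.Phi (expTau k t)) (D x) := by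
    intro k t x hx
    rw [Phi_expTau]
    refine map_Ad_exp hG hD ((lieAlg G).smul_mem _ (c.LPhi_mem k)) _ ?_ hx
    rw [← Complex.coe_smul, map_smul, hDL]
  change D _ = Ad _ (D x)
  obtain ⟨a, b, t, rfl⟩ := exists_euler_angles s
  have m2 := Ad_mem_lieAlgC (c.Phi_mem (expTau 2 t)) hx
  rw [map_mul, map_mul, Ad_mul, Ad_mul, h _ _ _ (Ad_mem_lieAlgC (c.Phi_mem _) m2), h _ _ _ m2,
    h _ _ _ hx, Ad_mul, Ad_mul]

/-- The reflected potential at `x`, in terms of the potential on the third axis. -/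
theorem twist_A_neg (hG : IsClosed (G : Set (UGroup N))) (hΘ : IsTwist G T Θ)
    (h0 : Θ (c.LPhi 0) = c.LPhi 0) (h1 : Θ (c.LPhi 1) = -c.LPhi 1) (s : SU2) (r t u : ℝ)
    (w : E3) :
    Ad (c.Phi (expTau 0 Real.pi))⁻¹
        (Θ (c.A (t, -rot s (r • axis 2)) (u, -rot s w)))
      = Ad (c.Phi s) (Θ (c.A (t, r • axis 2) (u, !₂[-w 0, w 1, w 2]))) := by
  have e1 : -rot s (r • axis 2) = rot (s * expTau 0 Real.pi) (r • axis 2) := by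
    rw [rot_mul, rot_expTau_zero, ← neg_one_smul ℝ (rot s _), ← rot_smul]
    congr 1
    ext i
    fin_cases i <;> simp [axis]
  have e2 : -rot s w = rot (s * expTau 0 Real.pi) !₂[-w 0, w 1, w 2] := by
    rw [rot_mul, rot_expTau_zero, ← neg_one_smul ℝ (rot s _), ← rot_smul]
    congr 1
    ext i
    fin_cases i <;> simp
  have m : c.A (t, r • axis 2) (u, !₂[-w 0, w 1, w 2]) ∈ lieAlgC G :=
    lieAlg_le_lieAlgC (c.A_mem _ _)
  rw [e1, e2, A_rot_eq, map_mul, Ad_mul,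
    c.twist_Ad_Phi hG hΘ h0 h1 s (Ad_mem_lieAlgC (c.Phi_mem _) m), c.twist_Ad_Phi_pi hG hΘ h0 m,
    Ad_inv_Ad]

end Twist

end Configuration

end EYM
end

noncomputable section

namespace EYM

open NormedSpace Filter

variable {N : ℕ}

namespace Configuration

variable {G T : Subgroup (UGroup N)} {S : Set (LTDual T)} (c : Configuration G)
  {Θ : Mat N →ₗ[ℂ] Mat N}

/-! ### Purely magnetic fields with real amplitudes are CP-symmetric -/

theorem twist_magnetic (h0 : Θ (c.LPhi 0) = c.LPhi 0) (h1 : Θ (c.LPhi 1) = -c.LPhi 1) {r : ℝ}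
    (hw : Θ (c.wang 0 r) = c.wang 0 r ∧ Θ (c.wang 1 r) = -c.wang 1 r) :
    Θ (c.magnetic 0 r) = c.magnetic 0 r ∧ Θ (c.magnetic 1 r) = -c.magnetic 1 r := by
  simp only [wang_eq, map_add, h0, h1, neg_add] at hw
  exact ⟨add_left_cancel hw.1, add_left_cancel hw.2⟩

theorem twist_A_axis
    (hm : ∀ r : ℝ, 0 ≤ r →
      Θ (c.magnetic 0 r) = c.magnetic 0 r ∧ Θ (c.magnetic 1 r) = -c.magnetic 1 r)
    {r : ℝ} (hr : 0 ≤ r) (w : E3) :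
    Θ (c.A (0, r • axis 2) (0, !₂[-w 0, w 1, w 2])) = c.A (0, r • axis 2) (0, w) := by
  rcases hr.eq_or_lt with rfl | hpos
  · simp [zero_smul, A_origin]
  · have e1 := c.smul_A_axis r w
    have e2 := congrArg Θ (c.smul_A_axis r !₂[-w 0, w 1, w 2])
    simp only [← Complex.coe_smul, map_smul, map_sub, (hm r hr).1, (hm r hr).2] at e2
    refine smul_right_injective (Mat N) (r := ((r : ℝ) : ℂ))
      (by exact_mod_cast hpos.ne') ?_
    change (r : ℂ) • _ = (r : ℂ) • _
    rw [Complex.coe_smul (r : ℝ) (c.A (0, r • axis 2) (0, w)), e1, e2]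
    simp

theorem exists_rot_eq (x v : E3) :
    ∃ (s : SU2) (w : E3), x = rot s (‖x‖ • axis 2) ∧ v = rot s w := by
  obtain ⟨a, b, h⟩ := exists_rot_axis x
  refine ⟨_, rot (expTau 2 a * expTau 1 b)⁻¹ v, h, ?_⟩
  rw [← rot_mul, mul_inv_cancel, rot_one]

theorem IsPurelyMagnetic.isCPSymmetric {c : Configuration G}
    (hG : IsClosed (G : Set (UGroup N))) (hT : IsTorusIn T G)
    (hS : IsRootBase G T S) (B : ChevalleyWeylBasis G T S) {Hl : lieAlg T}
    (hgen : c.IsGeneric S Hl) (hm : c.IsPurelyMagnetic) (hr : c.HasRealAmplitudes B Hl) :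
    c.IsCPSymmetric B := by
  refine ⟨c.metric_parity, ?_⟩
  obtain ⟨g, hg, hw⟩ := (c.hasRealAmplitudes_iff hG hT hS B hgen).1 hr
  have hΘ := B.isTwist hT hS hgen.2 hg
  obtain ⟨h0, h1⟩ := hw 0 le_rfl
  rw [wang_at_zero] at h0
  rw [wang_at_zero] at h1
  have hmag := fun r hr => c.twist_magnetic h0 h1 (hw r hr)
  set P := c.Phi (expTau 0 Real.pi) with hP
  set V : UGroup N := P⁻¹ * (g * g) with hV
  have hgG := hT.le hg
  refine ⟨fun _ => V, ⟨fun _ => G.mul_mem (G.inv_mem (c.Phi_mem _)) (G.mul_mem hgG hgG),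
    contDiff_const⟩, ?_⟩
  rintro ⟨t, x⟩ ⟨u, v⟩
  have e : gaugeTransform c.A (fun _ => V) (t, x) (u, v) = Ad V⁻¹ (c.A (t, x) (u, v)) := by
    rw [gaugeTransform, Ad_apply]
    have e1 : fderiv ℝ (fun _ : M4 => (V : Mat N)) (t, x) = 0 := fderiv_const_apply _
    have e2 : star ((V⁻¹ : UGroup N) : Mat N) = (V : Mat N) := star_star _
    rw [e1, e2]
    simp
  rw [← B.chev_coe, e]
  change B.chev (c.A (t, -x) (u, -v)) = _
  suffices h : Ad V (B.chev (c.A (t, -x) (u, -v))) = c.A (t, x) (u, v) by rw [← h, Ad_inv_Ad]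
  rw [hV, Ad_mul]
  change Ad P⁻¹ (B.twist g _) = _
  obtain ⟨s, w, hx, hv⟩ := exists_rot_eq x v
  rw [hm.A_time, hm.A_time t x u v]
  rw [hx, hv, c.twist_A_neg hG hΘ h0 h1, c.twist_A_axis hmag (norm_nonneg x), ← A_rot_eq]

/-! ### CP-symmetric fields are purely magnetic with real amplitudes -/

/-- In the radial gauge a gauge transformation that relates the potential to its reflection is
constant. -/
theorem IsCPSymmetric.exists_const {c : Configuration G} {B : ChevalleyWeylBasis G T S}
    (h : c.IsCPSymmetric B) :
    ∃ V ∈ G, ∀ (t : ℝ) (x : E3) (u : ℝ) (v : E3),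
      Ad V (B.chev (c.A (t, -x) (u, -v))) = c.A (t, x) (u, v) := by
  obtain ⟨-, V, hV, h⟩ := h
  have hd : Differentiable ℝ fun m => (V m : Mat N) := hV.smooth.differentiable (by simp)
  have h' : ∀ (t : ℝ) (x : E3) (u : ℝ) (v : E3), B.chev (c.A (t, -x) (u, -v))
      = gaugeTransform c.A V (t, x) (u, v) := fun t x u v => by
    rw [← h (t, x) (u, v), ← B.chev_coe]; rfl
  have hz : ∀ (t : ℝ) (x : E3) (u : ℝ) (v : E3), c.A (t, x) (u, v) = 0 →
      c.A (t, -x) (u, -v) = 0 → fderiv ℝ (fun m => (V m : Mat N)) (t, x) (u, v) = 0 := by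
    intro t x u v h1 h2
    have h3 := h' t x u v
    rw [h2, map_zero, gaugeTransform, h1, mul_zero, zero_mul, zero_add] at h3
    have h4 := congrArg (fun y => (V (t, x) : Mat N) * y) h3
    simp only [mul_zero, ← mul_assoc] at h4
    have h5 : (V (t, x) : Mat N) * (((V (t, x))⁻¹ : UGroup N) : Mat N) = 1 :=
      Unitary.coe_mul_star_self _
    rw [h5, one_mul] at h4
    exact h4.symm
  have hrad : ∀ t x, (V (t, x) : Mat N) = V (t, 0) := by
    intro t x
    have hγ : ∀ s : ℝ, HasDerivAt (fun s : ℝ => (V (t, s • x) : Mat N)) 0 s := by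
      intro s
      have h1 : HasDerivAt (fun s : ℝ => ((t, s • x) : M4)) (0, x) s := by
        have h2 := (hasDerivAt_id s).smul_const x
        rw [one_smul] at h2
        exact (hasDerivAt_const s t).prodMk h2
      have h2 := (hd (t, s • x)).hasFDerivAt.comp_hasDerivAt s h1
      have h3 : fderiv ℝ (fun m => (V m : Mat N)) (t, s • x) (0, x) = 0 := by
        rcases eq_or_ne s 0 with rfl | hs
        · rw [zero_smul]
          exact hz t 0 0 x (by rw [A_origin]; rfl) (by rw [neg_zero, A_origin]; rfl)
        · have h4 : fderiv ℝ (fun m => (V m : Mat N)) (t, s • x) (s • ((0, x) : M4)) = 0 := by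
            rw [Prod.smul_mk, smul_zero]
            exact hz t _ 0 _ (c.A_radial _ _) (c.A_radial _ _)
          rw [map_smul] at h4
          exact (smul_eq_zero_iff_right hs).1 h4
      rw [h3] at h2
      exact h2
    have h1 := is_const_of_deriv_eq_zero (fun s => (hγ s).differentiableAt)
      (fun s => (hγ s).deriv) 1 0
    simpa using h1
  have htime : ∀ t, (V (t, 0) : Mat N) = V (0, 0) := by
    intro t
    have hγ : ∀ s : ℝ, HasDerivAt (fun s : ℝ => (V (s, 0) : Mat N)) 0 s := by
      intro s
      have h1 : HasDerivAt (fun s : ℝ => ((s, 0) : M4)) (1, 0) s :=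
        (hasDerivAt_id s).prodMk (hasDerivAt_const s 0)
      have h2 := (hd (s, 0)).hasFDerivAt.comp_hasDerivAt s h1
      rw [hz s 0 1 0 (by rw [A_origin]; rfl) (by rw [neg_zero, A_origin]; rfl)] at h2
      exact h2
    exact is_const_of_deriv_eq_zero (fun s => (hγ s).differentiableAt)
      (fun s => (hγ s).deriv) t 0
  have hconst : ∀ m, V m = V (0, 0) := fun m => Subtype.ext ((hrad m.1 m.2).trans (htime m.1))
  refine ⟨V (0, 0), hV.mem _, fun t x u v => ?_⟩
  have hf : fderiv ℝ (fun m => (V m : Mat N)) (t, x) = 0 := by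
    rw [show (fun m => (V m : Mat N)) = fun _ => (V (0, 0) : Mat N) from
      funext fun m => by rw [hconst m]]
    exact fderiv_const_apply _
  rw [h', gaugeTransform, hf, hconst (t, x)]
  have e : (((V (0, 0))⁻¹ : UGroup N) : Mat N) * c.A (t, x) (u, v) * (V (0, 0) : Mat N)
      = Ad (V (0, 0))⁻¹ (c.A (t, x) (u, v)) := by
    rw [Ad_apply]
    congr 1
    exact (star_star _).symm
  rw [e]
  simp

/-- The group element `k` maps the orbit of `x` under the action of `SU(2)` to that of `y`,
compatibly with the action. -/
def Intertwines (k : UGroup N) (x y : Mat N) : Prop :=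
  ∀ s : SU2, Ad k (Ad (c.Phi s) x) = Ad (c.Phi s) y

namespace Intertwines

variable {c} {k : UGroup N} {x y x' y' : Mat N}

theorem add (h : c.Intertwines k x y) (h' : c.Intertwines k x' y') :
    c.Intertwines k (x + x') (y + y') := fun s => by simp only [map_add, h s, h' s]

theorem smul (h : c.Intertwines k x y) (z : ℂ) : c.Intertwines k (z • x) (z • y) := fun s => by
  simp only [map_smul, h s]

theorem star (h : c.Intertwines k x y) : c.Intertwines k (star x) (star y) := fun s => by
  rw [← star_Ad, ← star_Ad, ← star_Ad, h s]

theorem lie (h : c.Intertwines k x y) (i : Fin 3) :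
    c.Intertwines k ⁅c.LPhi i, x⁆ ⁅c.LPhi i, y⁆ := by
  intro s
  have hx := ((Ad k ∘ₗ Ad (c.Phi s)).restrictScalars
    ℝ).toContinuousLinearMap.hasFDerivAt.comp_hasDerivAt (0 : ℝ) (c.hasDerivAt_Ad_Phi i x)
  have hy := ((Ad (c.Phi s)).restrictScalars ℝ).toContinuousLinearMap.hasFDerivAt.comp_hasDerivAt
    (0 : ℝ) (c.hasDerivAt_Ad_Phi i y)
  refine hx.unique (hy.congr_of_eventuallyEq (Eventually.of_forall fun t => ?_))
  have h1 := h (s * expTau i t)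
  rw [map_mul, Ad_mul, Ad_mul] at h1
  exact h1

theorem eq_zero (hG : IsClosed (G : Set (UGroup N))) (hc : IsConnected (G : Set (UGroup N)))
    (hreg : ∀ x ∈ lieAlgC G, ∀ y ∈ lieAlgC G, ⁅c.LPhi 2, x⁆ = 0 → ⁅c.LPhi 2, y⁆ = 0 → ⁅x, y⁆ = 0)
    (hk : k ∈ G) {a : Mat N} (ha : a ∈ lieAlg G) (h2 : ⁅c.LPhi 2, a⁆ = 0)
    (h : c.Intertwines k (-a) a) : a = 0 := by
  let U : Submodule ℂ (Mat N) :=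
    { carrier := {x | x ∈ lieAlgC G ∧ c.Intertwines k (-x) x}
      zero_mem' := ⟨(lieAlgC G).zero_mem, fun s => by simp⟩
      add_mem' := fun hx hy => ⟨(lieAlgC G).add_mem hx.1 hy.1, by
        rw [neg_add]; exact hx.2.add hy.2⟩
      smul_mem' := fun z x hx => ⟨(lieAlgC G).smul_mem z hx.1, by
        rw [← smul_neg]; exact hx.2.smul z⟩ }
  refine eq_zero_of_Ad_eq_neg (U := U) hG hc c.isSu2_LPhi c.LPhi_mem hreg (fun x hx => hx.1)
    (fun x hx => ⟨star_mem_lieAlgC hx.1, by rw [← star_neg]; exact hx.2.star⟩)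
    (fun i x hx => ⟨lie_mem_lieAlgC (lieAlg_le_lieAlgC (c.LPhi_mem i)) hx.1, ?_⟩) hk
    (fun x hx => ?_) (⟨lieAlg_le_lieAlgC ha, h⟩ : a ∈ U) (star_eq_neg_of_mem ha) h2
  · rw [← lie_neg]; exact hx.2.lie i
  · have h1 := hx.2 1
    rw [map_one, Ad_one, Ad_one, map_neg] at h1
    exact neg_eq_iff_eq_neg.1 h1

end Intertwines

theorem lie_two_lie_add {L : Fin 3 → Mat N} (hL : IsSu2 L) {X Y : Mat N} (hX : ⁅L 2, X⁆ = Y)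
    (hY : ⁅L 2, Y⁆ = -X) : ⁅L 2, ⁅L 0, X⁆ + ⁅L 1, Y⁆⁆ = 0 := by
  have l21 : ⁅L 2, L 1⁆ = -L 0 := by rw [← lie_skew, hL.lie12]
  rw [lie_add, leibniz_lie (L 2) (L 0), leibniz_lie (L 2) (L 1), hX, hY, hL.lie20, l21, neg_lie,
    lie_neg]
  abel

theorem lie_two_lie_sub {L : Fin 3 → Mat N} (hL : IsSu2 L) {X Y : Mat N} (hX : ⁅L 2, X⁆ = Y)
    (hY : ⁅L 2, Y⁆ = -X) : ⁅L 2, ⁅L 0, Y⁆ - ⁅L 1, X⁆⁆ = 0 := by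
  have l21 : ⁅L 2, L 1⁆ = -L 0 := by rw [← lie_skew, hL.lie12]
  rw [lie_sub, leibniz_lie (L 2) (L 0), leibniz_lie (L 2) (L 1), hX, hY, hL.lie20, l21, neg_lie,
    lie_neg]
  abel

/-- The difference of `X + i Y` and its reflected conjugate is a lowest weight vector of positive
weight, hence zero. -/
theorem twist_eq_of_lie_add_eq_zero (hΘ : IsTwist G T Θ) {L : Fin 3 → Mat N} (hL : IsSu2 L)
    (hLm : ∀ k, L k ∈ lieAlgC G) (hcent : ∀ x ∈ lieAlgC G, ⁅L 2, x⁆ = 0 → x ∈ lieAlgC T)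
    (h0 : Θ (L 0) = L 0) (h1 : Θ (L 1) = -L 1) (h2 : Θ (L 2) = -L 2) {X Y : Mat N}
    (hXm : X ∈ lieAlgC G) (hYm : Y ∈ lieAlgC G) (hX : ⁅L 2, X⁆ = Y) (hY : ⁅L 2, Y⁆ = -X)
    (hq : ⁅L 0, X⁆ + ⁅L 1, Y⁆ = 0) : Θ (X - Complex.I • Y) = X + Complex.I • Y := by
  have hp := hcent _ ((lieAlgC G).sub_mem (lie_mem_lieAlgC (hLm 0) hYm)
    (lie_mem_lieAlgC (hLm 1) hXm)) (lie_two_lie_sub hL hX hY)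
  set p := ⁅L 0, Y⁆ - ⁅L 1, X⁆
  have hm : X - Complex.I • Y ∈ lieAlgC G :=
    (lieAlgC G).sub_mem hXm ((lieAlgC G).smul_mem _ hYm)
  have hLp : L 0 + Complex.I • L 1 ∈ lieAlgC G :=
    (lieAlgC G).add_mem (hLm 0) ((lieAlgC G).smul_mem _ (hLm 1))
  have e1 : ⁅L 0 - Complex.I • L 1, X + Complex.I • Y⁆ = Complex.I • p := by
    have e : ⁅L 0 - Complex.I • L 1, X + Complex.I • Y⁆
        = (⁅L 0, X⁆ - (Complex.I * Complex.I) • ⁅L 1, Y⁆) + Complex.I • p := by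
      simp only [p, sub_lie, lie_add, smul_lie, lie_smul, smul_sub, mul_smul]
      abel
    rw [e, Complex.I_mul_I, neg_one_smul, sub_neg_eq_add, hq, zero_add]
  have e2 : ⁅L 0 + Complex.I • L 1, X - Complex.I • Y⁆ = -(Complex.I • p) := by
    have e : ⁅L 0 + Complex.I • L 1, X - Complex.I • Y⁆
        = (⁅L 0, X⁆ - (Complex.I * Complex.I) • ⁅L 1, Y⁆) - Complex.I • p := by
      simp only [p, add_lie, lie_sub, smul_lie, lie_smul, smul_sub, smul_add, mul_smul]
      abel
    rw [e, Complex.I_mul_I, neg_one_smul, sub_neg_eq_add, hq, zero_sub]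
  have e3 : ⁅L 0 - Complex.I • L 1, Θ (X - Complex.I • Y)⁆ = Complex.I • p := by
    have e := hΘ.lie _ hLp _ hm
    rw [e2, map_add, map_smul, h0, h1, map_neg, map_smul, hΘ.torus p hp, smul_neg, neg_neg,
      smul_neg, ← sub_eq_add_neg] at e
    exact e.symm
  have hd2 : ⁅L 2, X + Complex.I • Y - Θ (X - Complex.I • Y)⁆
      = (-Complex.I) • (X + Complex.I • Y - Θ (X - Complex.I • Y)) := by
    have e := hΘ.lie _ (hLm 2) _ hm
    have e4 : ⁅L 2, X - Complex.I • Y⁆ = Complex.I • (X - Complex.I • Y) := by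
      rw [lie_sub, lie_smul, hX, hY, smul_sub, smul_smul, Complex.I_mul_I]
      module
    rw [e4, map_smul, h2, neg_lie] at e
    rw [lie_sub, ← neg_eq_iff_eq_neg.2 e, lie_add, lie_smul, hX, hY, smul_sub, smul_add,
      smul_smul, neg_mul, Complex.I_mul_I]
    module
  refine (sub_eq_zero.1 (hL.eq_zero_of_lie_lower hd2 ?_)).symm
  rw [lie_sub, e1, e3, sub_self]

theorem IsCPSymmetric.isPurelyMagnetic_and {c : Configuration G}
    (hG : IsClosed (G : Set (UGroup N))) (hc : IsConnected (G : Set (UGroup N)))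
    (hT : IsTorusIn T G) (hS : IsRootBase G T S) {B : ChevalleyWeylBasis G T S} {Hl : lieAlg T}
    (hgen : c.IsGeneric S Hl) (h : c.IsCPSymmetric B) :
    c.IsPurelyMagnetic ∧ c.HasRealAmplitudes B Hl := by
  rw [c.hasRealAmplitudes_iff hG hT hS B hgen]
  obtain ⟨V, hVG, hV⟩ := h.exists_const
  obtain ⟨g, hg, h0, h1⟩ := c.exists_twist_LPhi hG hT hS B hgen
  have hΘ := B.isTwist hT hS hgen.2 hg
  have hL := c.isSu2_LPhi
  have hL2 : B.twist g (c.LPhi 2) = -c.LPhi 2 := c.twist_LPhi_two hΘ h0 h1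
  have hcent : ∀ x ∈ lieAlgC G, ⁅c.LPhi 2, x⁆ = 0 → x ∈ lieAlgC T := fun x hx hx2 =>
    B.mem_lieAlgC_torus hT hS hgen.2 hx ((ChevalleyWeylBasis.lie_two_eq_zero hgen.1).1 hx2)
  have hreg : ∀ x ∈ lieAlgC G, ∀ y ∈ lieAlgC G, ⁅c.LPhi 2, x⁆ = 0 → ⁅c.LPhi 2, y⁆ = 0 →
      ⁅x, y⁆ = 0 := fun x hx y hy hx2 hy2 => hT.lie_eq_zero' (hcent x hx hx2) (hcent y hy hy2)
  have hLm : ∀ k, c.LPhi k ∈ lieAlgC G := fun k => lieAlg_le_lieAlgC (c.LPhi_mem k)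
  set P := c.Phi (expTau 0 Real.pi) with hP
  set k : UGroup N := V * (g * g)⁻¹ * P with hk
  have hgG := hT.le hg
  have hkG : k ∈ G := G.mul_mem (G.mul_mem hVG (G.inv_mem (G.mul_mem hgG hgG))) (c.Phi_mem _)
  have hAd : ∀ x, Ad V (B.chev x) = Ad k (Ad P⁻¹ (B.twist g x)) := by
    intro x
    rw [hk, Ad_mul, Ad_Ad_inv, B.twist_apply, Ad_mul, Ad_inv_Ad]
  -- The symmetry, transported to the third axis.
  have hrel : ∀ (r u : ℝ) (w : E3),
      c.Intertwines k (B.twist g (c.A (0, r • axis 2) (u, !₂[-w 0, w 1, w 2])))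
        (c.A (0, r • axis 2) (u, w)) := by
    intro r u w s
    rw [← c.twist_A_neg hG hΘ h0 h1, ← hAd, hV, A_rot_eq]
  have hinv : ∀ a ∈ lieAlg G, ⁅c.LPhi 2, a⁆ = 0 → c.Intertwines k (B.twist g a) a → a = 0 := by
    intro a ha ha2 hka
    rw [hΘ.torus a (hcent a (lieAlg_le_lieAlgC ha) ha2)] at hka
    exact hka.eq_zero hG hc hreg hkG ha ha2
  refine ⟨fun r _ => ?_, g, hg, fun r _ => ?_⟩
  · refine hinv _ (c.A_mem _ _) (c.lie_LPhi_two_electric r) ?_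
    have h2 := hrel r 1 0
    rw [show (!₂[-(0 : E3) 0, (0 : E3) 1, (0 : E3) 2] : E3) = 0 by
      ext i; fin_cases i <;> simp] at h2
    exact h2
  · have hM0 : c.Intertwines k (B.twist g (c.magnetic 0 r)) (c.magnetic 0 r) := by
      have h2 := hrel r 0 (axis 1)
      rw [show (!₂[-(axis 1) 0, (axis 1) 1, (axis 1) 2] : E3) = axis 1 by
        ext i; fin_cases i <;> simp [axis]] at h2
      have h3 := h2.smul ((-r : ℝ) : ℂ)
      rwa [← map_smul, Complex.coe_smul, ← c.magnetic_zero_eq] at h3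
    have hM1 : c.Intertwines k (-B.twist g (c.magnetic 1 r)) (c.magnetic 1 r) := by
      have h2 := hrel r 0 (axis 0)
      rw [show (!₂[-(axis 0) 0, (axis 0) 1, (axis 0) 2] : E3) = -axis 0 by
        ext i; fin_cases i <;> simp [axis]] at h2
      have h3 := h2.smul ((r : ℝ) : ℂ)
      rw [show ((0 : ℝ), -axis 0) = -((0 : ℝ), axis 0) by simp, map_neg, ← map_smul,
        Complex.coe_smul, Complex.coe_smul, smul_neg, ← c.magnetic_one_eq, map_neg] at h3
      exact h3
    have hMm : ∀ k, c.magnetic k r ∈ lieAlgC G := fun k => lieAlg_le_lieAlgC (c.magnetic_mem k r)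
    have l0 := c.lie_LPhi_two_magnetic_zero r
    have l1 := c.lie_LPhi_two_magnetic_one r
    have hq : ⁅c.LPhi 0, c.magnetic 0 r⁆ + ⁅c.LPhi 1, c.magnetic 1 r⁆ = 0 := by
      refine hinv _ ((lieAlg G).add_mem ((lieAlg G).lie_mem (c.LPhi_mem 0) (c.magnetic_mem 0 r))
        ((lieAlg G).lie_mem (c.LPhi_mem 1) (c.magnetic_mem 1 r))) (lie_two_lie_add hL l0 l1) ?_
      rw [map_add, hΘ.lie _ (hLm 0) _ (hMm 0), hΘ.lie _ (hLm 1) _ (hMm 1), h0, h1, neg_lie,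
        ← lie_neg]
      exact (hM0.lie 0).add (hM1.lie 1)
    have h3 := twist_eq_of_lie_add_eq_zero hΘ hL hLm hcent h0 h1 hL2 (hMm 0) (hMm 1) l0 l1 hq
    have h4 := (twist_star_raise_iff hΘ (c.magnetic_mem 0 r) (c.magnetic_mem 1 r)).1 (by
      rw [star_add, star_smul, star_eq_neg_of_mem (c.magnetic_mem 0 r),
        star_eq_neg_of_mem (c.magnetic_mem 1 r), ← h3, ← map_neg]
      congr 1
      simp only [Complex.star_def, Complex.conj_I, neg_smul, smul_neg, neg_neg]
      abel)
    rw [wang_eq, wang_eq, map_add, map_add, h0, h1, h4.1, h4.2, neg_add]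
    exact ⟨rfl, rfl⟩

end Configuration

end EYM
end

noncomputable section

namespace EYM

open NormedSpace Filter

variable {N : ℕ}

/-! ### The amplitudes of a neutral field at infinity -/

theorem tendsto_or_tendsto_neg_of_sq {f : ℝ → ℝ} (hf : Continuous f) {a : ℝ} (ha : a ≠ 0)
    (h : Tendsto (fun r => f r ^ 2) atTop (𝓝 (a ^ 2))) :
    Tendsto f atTop (𝓝 a) ∨ Tendsto f atTop (𝓝 (-a)) := by
  have habs : Tendsto (fun r => |f r|) atTop (𝓝 |a|) := by
    have h1 := (Real.continuous_sqrt.tendsto _).comp h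
    simpa only [Function.comp_def, Real.sqrt_sq_eq_abs] using h1
  obtain ⟨R, hR⟩ := eventually_atTop.1 (h.eventually_ne (pow_ne_zero 2 ha))
  have hR0 : ∀ r ≥ R, f r ≠ 0 := fun r hr h0 => hR r hr (by rw [h0]; ring)
  have hsign : (∀ r ≥ R, 0 < f r) ∨ (∀ r ≥ R, f r < 0) := by
    by_contra! hcon
    obtain ⟨⟨p, hp, hp'⟩, q, hq, hq'⟩ := hcon
    obtain ⟨z, hz, hz0⟩ := (isPreconnected_Ici (a := R)).intermediate_value hp hq hf.continuousOn
      (⟨hp', hq'⟩ : (0 : ℝ) ∈ Set.Icc (f p) (f q))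
    exact hR0 z hz hz0
  have hlim : Tendsto f atTop (𝓝 |a|) ∨ Tendsto f atTop (𝓝 (-|a|)) := by
    rcases hsign with hs | hs
    · exact Or.inl (habs.congr' ((eventually_ge_atTop R).mono fun r hr => abs_of_pos (hs r hr)))
    · refine Or.inr (habs.neg.congr' ((eventually_ge_atTop R).mono fun r hr => ?_))
      rw [abs_of_neg (hs r hr), neg_neg]
  rcases abs_choice a with h1 | h1 <;> rw [h1] at hlim
  · exact hlim
  · rw [neg_neg] at hlim
    exact hlim.symm

namespace ChevalleyWeylBasis

variable {G T : Subgroup (UGroup N)} {S : Set (LTDual T)} (B : ChevalleyWeylBasis G T S)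
  {H : lieAlg T}

/-- The moment map of a vector of level two. -/
theorem trace_lie_star [DecidableEq (roots G T)] (hT : IsTorusIn T G)
    (hS : IsRootBase G T S) {x : Mat N}
    (hx : x ∈ lieAlgC G)
    (hx2 : ⁅(H : Mat N), x⁆ = (2 * (Real.pi : ℂ) * Complex.I * 2) • x) {β : roots G T}
    {X : lieAlg T}
    (hX : ∀ α : roots G T, (α : LTDual T) H = 2 →
      (α : LTDual T) X = Pi.single (M := fun _ => ℝ) β 1 α) :
    (⁅x, star x⁆ * (X : Mat N)).trace
      = 2 * Real.pi * Complex.I * (‖B.basis.repr ⟨x, hx⟩ (Sum.inr β)‖ ^ 2 : ℝ)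
        * ip (B.e β) (B.e β) := by
  have := B.finite_index
  let := Fintype.ofFinite (S ⊕ roots G T)
  set d : S ⊕ roots G T → ℂ := fun i => B.basis.repr ⟨x, hx⟩ i with hd
  have hsum : x = ∑ i, d i • (B.basis i : Mat N) := B.eq_sum ⟨x, hx⟩
  have hd0 : ∀ i, (∀ α : roots G T, i = Sum.inr α → (α : LTDual T) H ≠ 2) → d i = 0 :=
    fun i hi => B.repr_eq_zero_of_level hT hS H hx hx2 i hi
  have e1 : (⁅x, star x⁆ * (X : Mat N)).trace = ip x ⁅(X : Mat N), x⁆ := by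
    simp only [ip, Ring.lie_def, sub_mul, mul_sub, Matrix.trace_sub]
    congr 1
    · rw [Matrix.mul_assoc, Matrix.trace_mul_comm, Matrix.mul_assoc]
    · rw [Matrix.mul_assoc]
  have e2 : ⁅(X : Mat N), x⁆ = (2 * Real.pi * Complex.I * d (Sum.inr β)) • B.e β := by
    conv_lhs => rw [hsum]
    rw [lie_sum, Finset.sum_eq_single (Sum.inr β)]
    · rw [lie_smul, B.basis_inr, (B.e_mem β β.2).2 X, smul_smul]
      by_cases h2 : (β : LTDual T) H = 2
      · rw [hX β h2, Pi.single_eq_same]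
        congr 1
        push_cast
        ring
      · rw [hd0 _ (by rintro α h; cases h; exact h2)]
        simp
    · rintro i - hi
      by_cases h : ∃ α : roots G T, i = Sum.inr α ∧ (α : LTDual T) H = 2
      · obtain ⟨α, rfl, h2⟩ := h
        rw [lie_smul, B.basis_inr, (B.e_mem α α.2).2 X, hX α h2,
          Pi.single_eq_of_ne (fun h => hi (by rw [h]))]
        simp
      · push Not at h
        rw [hd0 i h, zero_smul, lie_zero]
    · simp
  have e3 : ip x (B.e β) = star (d (Sum.inr β)) * ip (B.e β) (B.e β) := by
    conv_lhs => rw [hsum]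
    rw [show ip (∑ i, d i • (B.basis i : Mat N)) (B.e β)
        = ∑ i, star (d i) * ip (B.basis i : Mat N) (B.e β) by
      simp only [ip, star_sum, Finset.sum_mul, Matrix.trace_sum, star_smul, Matrix.smul_mul,
        Matrix.trace_smul, smul_eq_mul]]
    rw [Finset.sum_eq_single (Sum.inr β), B.basis_inr]
    · rintro i - hi
      by_cases h : ∃ α : roots G T, i = Sum.inr α ∧ (α : LTDual T) H = 2
      · obtain ⟨α, rfl, h2⟩ := h
        rw [B.basis_inr, (B.e_mem α α.2).ip_eq_zero (B.e_mem β β.2)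
          (fun h => hi (by rw [Subtype.ext h])), mul_zero]
      · push Not at h
        rw [hd0 i h, star_zero, zero_mul]
    · simp
  rw [e1, e2, ip_smul_right, e3]
  have e4 : d (Sum.inr β) * star (d (Sum.inr β)) = ((‖d (Sum.inr β)‖ ^ 2 : ℝ) : ℂ) := by
    rw [Complex.star_def, Complex.mul_conj, Complex.normSq_eq_norm_sq]
  rw [← e4]
  ring

end ChevalleyWeylBasis

namespace Configuration

variable {G T : Subgroup (UGroup N)} {S : Set (LTDual T)} (c : Configuration G)

theorem continuous_wang (k : Fin 3) : Continuous (c.wang k) := by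
  have h1 : Continuous fun r : ℝ => ((0, r • axis 2) : M4) := by fun_prop
  have h2 : ∀ r : ℝ, c.wang k r
      = c.LPhi k + r • c.A (0, r • axis 2) (0, rotField k (axis 2)) := by
    intro r
    rw [wang]
    congr 1
    rw [← map_smul]
    congr 1
    simp [rotField]
  rw [funext h2]
  exact continuous_const.add (continuous_id.smul
    ((c.A_smooth.continuous.comp h1).clm_apply continuous_const))

theorem continuous_wangPlusMat (g : G) : Continuous (c.wangPlusMat g) := by
  have h : Continuous fun r => c.wang 0 r + Complex.I • c.wang 1 r :=
    (c.continuous_wang 0).add ((c.continuous_wang 1).const_smul Complex.I)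
  exact (continuous_const.mul h).mul continuous_const

theorem tendsto_lie_wang (hn : c.IsNeutral) :
    Tendsto (fun r => ⁅c.wang 0 r, c.wang 1 r⁆) atTop (𝓝 (c.LPhi 2)) := by
  have h : Tendsto (fun r => ⁅c.wang 0 r, c.wang 1 r⁆ - c.LPhi 2) atTop (𝓝 0) :=
    Tendsto.congr c.sq_smul_curvature hn
  have h2 := h.add_const (c.LPhi 2)
  simp only [sub_add_cancel, zero_add] at h2
  exact h2

/-- The amplitudes of a neutral field converge, up to signs that a torus element absorbs, to their
values at the origin. -/
theorem exists_tendsto_wang (hT : IsTorusIn T G)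
    (hS : IsRootBase G T S) (B : ChevalleyWeylBasis G T S) {Hl : lieAlg T}
    (hgen : c.IsGeneric S Hl) (hr : c.HasRealAmplitudes B Hl) (hn : c.IsNeutral) :
    ∃ X : lieAlg T, ∀ k, k ≠ 2 → Tendsto (c.wang k) atTop
      (𝓝 (Ad (expU (X : Mat N) (star_eq_neg_of_mem X.2)) (c.LPhi k))) := by
  classical
  obtain ⟨g, hg, hreal⟩ := hr
  set W : ℝ → lieAlgC G := fun r => ⟨c.wangPlusMat g r, c.wangPlusMat_mem g r⟩ with hW
  have hginv : ∀ x : Mat N, star ((g : UGroup N) : Mat N) * x * ((g : UGroup N) : Mat N)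
      = Ad (g : UGroup N)⁻¹ x := fun x => by
    rw [Ad_apply]
    have e : (((g : UGroup N)⁻¹ : UGroup N) : Mat N) = star ((g : UGroup N) : Mat N) := rfl
    rw [e, star_star]
  have hWAd : ∀ r, (W r : Mat N)
      = Ad (g : UGroup N)⁻¹ (c.wang 0 r + Complex.I • c.wang 1 r) := fun r => hginv _
  have hgL2 : Ad (g : UGroup N)⁻¹ (c.LPhi 2) = c.LPhi 2 := by
    rw [hgen.1, ← smul_neg, ← Complex.coe_smul, map_smul, map_neg,
      ChevalleyWeylBasis.Ad_torus hT (T.inv_mem hg) (lieAlg_le_lieAlgC Hl.2)]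
  have hW2 : ∀ r, ⁅(Hl : Mat N), (W r : Mat N)⁆
      = (2 * (Real.pi : ℂ) * Complex.I * 2) • (W r : Mat N) := by
    intro r
    refine ChevalleyWeylBasis.lie_level hgen.1 ?_
    have h := congrArg (Ad (g : UGroup N)⁻¹) (c.lie_LPhi_two_wang_raise r)
    rwa [Ad_lie, map_smul, hgL2, ← hWAd] at h
  have hWc : Continuous W :=
    (c.continuous_wangPlusMat g).subtype_mk _
  have hrepr : ∀ i, Continuous fun y : lieAlgC G => B.basis.repr y i := fun i =>
    (B.basis.coord i).continuous_of_finiteDimensional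
  have hlie : ∀ r, ⁅(W r : Mat N), star (W r : Mat N)⁆
      = Ad (g : UGroup N)⁻¹ ((2 * Complex.I) • ⁅c.wang 0 r, c.wang 1 r⁆) := by
    intro r
    rw [hWAd, star_Ad, ← Ad_lie]
    congr 1
    rw [star_add, star_smul, star_eq_neg_of_mem (c.wang_mem 0 r),
      star_eq_neg_of_mem (c.wang_mem 1 r)]
    simp only [add_lie, lie_add, smul_lie, lie_smul, lie_neg, lie_self, Complex.star_def,
      Complex.conj_I, neg_smul, smul_neg, neg_neg, smul_zero,
      ← lie_skew (c.wang 1 r : Mat N) (c.wang 0 r)]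
    module
  have hlim : Tendsto (fun r => ⁅(W r : Mat N), star (W r : Mat N)⁆) atTop
      (𝓝 ⁅(W 0 : Mat N), star (W 0 : Mat N)⁆) := by
    have hAd : Continuous (Ad (g : UGroup N)⁻¹) := LinearMap.continuous_of_finiteDimensional _
    rw [hlie 0, wang_at_zero, wang_at_zero, c.isSu2_LPhi.lie01]
    exact Tendsto.congr (fun r => (hlie r).symm)
      ((hAd.tendsto _).comp ((c.tendsto_lie_wang hn).const_smul (2 * Complex.I)))
  have hsq : ∀ β : roots G T, (β : LTDual T) Hl = 2 →
      Tendsto (fun r => ‖B.basis.repr (W r) (Sum.inr β)‖ ^ 2) atTop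
        (𝓝 (‖B.basis.repr (W 0) (Sum.inr β)‖ ^ 2)) := by
    intro β hβ
    obtain ⟨X, hX⟩ := B.exists_root_values hT hS hgen.2 c.isSu2_LPhi c.LPhi_mem hgen.1
      (fun α => if hα : α ∈ roots G T then Pi.single (M := fun _ => ℝ) β 1 ⟨α, hα⟩ else 0)
    have hX' : ∀ α : roots G T, (α : LTDual T) Hl = 2 →
        (α : LTDual T) X = Pi.single (M := fun _ => ℝ) β 1 α := fun α hα => by
      rw [hX α hα, dif_pos α.2]
    have hc0 : 2 * Real.pi * Complex.I * ip (B.e β) (B.e β) ≠ 0 := by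
      refine mul_ne_zero Complex.two_pi_I_ne_zero fun h => ?_
      have h1 := ip_self_eq_zero.1 h
      rw [← B.basis_inr β] at h1
      exact B.basis.ne_zero (Sum.inr β) (Subtype.ext h1)
    have htr : ∀ r, (((‖B.basis.repr (W r) (Sum.inr β)‖ ^ 2 : ℝ) : ℂ))
        = (2 * Real.pi * Complex.I * ip (B.e β) (B.e β))⁻¹
          * (⁅(W r : Mat N), star (W r : Mat N)⁆ * (X : Mat N)).trace := by
      intro r
      rw [B.trace_lie_star hT hS (W r).2 (hW2 r) hX', eq_inv_mul_iff_mul_eq₀ hc0]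
      ring
    have hcont : Continuous fun y : Mat N => (2 * Real.pi * Complex.I * ip (B.e β) (B.e β))⁻¹
        * (y * (X : Mat N)).trace :=
      continuous_const.mul (Continuous.matrix_trace (continuous_id.mul continuous_const))
    have h1 := (hcont.tendsto _).comp hlim
    rw [← htr 0] at h1
    have h2 : Tendsto (fun r => (((‖B.basis.repr (W r) (Sum.inr β)‖ ^ 2 : ℝ) : ℂ))) atTop
        (𝓝 (((‖B.basis.repr (W 0) (Sum.inr β)‖ ^ 2 : ℝ) : ℂ))) :=
      Tendsto.congr (fun r => (htr r).symm) h1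
    have h3 := (Complex.continuous_re.tendsto _).comp h2
    exact h3
  have hne : ∀ β : roots G T, (β : LTDual T) Hl = 2 → B.basis.repr (W 0) (Sum.inr β) ≠ 0 := by
    intro β hβ
    -- `Ad g⁻¹` conjugates the triple at the origin to another one with the same third element.
    have hL' : IsSu2 fun k => Ad (g : UGroup N)⁻¹ (c.LPhi k) := c.isSu2_LPhi.conj _
    have h := B.coeff_raise_ne_zero hT hS hgen.2 hL'
      (fun k => Ad_mem_lieAlg (G.inv_mem g.2) (c.LPhi_mem k)) (hgL2.trans hgen.1) β hβ
    convert h using 3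
    apply Subtype.ext
    rw [hWAd, map_add, map_smul, wang_at_zero, wang_at_zero]
  have hsign : ∀ β : roots G T, (β : LTDual T) Hl = 2 → ∃ ε : ℝ, (ε = 0 ∨ ε = 1 / 2) ∧
      Tendsto (fun r => B.basis.repr (W r) (Sum.inr β)) atTop
        (𝓝 (Complex.exp (2 * Real.pi * Complex.I * (ε : ℂ)) * B.basis.repr (W 0) (Sum.inr β))) := by
    intro β hβ
    have him : ∀ r : ℝ, 0 ≤ r → (((B.basis.repr (W r) (Sum.inr β)).re : ℝ) : ℂ)
        = B.basis.repr (W r) (Sum.inr β) := fun r hr =>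
      Complex.ext rfl (by
        rw [Complex.ofReal_im]
        exact (hreal β (hS.mem_levelTwoRoots hgen.2 β.2 hβ) r hr).symm)
    have h0 := him 0 le_rfl
    have hfc : Continuous fun r => (B.basis.repr (W r) (Sum.inr β)).re :=
      Complex.continuous_re.comp ((hrepr _).comp hWc)
    have hsq' : Tendsto (fun r => (B.basis.repr (W r) (Sum.inr β)).re ^ 2) atTop
        (𝓝 ((B.basis.repr (W 0) (Sum.inr β)).re ^ 2)) := by
      have hn2 : ∀ r : ℝ, 0 ≤ r → ‖B.basis.repr (W r) (Sum.inr β)‖ ^ 2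
          = (B.basis.repr (W r) (Sum.inr β)).re ^ 2 := fun r hr => by
        rw [← him r hr, Complex.norm_real, Real.norm_eq_abs, sq_abs, Complex.ofReal_re]
      rw [← hn2 0 le_rfl]
      exact (hsq β hβ).congr' ((eventually_ge_atTop 0).mono hn2)
    have hre0 : (B.basis.repr (W 0) (Sum.inr β)).re ≠ 0 := fun h => by
      rw [h, Complex.ofReal_zero] at h0
      exact hne β hβ h0.symm
    rcases tendsto_or_tendsto_neg_of_sq hfc hre0 hsq' with h | h
    · refine ⟨0, Or.inl rfl, ?_⟩
      rw [Complex.ofReal_zero, mul_zero, Complex.exp_zero, one_mul, ← h0]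
      exact ((Complex.continuous_ofReal.tendsto _).comp h).congr'
        ((eventually_ge_atTop 0).mono him)
    · refine ⟨1 / 2, Or.inr rfl, ?_⟩
      have e : Complex.exp (2 * Real.pi * Complex.I * ((1 / 2 : ℝ) : ℂ)) = -1 := by
        rw [← Complex.exp_pi_mul_I]
        congr 1
        push_cast
        ring
      rw [e, neg_one_mul, ← h0, ← Complex.ofReal_neg]
      exact ((Complex.continuous_ofReal.tendsto _).comp h).congr'
        ((eventually_ge_atTop 0).mono him)
  choose! ε _ hε using hsign
  obtain ⟨X, hX⟩ := B.exists_root_values hT hS hgen.2 c.isSu2_LPhi c.LPhi_mem hgen.1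
    (fun α => if hα : α ∈ roots G T then ε ⟨α, hα⟩ else 0)
  set t := expU (X : Mat N) (star_eq_neg_of_mem X.2) with ht
  have htT : t ∈ T := ChevalleyWeylBasis.expU_mem hT X
  refine ⟨X, ?_⟩
  set W' : lieAlgC G := ⟨Ad t (W 0), Ad_mem_lieAlgC (hT.le htT) (W 0).2⟩ with hW'
  have hW'2 : ⁅(Hl : Mat N), (W' : Mat N)⁆
      = (2 * (Real.pi : ℂ) * Complex.I * 2) • (W' : Mat N) := by
    have h := congrArg (Ad t) (hW2 0)
    rwa [Ad_lie, map_smul, ChevalleyWeylBasis.Ad_torus hT htT (lieAlg_le_lieAlgC Hl.2)] at h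
  have hcoord : ∀ i, Tendsto (fun r => B.basis.repr (W r) i) atTop (𝓝 (B.basis.repr W' i)) := by
    intro i
    by_cases h : ∃ α : roots G T, i = Sum.inr α ∧ (α : LTDual T) Hl = 2
    · obtain ⟨α, rfl, h2⟩ := h
      rw [B.repr_Ad_exp hT hS X (W 0) W' α rfl, hX α h2, dif_pos α.2]
      exact hε α h2
    · push Not at h
      have e : ∀ r, B.basis.repr (W r) i = 0 := fun r =>
        B.repr_eq_zero_of_level hT hS Hl (W r).2 (hW2 r) i h
      have e' : B.basis.repr W' i = 0 := B.repr_eq_zero_of_level hT hS Hl W'.2 hW'2 i h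
      simp only [e, e']
      exact tendsto_const_nhds
  have hWlim : Tendsto (fun r => (W r : Mat N)) atTop (𝓝 (W' : Mat N)) := by
    have := B.finite_index
    let := Fintype.ofFinite (S ⊕ roots G T)
    rw [B.eq_sum W']
    exact Tendsto.congr (fun r => (B.eq_sum (W r)).symm)
      (tendsto_finsetSum _ fun i _ => (hcoord i).smul_const _)
  have hcomm : t * (g : UGroup N)⁻¹ = (g : UGroup N)⁻¹ * t :=
    hT.comm t htT _ (T.inv_mem hg)
  have hplus : Tendsto (fun r => c.wang 0 r + Complex.I • c.wang 1 r) atTop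
      (𝓝 (Ad t (c.LPhi 0 + Complex.I • c.LPhi 1))) := by
    have hAd : Continuous (Ad (g : UGroup N)) := LinearMap.continuous_of_finiteDimensional _
    have h := (hAd.tendsto _).comp hWlim
    have e : Ad (g : UGroup N) (W' : Mat N) = Ad t (c.LPhi 0 + Complex.I • c.LPhi 1) := by
      change Ad (g : UGroup N) (Ad t (W 0 : Mat N)) = _
      rw [hWAd, ← Ad_mul t, hcomm, Ad_mul, Ad_Ad_inv, wang_at_zero, wang_at_zero]
    rw [e] at h
    refine Tendsto.congr (fun r => ?_) h
    rw [Function.comp_apply, hWAd, Ad_Ad_inv]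
  have hsk : ∀ x ∈ lieAlg G, ∀ y ∈ lieAlg G,
      star (x + Complex.I • y) = -x + Complex.I • y := fun x hx y hy => by
    rw [star_add, star_smul, star_eq_neg_of_mem hx, star_eq_neg_of_mem hy]
    simp
  have hminus := hplus.star
  have m : ∀ k, Ad t (c.LPhi k) ∈ lieAlg G := fun k => Ad_mem_lieAlg (hT.le htT) (c.LPhi_mem k)
  rw [map_add, map_smul] at hplus hminus
  rw [hsk _ (m 0) _ (m 1)] at hminus
  have hminus' : Tendsto (fun r => -c.wang 0 r + Complex.I • c.wang 1 r) atTop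
      (𝓝 (-Ad t (c.LPhi 0) + Complex.I • Ad t (c.LPhi 1))) :=
    Tendsto.congr (fun r => hsk _ (c.wang_mem 0 r) _ (c.wang_mem 1 r)) hminus
  have h2 : ((2 : ℂ) * Complex.I) ≠ 0 := by simp
  have d0 : ∀ x y : Mat N, (2 : ℂ)⁻¹ • ((x + Complex.I • y) - (-x + Complex.I • y)) = x := by
    intro x y
    module
  have d1 : ∀ x y : Mat N,
      ((2 : ℂ) * Complex.I)⁻¹ • ((x + Complex.I • y) + (-x + Complex.I • y)) = y := by
    intro x y
    rw [show (x + Complex.I • y) + (-x + Complex.I • y) = ((2 : ℂ) * Complex.I) • y by module,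
      smul_smul, inv_mul_cancel₀ h2, one_smul]
  intro k hk
  fin_cases k
  · have h := (hplus.sub hminus').const_smul (2 : ℂ)⁻¹
    simp only [d0] at h
    exact h
  · have h := (hplus.add hminus').const_smul ((2 : ℂ) * Complex.I)⁻¹
    simp only [d1] at h
    exact h
  · exact absurd rfl hk

end Configuration

end EYM
end

noncomputable section

namespace EYM

open NormedSpace Filter

variable {N : ℕ}

/-! ### Equivariant fields on the punctured space -/

theorem contDiff_exp_mat : ContDiff ℝ ∞ (fun x : Mat N => exp x) := by
  let := NormedAlgebra.restrictScalars ℚ ℝ (Mat N)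
  exact contDiff_iff_contDiffAt.2 fun x => (NormedSpace.exp_analytic (𝕂 := ℝ) x).contDiffAt

theorem exp_Ad (g : UGroup N) (x : Mat N) : exp (Ad g x) = Ad g (exp x) :=
  Matrix.exp_units_conj (Unitary.toUnits g) x

theorem norm_Ad (g : UGroup N) (x : Mat N) : ‖Ad g x‖ = ‖x‖ := by
  rw [Ad_apply]
  have h1 := CStarRing.norm_coe_unitary_mul g (x * star (g : Mat N))
  have h2 := CStarRing.norm_mul_coe_unitary x (star g)
  rw [← mul_assoc] at h1
  exact h1.trans h2

/-- The third axis is turned to any point of the upper half-space by a rotation about the first axis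
after one about the second, through angles which depend smoothly on the point. -/
theorem eq_rot_arctan_arcsin {x : E3} (hx : 0 < x 2) :
    x = rot (expTau 0 (-Real.arctan (x 1 / x 2)) * expTau 1 (Real.arcsin (x 0 / ‖x‖)))
      (‖x‖ • axis 2) := by
  have hsq : ‖x‖ ^ 2 = x 0 ^ 2 + x 1 ^ 2 + x 2 ^ 2 := by
    rw [EuclideanSpace.norm_sq_eq]
    simp [Fin.sum_univ_three]
  have hr : 0 < ‖x‖ := norm_pos_iff.2 fun h => by rw [h] at hx; exact lt_irrefl _ hx
  set r := ‖x‖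
  have hle : (x 0 / r) ^ 2 ≤ 1 := by
    rw [div_pow, div_le_one (by positivity)]
    nlinarith [sq_nonneg (x 1), sq_nonneg (x 2)]
  obtain ⟨hl, hu⟩ := abs_le.1 ((sq_le_one_iff_abs_le_one _).1 hle)
  set b := Real.arcsin (x 0 / r)
  have hsb : r * Real.sin b = x 0 := by
    rw [Real.sin_arcsin hl hu]; field_simp
  set q := √(1 + (x 1 / x 2) ^ 2) with hq
  have hq0 : 0 < q := Real.sqrt_pos.2 (by positivity)
  have hq2 : q ^ 2 = 1 + (x 1 / x 2) ^ 2 := Real.sq_sqrt (by positivity)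
  have hcb : r * Real.cos b = x 2 * q := by
    have h1 : 0 ≤ r * Real.cos b := mul_nonneg hr.le (Real.cos_arcsin_nonneg _)
    refine (sq_eq_sq₀ h1 (by positivity)).1 ?_
    have h3 : (x 2 * q) ^ 2 = x 2 ^ 2 + x 1 ^ 2 := by
      rw [mul_pow, hq2]; field_simp
    rw [h3, mul_pow, Real.cos_sq', mul_sub, mul_one, ← mul_pow, hsb, hsq]
    ring
  set a := Real.arctan (x 1 / x 2)
  have hca : Real.cos a = 1 / q := Real.cos_arctan _
  have hsa : Real.sin a = x 1 / x 2 / q := Real.sin_arctan _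
  rw [rot_mul, rot_expTau_one, rot_expTau_zero]
  ext i
  fin_cases i
  · simp [axis]
    linarith
  · simp [axis]
    rw [mul_comm (Real.cos b), hcb, hsa]
    field_simp
  · simp [axis]
    rw [mul_comm (Real.cos b), hcb, hca]
    field_simp

namespace Configuration

variable {G : Subgroup (UGroup N)} (c : Configuration G) {X : Mat N}

theorem exists_eq_rot (x : E3) : ∃ s, x = rot s (‖x‖ • axis 2) :=
  let ⟨_, _, h⟩ := exists_rot_axis x
  ⟨_, h⟩

/-- The field on `ℝ³` which is equivariant under `SU(2)` and takes the value `X` on the positive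
third axis (with an arbitrary value at the origin). -/
def orbitField (X : Mat N) (x : E3) : Mat N := Ad (c.Phi (exists_eq_rot x).choose) X

theorem Ad_Phi_expTau_two (h2 : ⁅c.LPhi 2, X⁆ = 0) (t : ℝ) : Ad (c.Phi (expTau 2 t)) X = X := by
  rw [Phi_expTau]
  exact Ad_exp_eq_self _ (by rw [smul_lie, h2, smul_zero])

theorem orbitField_eq (h2 : ⁅c.LPhi 2, X⁆ = 0) {x : E3} (hx : x ≠ 0) {s : SU2}
    (h : x = rot s (‖x‖ • axis 2)) : c.orbitField X x = Ad (c.Phi s) X := by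
  have h' := (exists_eq_rot x).choose_spec
  rw [orbitField]
  set u := (exists_eq_rot x).choose
  have e : rot (s⁻¹ * u) (axis 2) = axis 2 := by
    have e1 := h'.symm.trans h
    rw [rot_smul, rot_smul] at e1
    have e2 := smul_right_injective E3 (norm_ne_zero_iff.2 hx) e1
    rw [rot_mul, e2, ← rot_mul, inv_mul_cancel, rot_one]
  obtain ⟨t, ht⟩ := exists_eq_expTau_two e
  rw [inv_mul_eq_iff_eq_mul.1 ht, map_mul, Ad_mul, c.Ad_Phi_expTau_two h2]

theorem orbitField_rot (h2 : ⁅c.LPhi 2, X⁆ = 0) (s : SU2) {x : E3} (hx : x ≠ 0) :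
    c.orbitField X (rot s x) = Ad (c.Phi s) (c.orbitField X x) := by
  obtain ⟨u, hu⟩ := exists_eq_rot x
  have hx' : rot s x ≠ 0 := by rw [← norm_ne_zero_iff, norm_rot, norm_ne_zero_iff]; exact hx
  rw [c.orbitField_eq h2 hx hu, ← Ad_mul, ← map_mul]
  refine c.orbitField_eq h2 hx' ?_
  rw [norm_rot, rot_mul, ← hu]

theorem orbitField_mem (hX : X ∈ lieAlg G) (x : E3) : c.orbitField X x ∈ lieAlg G :=
  Ad_mem_lieAlg (c.Phi_mem _) hX

theorem contDiffAt_orbitField_of_pos (h2 : ⁅c.LPhi 2, X⁆ = 0) {x : E3} (hx : 0 < x 2) :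
    ContDiffAt ℝ ∞ (c.orbitField X) x := by
  have hcoord : ∀ i : Fin 3, ContDiff ℝ ∞ fun y : E3 => y i := fun i =>
    (EuclideanSpace.proj (𝕜 := ℝ) i).contDiff
  have hx0 : x ≠ 0 := fun h => by rw [h] at hx; exact lt_irrefl _ hx
  have hev : c.orbitField X =ᶠ[𝓝 x] fun y =>
      exp ((-Real.arctan (y 1 / y 2)) • c.LPhi 0)
        * (exp (Real.arcsin (y 0 / ‖y‖) • c.LPhi 1) * X
          * exp (-(Real.arcsin (y 0 / ‖y‖) • c.LPhi 1)))
        * exp (-((-Real.arctan (y 1 / y 2)) • c.LPhi 0)) := by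
    filter_upwards [((hcoord 2).continuous.tendsto x).eventually_const_lt hx] with y hy
    have hy0 : y ≠ 0 := fun h => by rw [h] at hy; exact lt_irrefl _ hy
    rw [c.orbitField_eq h2 hy0 (eq_rot_arctan_arcsin hy), map_mul, Ad_mul, Phi_expTau, Phi_expTau,
      Ad_exp, Ad_exp]
  refine ContDiffAt.congr_of_eventuallyEq ?_ hev
  have ha : ContDiffAt ℝ ∞ (fun y : E3 => -Real.arctan (y 1 / y 2)) x :=
    (Real.contDiff_arctan.contDiffAt.comp x
      ((hcoord 1).contDiffAt.div (hcoord 2).contDiffAt hx.ne')).neg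
  have hlt : (x 0 / ‖x‖) ^ 2 < 1 := by
    have hsq : ‖x‖ ^ 2 = x 0 ^ 2 + x 1 ^ 2 + x 2 ^ 2 := by
      rw [EuclideanSpace.norm_sq_eq]
      simp [Fin.sum_univ_three]
    have hpos : 0 < ‖x‖ := norm_pos_iff.2 hx0
    rw [div_pow, div_lt_one (by positivity), hsq]
    nlinarith [sq_nonneg (x 1)]
  have hb : ContDiffAt ℝ ∞ (fun y : E3 => Real.arcsin (y 0 / ‖y‖)) x := by
    refine (Real.contDiffAt_arcsin ?_ ?_).comp x
      ((hcoord 0).contDiffAt.div (contDiffAt_norm ℝ hx0) (norm_ne_zero_iff.2 hx0))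
    · intro h; rw [h] at hlt; norm_num at hlt
    · intro h; rw [h] at hlt; norm_num at hlt
  have hexp : ∀ {f : E3 → Mat N}, ContDiffAt ℝ ∞ f x → ContDiffAt ℝ ∞ (fun y => exp (f y)) x :=
    fun hf => contDiff_exp_mat.contDiffAt.comp x hf
  have hA := ha.smul (contDiffAt_const (c := c.LPhi 0))
  have hB := hb.smul (contDiffAt_const (c := c.LPhi 1))
  exact ((hexp hA).mul (((hexp hB).mul contDiffAt_const).mul (hexp hB.neg))).mul (hexp hA.neg)

theorem contDiffAt_orbitField (h2 : ⁅c.LPhi 2, X⁆ = 0) {x : E3} (hx : x ≠ 0) :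
    ContDiffAt ℝ ∞ (c.orbitField X) x := by
  obtain ⟨s, hs⟩ := exists_eq_rot x
  have hev : c.orbitField X =ᶠ[𝓝 x] fun y => Ad (c.Phi s) (c.orbitField X (rotL s⁻¹ y)) := by
    filter_upwards [isOpen_ne.mem_nhds hx] with y hy
    have hy' : rot s⁻¹ y ≠ 0 := by
      rw [← norm_ne_zero_iff, norm_rot, norm_ne_zero_iff]; exact hy
    rw [rotL_apply, ← c.orbitField_rot h2 s hy', ← rot_mul, mul_inv_cancel, rot_one]
  refine ContDiffAt.congr_of_eventuallyEq ?_ hev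
  have e : rotL s⁻¹ x = ‖x‖ • axis 2 := by
    rw [rotL_apply]
    conv_lhs => rw [hs]
    rw [← rot_mul, inv_mul_cancel, rot_one]
  have h1 : ContDiffAt ℝ ∞ (c.orbitField X) (rotL s⁻¹ x) := by
    refine c.contDiffAt_orbitField_of_pos h2 ?_
    rw [e]
    simpa [axis] using hx
  exact ((Ad (c.Phi s)).restrictScalars ℝ).toContinuousLinearMap.contDiff.contDiffAt.comp x
    (h1.comp x (rotL s⁻¹).contDiff.contDiffAt)

/-- A radial cutoff, which vanishes near the origin and equals one far away. -/
def cutoff (x : E3) : ℝ := Real.smoothTransition (‖x‖ ^ 2 - 1)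

theorem contDiff_cutoff : ContDiff ℝ ∞ cutoff :=
  Real.smoothTransition.contDiff.comp ((contDiff_norm_sq ℝ).sub contDiff_const)

theorem cutoff_rot (s : SU2) (x : E3) : cutoff (rot s x) = cutoff x := by
  rw [cutoff, cutoff, norm_rot]

theorem cutoff_eq_zero {x : E3} (hx : ‖x‖ ≤ 1) : cutoff x = 0 :=
  Real.smoothTransition.zero_of_nonpos (by nlinarith [norm_nonneg x])

theorem cutoff_eq_one {x : E3} (hx : 2 ≤ ‖x‖) : cutoff x = 1 :=
  Real.smoothTransition.one_of_one_le (by nlinarith)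

theorem contDiff_cutoff_orbitField (h2 : ⁅c.LPhi 2, X⁆ = 0) :
    ContDiff ℝ ∞ fun x => cutoff x • c.orbitField X x := by
  refine contDiff_iff_contDiffAt.2 fun x => ?_
  rcases eq_or_ne x 0 with rfl | hx
  · refine (contDiffAt_const (c := (0 : Mat N))).congr_of_eventuallyEq ?_
    filter_upwards [Metric.ball_mem_nhds (0 : E3) one_pos] with y hy
    rw [mem_ball_zero_iff] at hy
    rw [cutoff_eq_zero hy.le, zero_smul]
  · exact contDiff_cutoff.contDiffAt.smul (c.contDiffAt_orbitField h2 hx)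

/-- The gauge transformation generated by the equivariant field through `X`, cut off near the
origin. -/
def orbitGauge (X : Mat N) (x : E3) : Mat N := exp (cutoff x • c.orbitField X x)

theorem contDiff_orbitGauge (h2 : ⁅c.LPhi 2, X⁆ = 0) : ContDiff ℝ ∞ (c.orbitGauge X) :=
  contDiff_exp_mat.comp (c.contDiff_cutoff_orbitField h2)

theorem cutoff_orbitField_mem (hX : X ∈ lieAlg G) (x : E3) :
    cutoff x • c.orbitField X x ∈ lieAlg G :=
  (lieAlg G).smul_mem _ (c.orbitField_mem hX x)

theorem orbitGauge_rot (h2 : ⁅c.LPhi 2, X⁆ = 0) (s : SU2) (x : E3) :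
    c.orbitGauge X (rot s x) = Ad (c.Phi s) (c.orbitGauge X x) := by
  have e : cutoff (rot s x) • c.orbitField X (rot s x)
      = Ad (c.Phi s) (cutoff x • c.orbitField X x) := by
    rw [cutoff_rot]
    rcases eq_or_ne x 0 with rfl | hx
    · rw [cutoff_eq_zero (by simp), zero_smul, zero_smul, map_zero]
    · rw [c.orbitField_rot h2 s hx, ← Complex.coe_smul, ← Complex.coe_smul, map_smul]
  rw [orbitGauge, orbitGauge, e, exp_Ad]

theorem orbitGauge_axis (h2 : ⁅c.LPhi 2, X⁆ = 0) {r : ℝ} (hr : 2 ≤ r) :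
    c.orbitGauge X (r • axis 2) = exp X := by
  have hn : ‖r • axis 2‖ = r := by
    rw [norm_smul, Real.norm_eq_abs, abs_of_nonneg (by linarith)]
    simp [axis]
  have h0 : r • axis 2 ≠ 0 := by
    rw [← norm_ne_zero_iff, hn]; linarith
  rw [orbitGauge, cutoff_eq_one (by rw [hn]; exact hr), one_smul,
    c.orbitField_eq h2 h0 (s := 1) (by rw [hn, rot_one]), map_one, Ad_one]

end Configuration

end EYM
end

noncomputable section

namespace EYM

open NormedSpace Filter

variable {N : ℕ}

/-! ### The gauge in which the potential vanishes at infinity -/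

namespace Configuration

variable {G T : Subgroup (UGroup N)} {S : Set (LTDual T)} (c : Configuration G) {X : Mat N}

/-- The spatial part of the potential at time zero, after the gauge transformation `orbitGauge`. -/
def spatialPotential (X : Mat N) (x : E3) : E3 →L[ℝ] Mat N :=
  ContinuousLinearMap.mul ℝ (Mat N) (star (c.orbitGauge X x)) ∘L
    ((ContinuousLinearMap.mul ℝ (Mat N)).flip (c.orbitGauge X x) ∘L
      (c.A (0, x) ∘L ContinuousLinearMap.inr ℝ ℝ E3) + fderiv ℝ (c.orbitGauge X) x)

theorem spatialPotential_apply (x v : E3) : c.spatialPotential X x v =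
    star (c.orbitGauge X x) * (c.A (0, x) (0, v) * c.orbitGauge X x
      + fderiv ℝ (c.orbitGauge X) x v) := rfl

theorem contDiff_spatialPotential (h2 : ⁅c.LPhi 2, X⁆ = 0) :
    ContDiff ℝ ∞ (c.spatialPotential X) := by
  have hW := c.contDiff_orbitGauge h2
  refine contDiff_clm_apply_iff.2 fun v => ?_
  have hA : ContDiff ℝ ∞ fun x : E3 => c.A (0, x) (0, v) :=
    (c.A_smooth.comp (contDiff_const.prodMk contDiff_id)).clm_apply contDiff_const
  have hW' : ContDiff ℝ ∞ fun x : E3 => fderiv ℝ (c.orbitGauge X) x v :=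
    (hW.fderiv_right (m := ∞) (by simp)).clm_apply contDiff_const
  have hs : ContDiff ℝ ∞ fun x : E3 => star (c.orbitGauge X x) :=
    (starL' ℝ (A := Mat N) : Mat N →L[ℝ] Mat N).contDiff.comp hW
  exact hs.mul ((hA.mul hW).add hW')

theorem spatialPotential_mem (hG : IsClosed (G : Set (UGroup N))) (hX : X ∈ lieAlg G)
    (h2 : ⁅c.LPhi 2, X⁆ = 0) (x v : E3) : c.spatialPotential X x v ∈ lieAlg G := by
  have hm : ∀ y, ∃ g ∈ G, (g : Mat N) = c.orbitGauge X y := fun y => by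
    have h := exp_smul_mem_matSet hG (c.cutoff_orbitField_mem hX y) 1
    rw [one_smul] at h
    obtain ⟨g, hg, hgX⟩ := h
    exact ⟨g, hg, hgX⟩
  choose g hg hgW using hm
  rw [spatialPotential_apply, mul_add, ← mul_assoc]
  refine (lieAlg G).add_mem ?_ ?_
  · have h := Ad_mem_lieAlg (G.inv_mem (hg x)) (c.A_mem (0, x) (0, v))
    rw [Ad_apply] at h
    have e : (((g x)⁻¹ : UGroup N) : Mat N) = star (c.orbitGauge X x) := by
      rw [← hgW]; rfl
    rw [e, star_star] at h
    exact h
  · refine ⟨fun t : ℝ => (g x)⁻¹ * g (x + t • v), fun t => G.mul_mem (G.inv_mem (hg _)) (hg _),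
      by simp, ?_⟩
    have h1 : HasDerivAt (fun t : ℝ => x + t • v) v 0 := by
      simpa using ((hasDerivAt_id (0 : ℝ)).smul_const v).const_add x
    have hd := ((c.contDiff_orbitGauge h2).differentiable (by simp) (x + (0 : ℝ) • v)).hasFDerivAt
    have h3 := (hd.comp_hasDerivAt (0 : ℝ) h1).const_mul (star (c.orbitGauge X x))
    rw [zero_smul, add_zero] at h3
    refine h3.congr_of_eventuallyEq (Eventually.of_forall fun t => ?_)
    change star (g x : Mat N) * (g (x + t • v) : Mat N) = _
    rw [hgW, hgW]
    rfl

theorem spatialPotential_rot (h2 : ⁅c.LPhi 2, X⁆ = 0) (s : SU2) (x v : E3) :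
    c.spatialPotential X (rot s x) (rot s v) = Ad (c.Phi s) (c.spatialPotential X x v) := by
  have hd := (c.contDiff_orbitGauge h2).differentiable (by simp)
  have e : fderiv ℝ (c.orbitGauge X) (rot s x) (rot s v)
      = Ad (c.Phi s) (fderiv ℝ (c.orbitGauge X) x v) := by
    have e1 : c.orbitGauge X ∘ rotL s
        = ((Ad (c.Phi s)).restrictScalars ℝ).toContinuousLinearMap ∘ c.orbitGauge X :=
      funext fun y => c.orbitGauge_rot h2 s y
    have h1 := (hd (rotL s x)).hasFDerivAt.comp x (rotL s).hasFDerivAt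
    have h3 := ((Ad (c.Phi s)).restrictScalars ℝ).toContinuousLinearMap.hasFDerivAt.comp x
      (hd x).hasFDerivAt
    rw [e1] at h1
    exact congrArg (fun l => l v) (h1.unique h3)
  have hmul : ∀ a b : Mat N, Ad (c.Phi s) (a * b) = Ad (c.Phi s) a * Ad (c.Phi s) b := fun a b => by
    have h1 : star (c.Phi s : Mat N) * (c.Phi s : Mat N) = 1 := Unitary.coe_star_mul_self _
    simp only [Ad_apply]
    rw [show a * b = a * (star (c.Phi s : Mat N) * (c.Phi s : Mat N)) * b by rw [h1, mul_one]]
    simp only [mul_assoc]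
  rw [spatialPotential_apply, spatialPotential_apply, e, c.orbitGauge_rot h2, A_rot_eq, hmul,
    map_add, hmul, star_Ad]

/-- On the third axis, far from the origin, the new potential measures the deviation of the Wang
map from its limit. -/
theorem smul_spatialPotential_axis (hX : X ∈ lieAlg G) (h2 : ⁅c.LPhi 2, X⁆ = 0) {r : ℝ}
    (hr : 2 < r) (v : E3) :
    r • c.spatialPotential X (r • axis 2) v
      = v 0 • (Ad (expU X (star_eq_neg_of_mem hX))⁻¹ (c.wang 1 r) - c.LPhi 1)
        - v 1 • (Ad (expU X (star_eq_neg_of_mem hX))⁻¹ (c.wang 0 r) - c.LPhi 0) := by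
  have hd := (c.contDiff_orbitGauge h2).differentiable (by simp)
  set t := expU X (star_eq_neg_of_mem hX) with ht
  have htW : c.orbitGauge X (r • axis 2) = (t : Mat N) := c.orbitGauge_axis h2 hr.le
  have hAd : ∀ y, star (t : Mat N) * y * (t : Mat N) = Ad t⁻¹ y := fun y => by
    rw [Ad_apply]
    have e : ((t⁻¹ : UGroup N) : Mat N) = star (t : Mat N) := rfl
    rw [e, star_star]
  have hts : star (t : Mat N) * (t : Mat N) = 1 := Unitary.coe_star_mul_self _
  have hrot : ∀ k, c.spatialPotential X (r • axis 2) (rotField k (r • axis 2))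
      = Ad t⁻¹ (c.wang k r) - c.LPhi k := by
    intro k
    have h1 : fderiv ℝ (c.orbitGauge X) (r • axis 2) (rotField k (r • axis 2))
        = ⁅c.LPhi k, (t : Mat N)⁆ := by
      have h3 := hasDerivAt_rot_expTau k (r • axis 2)
      have h4 := (hd (rot (expTau k 0) (r • axis 2))).hasFDerivAt.comp_hasDerivAt (0 : ℝ) h3
      rw [expTau_zero, rot_one] at h4
      refine h4.unique ((c.hasDerivAt_Ad_Phi k (t : Mat N)).congr_of_eventuallyEq
        (Eventually.of_forall fun s => ?_))
      rw [← htW]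
      exact c.orbitGauge_rot h2 _ _
    rw [spatialPotential_apply, h1, htW, wang, Ring.lie_def, mul_add, ← mul_assoc, mul_sub,
      ← mul_assoc, ← mul_assoc, hts, one_mul, hAd, hAd, map_add]
    abel
  have hrad : c.spatialPotential X (r • axis 2) (axis 2) = 0 := by
    have h1 : fderiv ℝ (c.orbitGauge X) (r • axis 2) (axis 2) = 0 := by
      have h3 : HasDerivAt (fun s : ℝ => s • axis 2) (axis 2) r := by
        simpa using (hasDerivAt_id r).smul_const (axis 2)
      have h4 := (hd (r • axis 2)).hasFDerivAt.comp_hasDerivAt r h3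
      refine h4.unique ((hasDerivAt_const r (exp X)).congr_of_eventuallyEq ?_)
      filter_upwards [eventually_gt_nhds hr] with s hs
      exact c.orbitGauge_axis h2 hs.le
    have h3 : c.A (0, r • axis 2) (0, axis 2) = 0 := by
      have h4 := c.smul_A_axis r (axis 2)
      have hr0 : r ≠ 0 := by linarith
      refine (smul_eq_zero_iff_right hr0).1 (h4.trans ?_)
      simp [axis]
    rw [spatialPotential_apply, h1, h3, zero_mul, add_zero, mul_zero]
  have e0 := hrot 0
  have e1 := hrot 1
  rw [rotField_zero_axis, map_smul] at e0
  rw [rotField_one_axis, map_smul] at e1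
  conv_lhs => rw [eq_sum_axis v]
  rw [map_add, map_add, map_smul, map_smul, map_smul, hrad, ← e0, ← e1]
  module

theorem IsPurelyMagnetic.hasVanishingSpatialGauge {c : Configuration G}
    (hG : IsClosed (G : Set (UGroup N))) (hT : IsTorusIn T G) (hS : IsRootBase G T S)
    (B : ChevalleyWeylBasis G T S) {Hl : lieAlg T} (hgen : c.IsGeneric S Hl)
    (hm : c.IsPurelyMagnetic) (hr : c.HasRealAmplitudes B Hl) (hn : c.IsNeutral) :
    c.HasVanishingSpatialGauge := by
  obtain ⟨Y, hY⟩ := c.exists_tendsto_wang hT hS B hgen hr hn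
  have hX := lieAlg_mono hT.le Y.2
  have h2 : ⁅c.LPhi 2, (Y : Mat N)⁆ = 0 :=
    (ChevalleyWeylBasis.lie_two_eq_zero hgen.1).2 (hT.lie_eq_zero Hl.2 Y.2)
  have hd := (c.contDiff_orbitGauge h2).differentiable (by simp)
  refine ⟨fun m => expU (cutoff m.2 • c.orbitField (Y : Mat N) m.2)
      (star_eq_neg_of_mem (c.cutoff_orbitField_mem hX m.2)), ⟨fun m => ?_, ?_⟩,
    c.spatialPotential Y, c.contDiff_spatialPotential h2, c.spatialPotential_mem hG hX h2,
    fun t x s v => ?_, ?_⟩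
  · obtain ⟨g, hg, hgX⟩ := exp_smul_mem_matSet hG (c.cutoff_orbitField_mem hX m.2) 1
    rw [one_smul] at hgX
    have e : expU (cutoff m.2 • c.orbitField (Y : Mat N) m.2)
        (star_eq_neg_of_mem (c.cutoff_orbitField_mem hX m.2)) = g := Subtype.ext hgX.symm
    exact e ▸ hg
  · exact (c.contDiff_orbitGauge h2).comp contDiff_snd
  · have h1 := (hd x).hasFDerivAt.comp ((t, x) : M4) (hasFDerivAt_snd (𝕜 := ℝ) (p := ((t, x) : M4)))
    have h3 : fderiv ℝ (fun m : M4 => c.orbitGauge (Y : Mat N) m.2) (t, x) (s, v)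
        = fderiv ℝ (c.orbitGauge (Y : Mat N)) x v := by
      rw [show (fun m : M4 => c.orbitGauge (Y : Mat N) m.2)
        = c.orbitGauge (Y : Mat N) ∘ Prod.snd from rfl, h1.fderiv]
      rfl
    rw [gaugeTransform, hm.A_time, spatialPotential_apply, mul_add, ← mul_assoc, ← h3]
    rfl
  · set t := expU (Y : Mat N) (star_eq_neg_of_mem hX) with ht
    set δ : Fin 3 → ℝ → Mat N := fun k r => Ad t⁻¹ (c.wang k r) - c.LPhi k with hδ
    have hAd : Continuous (Ad t⁻¹) := LinearMap.continuous_of_finiteDimensional _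
    have hδ0 : ∀ k, k ≠ 2 → Tendsto (fun r => ‖δ k r‖) atTop (𝓝 0) := by
      intro k hk
      have h := ((hAd.tendsto _).comp (hY k hk)).sub_const (c.LPhi k)
      rw [Ad_inv_Ad, sub_self] at h
      exact tendsto_zero_iff_norm_tendsto_zero.1 h
    have hlim := ((hδ0 1 (by decide)).add (hδ0 0 (by decide))).comp
      (tendsto_norm_cocompact_atTop (E := E3))
    rw [add_zero] at hlim
    refine squeeze_zero' (Eventually.of_forall fun x => by positivity) ?_ hlim
    filter_upwards [tendsto_norm_cocompact_atTop.eventually_gt_atTop 2] with x hx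
    have hb : ‖‖x‖ • c.spatialPotential (Y : Mat N) x‖ ≤ ‖δ 1 ‖x‖‖ + ‖δ 0 ‖x‖‖ := by
      refine ContinuousLinearMap.opNorm_le_bound _ (by positivity) fun v => ?_
      obtain ⟨s, w, hxs, hvw⟩ := exists_rot_eq x v
      have e : (‖x‖ • c.spatialPotential (Y : Mat N) x) v
          = Ad (c.Phi s) (‖x‖ • c.spatialPotential (Y : Mat N) (‖x‖ • axis 2) w) := by
        rw [smul_apply, ← Complex.coe_smul, ← Complex.coe_smul, map_smul,
          ← c.spatialPotential_rot h2, ← hxs, ← hvw]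
      rw [e, norm_Ad, c.smul_spatialPotential_axis hX h2 hx, hvw, norm_rot]
      have hw : ∀ i, ‖w i‖ ≤ ‖w‖ := fun i => PiLp.norm_apply_le w i
      calc _ ≤ ‖w 0 • δ 1 ‖x‖‖ + ‖w 1 • δ 0 ‖x‖‖ := norm_sub_le _ _
        _ ≤ ‖w‖ * ‖δ 1 ‖x‖‖ + ‖w‖ * ‖δ 0 ‖x‖‖ := by
          rw [norm_smul, norm_smul]
          gcongr <;> exact hw _
        _ = _ := by ring
    rw [norm_smul, norm_norm] at hb
    exact hb

end Configuration

end EYM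
end


theorem proposition3 {N : ℕ} (G T : Subgroup (UGroup N))
    (hG : IsClosed (G : Set (UGroup N))) [SimplyConnectedSpace G]
    [LieAlgebra.IsSemisimple ℝ (lieAlg G)]
    (hT : IsMaximalTorus T G)
    (S : Set (LTDual T)) (hS : IsRootBase G T S)
    (B : ChevalleyWeylBasis G T S)
    (c : Configuration G) (Hl : lieAlg T) (hgen : c.IsGeneric S Hl) :
    (c.IsCPSymmetric B ↔ c.IsPurelyMagnetic ∧ c.HasRealAmplitudes B Hl) ∧
    (c.IsPurelyMagnetic ∧ c.HasRealAmplitudes B Hl → c.IsNeutral →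
      c.HasVanishingSpatialGauge) := by
  have hc : IsConnected (G : Set (UGroup N)) := isConnected_iff_connectedSpace.2 inferInstance
  refine ⟨⟨fun h => h.isPurelyMagnetic_and hG hc hT.torus hS hgen,
    fun h => h.1.isCPSymmetric hG hT.torus hS B hgen h.2⟩,
    fun h hn => h.1.hasVanishingSpatialGauge hG hT.torus hS B hgen h.2 hn⟩
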